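/- Let $c_1,c_3,c_5,r_2,r_4,\tau>0$ and $a_0\neq 0$ be real numbers and put $$a_1=2\pi c_3\frac{2c_1}{c_1+c_3},\qquad a_2=2\pi c_3\frac{c_1-c_3}{c_1+c_3},\qquad a_5=\frac{2c_5}{c_5+c_3},$$ $$A=\begin{pmatrix}-a_1r_2&0&a_1a_0\\0&-(a_1-a_2)r_4a_5&0\\0&0&-1\end{pmatrix},\quad B=\begin{pmatrix}0&0&0\\-a_5a_1r_2&0&a_2a_0a_5\\0&-\frac{a_5r_4}{a_0}&0\end{pmatrix},\quad C=\begin{pmatrix}0&0&0\\0&0&0\\-\frac{a_1r_2(a_5-1)}{(a_1-a_2)a_0}&0&\frac{a_2(a_5-1)}{a_1-a_2}\end{pmatrix}.$$ For a function $F:\mathbb R\to\mathbb R$ let $$h(t)=\Bigl(a_1a_0F(t),\ a_1a_0a_5F(t-\tau),\ \tfrac{a_1(a_5-1)}{a_1-a_2}F(t-2\tau)\Bigr)^T,$$ and for $\epsilon\ge 0$ let $E(\epsilon)=\mathrm{diag}(1,1,\epsilon)$. Let $\phi:[-2\tau,0]\to\mathbb R^3$, and for $\epsilon\ge 0$ let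 $x(\epsilon,\cdot)=(x_1,x_2,x_3)(\epsilon,\cdot)$ be the solution of $$\frac{d}{dt}\bigl(E(\epsilon)x(t)\bigr)=Ax(t)+Bx(t-\tau)+Cx(t-2\tau)+h(t),\qquad t\ge 0,$$ with initial function $\phi$; that is, $x=\phi$ on $[-2\tau,0)$, $E(\epsilon)x(0)=E(\epsilon)\phi(0)$, $E(\epsilon)x$ is continuous on $[0,\infty)$, and the equation holds at every $t\ge0$ with the derivative taken from the right. (For $\epsilon=0$ the third row is a difference equation for $x_3$ on $[0,\infty)$, and $x_3(0,\cdot)$ may have jumps.) Suppose that $\phi$ is continuous and of bounded variation on $[-2\tau,0]$ and that $h$ is continuous and of bounded variation on $[0,\infty)$. 1. Then $\lim_{\epsilon\to0^+}x_1(\epsilon,t)=x_1(0,t)$ and $\lim_{\epsilon\to0^+}x_2(\epsilon,t)=x_2(0,t)$, uniformly in $t\in[0,\infty)$. 2. If in addition $\dot\phi$ exists and is continuous and of bounded variation on $[-2\tau,0]$, and $\dot h$ exists and is continuous and of bounded variation on $[0,\infty)$, then $$\lim_{\epsilon\to0^+}x_3(\epsilon,t)=x_3(0,t)\qquad\text{for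 all } t\in CQ:=[0,\infty)\setminus\{j\tau: j=0,1,2,\dots\},$$ uniformly on every compact subset of $CQ$. 3. If, in addition to the assumptions of 2, the compatibility condition $$\frac{d}{dt}\bigl(E(\epsilon)\phi(t)\bigr)\Big|_{t=0^-}=A\phi(0)+B\phi(-\tau)+C\phi(-2\tau)+h(0)$$ holds for $\epsilon=0$, or for arbitrarily small $\epsilon>0$, then $\lim_{\epsilon\to0^+}x_3(\epsilon,t)=x_3(0,t)$ uniformly in $t\in[0,\infty)$. -/

import Mathlib

open Filter Topology Set
open scoped Matrix

/-- The dimensionless parameters of the two-layer scattering model. The numbers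
`cᵢ = cos θᵢ / nᵢ` (refraction angle over refractive index in the dielectrics 1, 3, 5) are positive,
the damping parameters `r₂, r₄` of the two metal layers are positive, the intensity
parameter `a₀` is non-zero, and `τ` is the (positive) delay. -/
structure LayerParams where
  c₁ : ℝ
  c₃ : ℝ
  c₅ : ℝ
  r₂ : ℝ
  r₄ : ℝ
  a₀ : ℝ
  τ : ℝ
  c₁_pos : 0 < c₁
  c₃_pos : 0 < c₃
  c₅_pos : 0 < c₅
  r₂_pos : 0 < r₂
  r₄_pos : 0 < r₄
  a₀_ne_zero : a₀ ≠ 0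
  τ_pos : 0 < τ

namespace LayerParams

noncomputable section

variable (P : LayerParams)

def a₁ : ℝ := 2 * Real.pi * P.c₃ * (2 * P.c₁ / (P.c₁ + P.c₃))

def a₂ : ℝ := 2 * Real.pi * P.c₃ * ((P.c₁ - P.c₃) / (P.c₁ + P.c₃))

def a₅ : ℝ := 2 * P.c₅ / (P.c₅ + P.c₃)

def A : Matrix (Fin 3) (Fin 3) ℝ :=
  !![-(P.a₁ * P.r₂), 0, P.a₁ * P.a₀;
     0, -((P.a₁ - P.a₂) * P.r₄ * P.a₅), 0;
     0, 0, -1]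

def B : Matrix (Fin 3) (Fin 3) ℝ :=
  !![0, 0, 0;
     -(P.a₅ * P.a₁ * P.r₂), 0, P.a₂ * P.a₀ * P.a₅;
     0, -(P.a₅ * P.r₄ / P.a₀), 0]

def C : Matrix (Fin 3) (Fin 3) ℝ :=
  !![0, 0, 0;
     0, 0, 0;
     -(P.a₁ * P.r₂ * (P.a₅ - 1) / ((P.a₁ - P.a₂) * P.a₀)), 0,
       P.a₂ * (P.a₅ - 1) / (P.a₁ - P.a₂)]

/-- The source term produced by the incoming pulse `F`. -/
def source (F : ℝ → ℝ) (t : ℝ) : Fin 3 → ℝ :=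
  ![P.a₁ * P.a₀ * F t,
    P.a₁ * P.a₀ * P.a₅ * F (t - P.τ),
    P.a₁ * (P.a₅ - 1) / (P.a₁ - P.a₂) * F (t - 2 * P.τ)]

/-- `E(ε) = diag(1, 1, ε)`. -/
def E (ε : ℝ) : Matrix (Fin 3) (Fin 3) ℝ :=
  Matrix.diagonal ![1, 1, ε]

/-- The right-hand side `A x(t) + B x(t - τ) + C x(t - 2τ) + h(t)`. -/
def rhs (h x : ℝ → Fin 3 → ℝ) (t : ℝ) : Fin 3 → ℝ :=
  P.A *ᵥ x t + P.B *ᵥ x (t - P.τ) + P.C *ᵥ x (t - 2 * P.τ) + h t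

/-- `x` solves `d/dt (E(ε) x) = A x(t) + B x(t - τ) + C x(t - 2τ) + h(t)`, `t ≥ 0`, with initial
function `φ` on `[-2τ, 0]`.

For `ε > 0` the condition at `0` reads `x(0) = φ(0)`, `x` is continuous, and (the right-hand side
being continuous for continuous `φ`, `h`) the right derivative is an ordinary derivative at every
`t > 0`. For `ε = 0` the third row is the difference equation
`x₃(t) = (B x(t - τ) + C x(t - 2τ) + h(t))₃`, `t ≥ 0`, which determines `x₃(0)`; then `x₃` may jump
at the points `2jτ`, where `x₁` (and at `(2j + 1)τ`, `x₂`) has one-sided derivatives only. -/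
structure IsSolution (ε : ℝ) (φ h x : ℝ → Fin 3 → ℝ) : Prop where
  initial : ∀ t ∈ Ico (-(2 * P.τ)) 0, x t = φ t
  initial_zero : E ε *ᵥ x 0 = E ε *ᵥ φ 0
  continuousOn : ContinuousOn (fun t => E ε *ᵥ x t) (Ici 0)
  hasDeriv : ∀ t, 0 ≤ t → HasDerivWithinAt (fun s => E ε *ᵥ x s) (P.rhs h x t) (Ici t) t

/-- The compatibility condition
`d/dt (E(ε) φ(t)) |_{t = 0⁻} = A φ(0) + B φ(-τ) + C φ(-2τ) + h(0)`. -/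
def Compatible (ε : ℝ) (φ h : ℝ → Fin 3 → ℝ) : Prop :=
  HasDerivWithinAt (fun t => E ε *ᵥ φ t)
    (P.A *ᵥ φ 0 + P.B *ᵥ φ (-P.τ) + P.C *ᵥ φ (-(2 * P.τ)) + h 0) (Icc (-(2 * P.τ)) 0) 0

/-- `[0, ∞)` without the grid points `jτ`, `j = 0, 1, 2, …`. -/
def CQ : Set ℝ := Ici 0 \ {t | ∃ j : ℕ, t = j * P.τ}

end

end LayerParams

/-- `f` is continuous and of bounded variation on `s`. -/
def IsContBV (f : ℝ → Fin 3 → ℝ) (s : Set ℝ) : Prop :=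
  ContinuousOn f s ∧ BoundedVariationOn f s

/-- The derivative of `f` exists on `s` (one-sided at the end points of an interval `s`) and is
continuous and of bounded variation on `s`. -/
def HasContBVDeriv (f : ℝ → Fin 3 → ℝ) (s : Set ℝ) : Prop :=
  DifferentiableOn ℝ f s ∧ IsContBV (derivWithin f s) s

/-! With `X = x₁`, `Z = x₂` and `Q = (a₁ - a₂) a₀ x₃` the system is a feedback loop (`isFamily`):
two layers with decay rates `k₁, k₂ > 0` and reflection coefficients `ρ, s` in `(-1, 1)` exchange
delayed waves, and `Q` relaxes at rate `1 / ε` to its delayed inflow. The three source components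
are delayed multiples of a single function `f`.

On bounded intervals convergence follows by the method of steps (`vanishes_finite_time`). The inflow
on a window of length `τ` depends only on earlier windows, `Q` follows it outside a thin layer at
the left end of the window, and `X`, `Z`, which have fixed rates, do not notice the layer. This also
gives part 2.

On the half-line the loop is not asymptotically stable: it has a line of equilibria `X = v (1 + ρ) /
k₁`, `Z = -v (1 + s) / k₂`, `Q = v`. What holds is settling to within any tolerance of an
equilibrium, after a time independent of `ε ∈ (0, 1]` (`exists_settling_time`). The energy of layers
and travelling waves obeys `V' ≤ -δ D + Λ b (1 + V)`, where `D` is the dissipation, `b` the load and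
`δ, Λ` do not depend on `ε` (`energy_balance`). If `b` is integrable, the total dissipation is
bounded uniformly in `ε`, so among a fixed number of late windows one has small dissipation. There
the state is close to an equilibrium (`exists_energy_shift_le`), and the energy inequality for the
difference from this equilibrium keeps it close forever.

The load is integrable because of bounded variation: subtracting from `X` its quasi-static response
to the sliding mean of `f` leaves forcings bounded by increments `v (t + 1) - v t` of a bounded
monotone `v`. Convergence on bounded intervals and uniform settling together give part 1
(`vanishes_Ici_of_settling`).

For part 3, compatibility makes the initial jump of `Q 0` vanish
(`eq_initial_of_frequently_compatible`). Since a round trip multiplies `Q` by `s ρ` with `|s ρ| <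
1`, both the modulus of continuity of `Q 0` and the error `Q ε - Q 0` reproduce themselves from one
window of length `2τ` to the next (`vanishes_Q`). -/

/-! ### Scalar relaxation equations -/

/-- One-sided comparison for `y' = μ (w - y)` with right derivatives. -/
theorem relaxation_le {μ β σ t : ℝ} {y w : ℝ → ℝ} (hμ : 0 < μ) (hσt : σ ≤ t)
    (hc : ContinuousOn y (Icc σ t))
    (hd : ∀ r ∈ Ico σ t, HasDerivWithinAt y (μ * (w r - y r)) (Ici r) r)
    (hw : ∀ r ∈ Ico σ t, w r ≤ β) :
    y t ≤ β + Real.exp (-(μ * (t - σ))) * (y σ - β) := by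
  have hexp : ∀ r : ℝ, HasDerivAt (fun r => Real.exp (μ * (r - σ)))
      (Real.exp (μ * (r - σ)) * μ) r := fun r => by
    have h := (((hasDerivAt_id r).sub_const σ).const_mul μ).exp
    simpa using h
  -- Integrating factor: `exp (μ (r - σ)) (y r - β)` has right derivative `μ exp (μ (r - σ)) (w r -
  -- β) ≤ 0`.
  have key := image_le_of_deriv_right_le_deriv_boundary
    (f := fun r => Real.exp (μ * (r - σ)) * (y r - β))
    (f' := fun r => Real.exp (μ * (r - σ)) * μ * (y r - β)
      + Real.exp (μ * (r - σ)) * (μ * (w r - y r)))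
    (a := σ) (b := t)
    (ContinuousOn.mul (by fun_prop) (hc.sub continuousOn_const))
    (fun r hr => (hexp r).hasDerivWithinAt.mul ((hd r hr).sub_const β))
    (B := fun _ => y σ - β) (B' := fun _ => 0) (by simp) continuousOn_const
    (fun r _ => hasDerivWithinAt_const _ _ _)
    (fun r hr => by
      have h1 : 0 < Real.exp (μ * (r - σ)) * μ := mul_pos (Real.exp_pos _) hμ
      have h2 := hw r hr
      nlinarith [mul_nonneg h1.le (sub_nonneg.2 h2)])
    (right_mem_Icc.2 hσt)
  have h3 : Real.exp (-(μ * (t - σ))) * Real.exp (μ * (t - σ)) = 1 := by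
    rw [← Real.exp_add]; simp
  have h4 := mul_le_mul_of_nonneg_left key (Real.exp_pos (-(μ * (t - σ)))).le
  rw [← mul_assoc, h3, one_mul] at h4
  linarith

/-- If `y' = μ (w - y)` and `w` stays within `β` of `m`, then `y` relaxes to within `β` of `m`. -/
theorem abs_sub_le_of_relaxation {μ β m σ t : ℝ} {y w : ℝ → ℝ} (hμ : 0 < μ) (hσt : σ ≤ t)
    (hβ : 0 ≤ β) (hc : ContinuousOn y (Icc σ t))
    (hd : ∀ r ∈ Ico σ t, HasDerivWithinAt y (μ * (w r - y r)) (Ici r) r)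
    (hw : ∀ r ∈ Ico σ t, |w r - m| ≤ β) :
    |y t - m| ≤ |y σ - m| * Real.exp (-(μ * (t - σ))) + β := by
  have h1 := relaxation_le (β := m + β) hμ hσt hc hd
    (fun r hr => by linarith [le_of_abs_le (hw r hr)])
  have h2 := relaxation_le (y := fun r => -y r) (w := fun r => -w r) (β := -m + β) hμ hσt hc.neg
    (fun r hr => (hd r hr).neg.congr_deriv (by ring))
    (fun r hr => by linarith [neg_le_of_abs_le (hw r hr)])
  have he := Real.exp_pos (-(μ * (t - σ)))
  have h3 := mul_le_mul_of_nonneg_left (le_abs_self (y σ - m)) he.le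
  have h4 := mul_le_mul_of_nonneg_left (neg_abs_le (y σ - m)) he.le
  have h5 := mul_nonneg he.le hβ
  rw [abs_le]
  constructor <;> nlinarith

theorem abs_le_add_of_relaxation {μ β σ t : ℝ} {y w : ℝ → ℝ} (hμ : 0 < μ) (hσt : σ ≤ t)
    (hβ : 0 ≤ β) (hc : ContinuousOn y (Icc σ t))
    (hd : ∀ r ∈ Ico σ t, HasDerivWithinAt y (μ * (w r - y r)) (Ici r) r)
    (hw : ∀ r ∈ Ico σ t, |w r| ≤ β) : |y t| ≤ |y σ| + β := by
  have h := abs_sub_le_of_relaxation (m := 0) hμ hσt hβ hc hd (by simpa using hw)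
  simp only [sub_zero] at h
  have he : Real.exp (-(μ * (t - σ))) ≤ 1 := by
    rw [Real.exp_le_one_iff]; nlinarith [mul_nonneg hμ.le (sub_nonneg.2 hσt)]
  nlinarith [mul_le_mul_of_nonneg_left he (abs_nonneg (y σ))]

/-- `|y|` stays below `M` as long as it starts below `M` and `|w| ≤ M`. -/
theorem abs_le_of_relaxation {μ M σ t : ℝ} {y w : ℝ → ℝ} (hμ : 0 < μ) (hσt : σ ≤ t)
    (hc : ContinuousOn y (Icc σ t))
    (hd : ∀ r ∈ Ico σ t, HasDerivWithinAt y (μ * (w r - y r)) (Ici r) r)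
    (hw : ∀ r ∈ Ico σ t, |w r| ≤ M) (hσ : |y σ| ≤ M) : |y t| ≤ M := by
  have h1 := relaxation_le (β := M) hμ hσt hc hd (fun r hr => le_of_abs_le (hw r hr))
  have h2 := relaxation_le (y := fun r => -y r) (w := fun r => -w r) (β := M) hμ hσt hc.neg
    (fun r hr => (hd r hr).neg.congr_deriv (by ring))
    (fun r hr => by linarith [neg_le_of_abs_le (hw r hr)])
  have he := Real.exp_pos (-(μ * (t - σ)))
  have h3 := abs_le.1 hσ
  rw [abs_le]
  constructor <;> nlinarith

/-! ### Families that vanish uniformly as `ε → 0⁺` -/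

/-- `D ε → 0` uniformly on `S` as `ε → 0⁺`. -/
def Vanishes (D : ℝ → ℝ → ℝ) (S : Set ℝ) : Prop :=
  ∀ γ > 0, ∀ᶠ ε in 𝓝[>] (0 : ℝ), ∀ t ∈ S, |D ε t| ≤ γ

namespace Vanishes

variable {D D' : ℝ → ℝ → ℝ} {S S' : Set ℝ}

theorem mono (h : Vanishes D S) (hS : S' ⊆ S) : Vanishes D S' := fun γ hγ =>
  (h γ hγ).mono fun _ hε t ht => hε t (hS ht)

theorem add (h : Vanishes D S) (h' : Vanishes D' S) : Vanishes (fun ε t => D ε t + D' ε t) S := by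
  intro γ hγ
  filter_upwards [h (γ / 2) (half_pos hγ), h' (γ / 2) (half_pos hγ)] with ε h1 h2 t ht
  linarith [abs_add_le (D ε t) (D' ε t), h1 t ht, h2 t ht]

theorem const_mul (h : Vanishes D S) (k : ℝ) : Vanishes (fun ε t => k * D ε t) S := by
  intro γ hγ
  have hk : 0 < |k| + 1 := by positivity
  filter_upwards [h (γ / (|k| + 1)) (div_pos hγ hk)] with ε h1 t ht
  have h2 := h1 t ht
  rw [le_div_iff₀ hk] at h2
  rw [abs_mul]
  nlinarith [abs_nonneg (D ε t)]

theorem union (h : Vanishes D S) (h' : Vanishes D S') : Vanishes D (S ∪ S') := by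
  intro γ hγ
  filter_upwards [h γ hγ, h' γ hγ] with ε h1 h2 t ht
  exact ht.elim (h1 t) (h2 t)

theorem comp_sub (h : Vanishes D S) {a : ℝ} (hS : ∀ t ∈ S', t - a ∈ S) :
    Vanishes (fun ε t => D ε (t - a)) S' := fun γ hγ =>
  (h γ hγ).mono fun _ hε t ht => hε _ (hS t ht)

theorem congr (h : Vanishes D S) (he : ∀ ε > 0, ∀ t ∈ S, D ε t = D' ε t) : Vanishes D' S := by
  intro γ hγ
  filter_upwards [h γ hγ, self_mem_nhdsWithin] with ε h1 hε t ht
  rw [← he ε hε t ht]; exact h1 t ht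

theorem of_eq_zero (h : ∀ ε > 0, ∀ t ∈ S, D ε t = 0) : Vanishes D S := by
  intro γ hγ
  filter_upwards [self_mem_nhdsWithin] with ε hε t ht
  rw [h ε hε t ht]; simpa using hγ.le

theorem tendstoUniformlyOn {x : ℝ → ℝ → ℝ} (h : Vanishes (fun ε t => x ε t - x 0 t) S) :
    TendstoUniformlyOn x (x 0) (𝓝[>] 0) S := by
  rw [Metric.tendstoUniformlyOn_iff]
  intro γ hγ
  filter_upwards [h (γ / 2) (half_pos hγ)] with ε h1 t ht
  rw [dist_comm, Real.dist_eq]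
  linarith [h1 t ht]

end Vanishes

/-- A relaxation variable with fixed rate follows its input, uniformly up to the left end point,
even if the input converges only away from that point. -/
theorem vanishes_of_slow_relaxation {μ a b W : ℝ} {y w : ℝ → ℝ → ℝ} (hμ : 0 < μ)
    (hc : ∀ ε > 0, ContinuousOn (y ε) (Icc a b))
    (hd : ∀ ε > 0, ∀ r ∈ Ico a b,
      HasDerivWithinAt (y ε) (μ * (w ε r - y ε r)) (Ici r) r)
    (hW : 0 ≤ W) (hyW : ∀ ε > 0, ∀ r ∈ Icc a b, |y ε r| ≤ W)
    (hwW : ∀ ε > 0, ∀ r ∈ Ico a b, |w ε r| ≤ W)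
    (ha : Vanishes y {a}) (hw : ∀ δ > 0, Vanishes w (Ico (a + δ) b)) :
    Vanishes y (Icc a b) := by
  intro γ hγ
  -- The slope of `y` is at most `2 μ W`, so `y` moves by at most `γ / 3` during time `δ`, whatever
  -- the input does there. The other two thirds are the value at `a` and the input after `a + δ`.
  -- The `+ 1` keeps the denominator positive when `W = 0`.
  set δ := γ / 3 / (μ * (2 * W) + 1) with hδ
  have hden : 0 < μ * (2 * W) + 1 := by positivity
  have hδ0 : 0 < δ := by positivity
  have hδL : μ * (2 * W) * δ ≤ γ / 3 := by
    have : (μ * (2 * W) + 1) * δ = γ / 3 := by rw [hδ]; field_simp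
    nlinarith
  filter_upwards [ha (γ / 3) (by positivity), hw δ hδ0 (γ / 3) (by positivity),
    self_mem_nhdsWithin] with ε h1 h2 hε t ht
  have h1' := h1 a rfl
  have hshort : ∀ r ∈ Icc a b, r ≤ a + δ → |y ε r| ≤ 2 * (γ / 3) := by
    intro r hr hra
    have h3 := norm_image_sub_le_of_norm_deriv_right_le_segment (hc ε hε) (hd ε hε)
      (C := μ * (2 * W)) (fun u hu => by
        rw [Real.norm_eq_abs, abs_mul, abs_of_pos hμ]
        refine mul_le_mul_of_nonneg_left ?_ hμ.le
        linarith [abs_sub (w ε u) (y ε u), hwW ε hε u hu, hyW ε hε u (Ico_subset_Icc_self hu)])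
      r hr
    rw [Real.norm_eq_abs] at h3
    have h4 : μ * (2 * W) * (r - a) ≤ μ * (2 * W) * δ :=
      mul_le_mul_of_nonneg_left (by linarith) (by positivity)
    have h5 := abs_sub_abs_le_abs_sub (y ε r) (y ε a)
    linarith
  rcases le_total t (a + δ) with hta | hta
  · linarith [hshort t ht hta]
  · have h6 := hshort (a + δ) ⟨by linarith, hta.trans ht.2⟩ le_rfl
    have h7 := abs_le_add_of_relaxation (β := γ / 3) hμ hta (by positivity)
      ((hc ε hε).mono (Icc_subset_Icc (by linarith) ht.2))
      (fun r hr => hd ε hε r ⟨by linarith [hr.1], hr.2.trans_le ht.2⟩)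
      (fun r hr => h2 r ⟨hr.1, hr.2.trans_le ht.2⟩)
    linarith

theorem eventually_exp_layer_le {M δ γ : ℝ} (hδ : 0 < δ) (hγ : 0 < γ) :
    ∀ᶠ ε in 𝓝[>] (0 : ℝ), M * Real.exp (-(ε⁻¹ * δ)) ≤ γ := by
  have h1 : Tendsto (fun ε : ℝ => ε⁻¹ * δ) (𝓝[>] 0) atTop :=
    tendsto_inv_nhdsGT_zero.atTop_mul_const hδ
  have h2 : Tendsto (fun ε : ℝ => M * Real.exp (-(ε⁻¹ * δ))) (𝓝[>] 0) (𝓝 (M * 0)) :=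
    (Real.tendsto_exp_neg_atTop_nhds_zero.comp h1).const_mul M
  rw [mul_zero] at h2
  exact h2.eventually_le_const hγ

/-- A relaxation variable with rate `1 / ε` converges to the limit of its inputs away from an
initial layer. -/
theorem vanishes_of_fast_relaxation {a b W : ℝ} {y w : ℝ → ℝ → ℝ} {u : ℝ → ℝ}
    (hc : ∀ ε > 0, ContinuousOn (y ε) (Icc a b))
    (hd : ∀ ε > 0, ∀ r ∈ Ico a b,
      HasDerivWithinAt (y ε) (ε⁻¹ * (w ε r - y ε r)) (Ici r) r)
    (hyW : ∀ ε > 0, ∀ r ∈ Icc a b, |y ε r| ≤ W) (huW : ∀ r ∈ Ico a b, |u r| ≤ W)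
    (hu : UniformContinuousOn u (Ico a b))
    (hw : ∀ δ > 0, Vanishes (fun ε t => w ε t - u t) (Ico (a + δ) b)) :
    ∀ δ > 0, Vanishes (fun ε t => y ε t - u t) (Ico (a + δ) b) := by
  intro δ hδ γ hγ
  obtain ⟨δ₁, hδ₁, hmod⟩ := Metric.uniformContinuousOn_iff.1 hu (γ / 3) (by positivity)
  -- Look back from `t` by `d` and freeze the target at `u t`: on `[t - d, t)` the input is within
  -- `γ / 3` of `u`, because `d ≤ δ / 2` stays clear of `a`, and `u` is within `γ / 3` of `u t`. The
  -- value at `t - d` is forgotten at the rate `exp (-d / ε)`.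
  set d := min (δ₁ / 2) (δ / 2) with hdd
  have hd0 : 0 < d := by positivity
  have hd1 : d < δ₁ := (min_le_left _ _).trans_lt (by linarith)
  have hd2 : d ≤ δ / 2 := min_le_right _ _
  filter_upwards [eventually_exp_layer_le (M := 2 * W) hd0 (show 0 < γ / 3 by positivity),
    hw (δ / 2) (by positivity) (γ / 3) (by positivity), self_mem_nhdsWithin] with ε h1 h2 hε t ht
  have hε' : (0 : ℝ) < ε⁻¹ := inv_pos.2 hε
  have htI : t ∈ Ico a b := ⟨by linarith [ht.1], ht.2⟩
  have hσI : t - d ∈ Ico a b := ⟨by linarith [ht.1], by linarith [ht.2]⟩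
  have h3 := abs_sub_le_of_relaxation (m := u t) (β := 2 * (γ / 3)) (σ := t - d) (t := t) hε'
    (by linarith) (by positivity) ((hc ε hε).mono (Icc_subset_Icc hσI.1 ht.2.le))
    (fun r hr => hd ε hε r ⟨hσI.1.trans hr.1, hr.2.trans ht.2⟩)
    (fun r hr => by
      have h4 := h2 r ⟨by linarith [hr.1, ht.1], hr.2.trans ht.2⟩
      have h5 := hmod r ⟨hσI.1.trans hr.1, hr.2.trans ht.2⟩ t htI (by
        rw [Real.dist_eq, abs_sub_comm, abs_of_nonneg] <;> linarith [hr.1, hr.2])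
      rw [Real.dist_eq] at h5
      have h6 := abs_sub_le (w ε r) (u r) (u t)
      linarith)
  have h7 : |y ε (t - d) - u t| ≤ 2 * W := by
    linarith [abs_sub (y ε (t - d)) (u t), hyW ε hε _ (Ico_subset_Icc_self hσI), huW t htI]
  have h8 := mul_le_mul_of_nonneg_right h7 (Real.exp_pos (-(ε⁻¹ * (t - (t - d))))).le
  have h9 : t - (t - d) = d := by ring
  rw [h9] at h3 h8
  linarith

theorem uniformContinuousOn_add {f g : ℝ → ℝ} {S : Set ℝ} (hf : UniformContinuousOn f S)
    (hg : UniformContinuousOn g S) : UniformContinuousOn (fun t => f t + g t) S := by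
  rw [uniformContinuousOn_iff_restrict] at *
  exact hf.add hg

theorem uniformContinuousOn_const_mul {f : ℝ → ℝ} {S : Set ℝ} (hf : UniformContinuousOn f S)
    (k : ℝ) : UniformContinuousOn (fun t => k * f t) S :=
  (Real.uniformContinuous_const_mul (x := k)).comp_uniformContinuousOn hf

theorem uniformContinuousOn_comp_sub {f : ℝ → ℝ} {S S' : Set ℝ} (hf : UniformContinuousOn f S)
    {a : ℝ} (hS : ∀ t ∈ S', t - a ∈ S) : UniformContinuousOn (fun t => f (t - a)) S' :=
  hf.comp ((uniformContinuous_id.sub uniformContinuous_const).uniformContinuousOn) hS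

/-! ### The scalar feedback loop on bounded time intervals -/

/-- Coefficients of the feedback loop formed by the two layers: `k₁, k₂` are the decay rates of the
layers, `ρ, s` their instantaneous reflection coefficients and `τ` the travel time. -/
structure LoopCoeffs where
  k₁ : ℝ
  k₂ : ℝ
  ρ : ℝ
  s : ℝ
  τ : ℝ
  k₁_pos : 0 < k₁
  k₂_pos : 0 < k₂
  ρ_lt : |ρ| < 1
  s_lt : |s| < 1
  τ_pos : 0 < τ

namespace LoopCoeffs

variable (c : LoopCoeffs)

/-- The input `-k₂ Z(t - τ) + s (-k₁ X(t - 2τ) + ρ Q(t - 2τ)) + H(t)` of the third equation. -/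
def inflow (H X Z Q : ℝ → ℝ) (t : ℝ) : ℝ :=
  -c.k₂ * Z (t - c.τ) + c.s * (-c.k₁ * X (t - 2 * c.τ) + c.ρ * Q (t - 2 * c.τ)) + H t

/-- A family, indexed by `ε ≥ 0`, of solutions of the loop equations
`X' = -k₁ X + (1 + ρ) Q + H₁`,
`Z' = -k₂ Z + (1 + s) (-k₁ X + ρ Q)(t - τ) + H₂`,
`ε Q' = -Q + inflow`, with common initial functions. -/
structure IsFamily (φ₁ φ₂ φ₃ H₁ H₂ H₃ : ℝ → ℝ) (X Z Q : ℝ → ℝ → ℝ) : Prop where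
  φ₁_cont : ContinuousOn φ₁ (Icc (-(2 * c.τ)) 0)
  φ₂_cont : ContinuousOn φ₂ (Icc (-(2 * c.τ)) 0)
  φ₃_cont : ContinuousOn φ₃ (Icc (-(2 * c.τ)) 0)
  H₁_cont : ContinuousOn H₁ (Ici 0)
  H₂_cont : ContinuousOn H₂ (Ici 0)
  H₃_cont : ContinuousOn H₃ (Ici 0)
  X_init : ∀ ε ≥ 0, ∀ t ∈ Icc (-(2 * c.τ)) 0, X ε t = φ₁ t
  Z_init : ∀ ε ≥ 0, ∀ t ∈ Icc (-(2 * c.τ)) 0, Z ε t = φ₂ t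
  Q_init : ∀ ε ≥ 0, ∀ t ∈ Ico (-(2 * c.τ)) 0, Q ε t = φ₃ t
  Q_zero : ∀ ε > 0, Q ε 0 = φ₃ 0
  X_cont : ∀ ε ≥ 0, ContinuousOn (X ε) (Ici (-(2 * c.τ)))
  Z_cont : ∀ ε ≥ 0, ContinuousOn (Z ε) (Ici (-(2 * c.τ)))
  Q_cont : ∀ ε > 0, ContinuousOn (Q ε) (Ici (-(2 * c.τ)))
  X_deriv : ∀ ε ≥ 0, ∀ t ≥ 0, HasDerivWithinAt (X ε)
    (-c.k₁ * X ε t + (1 + c.ρ) * Q ε t + H₁ t) (Ici t) t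
  Z_deriv : ∀ ε ≥ 0, ∀ t ≥ 0, HasDerivWithinAt (Z ε)
    (-c.k₂ * Z ε t + (1 + c.s) * (-c.k₁ * X ε (t - c.τ) + c.ρ * Q ε (t - c.τ)) + H₂ t) (Ici t) t
  Q_deriv : ∀ ε > 0, ∀ t ≥ 0, HasDerivWithinAt (Q ε)
    (ε⁻¹ * (c.inflow H₃ (X ε) (Z ε) (Q ε) t - Q ε t)) (Ici t) t
  Q_limit : ∀ t ≥ 0, Q 0 t = c.inflow H₃ (X 0) (Z 0) (Q 0) t

theorem abs_inflow_le {H X Z Q : ℝ → ℝ} {t M N : ℝ} (hX : |X (t - 2 * c.τ)| ≤ M)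
    (hZ : |Z (t - c.τ)| ≤ M) (hQ : |Q (t - 2 * c.τ)| ≤ M) (hH : |H t| ≤ N) :
    |c.inflow H X Z Q t| ≤ c.k₂ * M + (c.k₁ * M + M) + N := by
  have h1 := abs_add_three (-c.k₂ * Z (t - c.τ))
    (c.s * (-c.k₁ * X (t - 2 * c.τ) + c.ρ * Q (t - 2 * c.τ))) (H t)
  have h2 := abs_add_le (-c.k₁ * X (t - 2 * c.τ)) (c.ρ * Q (t - 2 * c.τ))
  rw [abs_mul, abs_neg, abs_of_pos c.k₁_pos, abs_mul c.ρ] at h2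
  rw [abs_mul, abs_neg, abs_of_pos c.k₂_pos, abs_mul c.s] at h1
  have hM : 0 ≤ M := (abs_nonneg _).trans hX
  have h3 := mul_le_mul_of_nonneg_left hX c.k₁_pos.le
  have h4 := mul_le_mul_of_nonneg_left hZ c.k₂_pos.le
  have h5 := mul_le_mul c.ρ_lt.le hQ (abs_nonneg _) zero_le_one
  have h6 : |c.s| * |-c.k₁ * X (t - 2 * c.τ) + c.ρ * Q (t - 2 * c.τ)| ≤
      1 * (c.k₁ * M + M) :=
    mul_le_mul c.s_lt.le (by linarith) (abs_nonneg _) zero_le_one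
  unfold inflow
  linarith

namespace IsFamily

variable {c} {φ₁ φ₂ φ₃ H₁ H₂ H₃ : ℝ → ℝ} {X Z Q : ℝ → ℝ → ℝ}

/-- The form `μ (w - y)` makes the relaxation estimates applicable to `X ε` and, by subtraction, to
`X ε - X 0`. -/
theorem X_relax (hF : c.IsFamily φ₁ φ₂ φ₃ H₁ H₂ H₃ X Z Q) {ε t : ℝ} (hε : 0 ≤ ε) (ht : 0 ≤ t) :
    HasDerivWithinAt (X ε) (c.k₁ * ((1 + c.ρ) / c.k₁ * Q ε t + H₁ t / c.k₁ - X ε t)) (Ici t) t :=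
  (hF.X_deriv ε hε t ht).congr_deriv (by have := c.k₁_pos.ne'; field_simp; ring)

theorem Z_relax (hF : c.IsFamily φ₁ φ₂ φ₃ H₁ H₂ H₃ X Z Q) {ε t : ℝ} (hε : 0 ≤ ε) (ht : 0 ≤ t) :
    HasDerivWithinAt (Z ε) (c.k₂ * ((1 + c.s) / c.k₂ *
      (-c.k₁ * X ε (t - c.τ) + c.ρ * Q ε (t - c.τ)) + H₂ t / c.k₂ - Z ε t)) (Ici t) t :=
  (hF.Z_deriv ε hε t ht).congr_deriv (by have := c.k₂_pos.ne'; field_simp; ring)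

/-- Bounds on compact time intervals, uniformly in `ε ≥ 0`. -/
theorem exists_bound (hF : c.IsFamily φ₁ φ₂ φ₃ H₁ H₂ H₃ X Z Q)
    (n : ℕ) : ∃ M, ∀ ε ≥ 0, ∀ t ∈ Icc (-(2 * c.τ)) (n * c.τ),
    |X ε t| ≤ M ∧ |Z ε t| ≤ M ∧ |Q ε t| ≤ M := by
  have hτ := c.τ_pos
  have hρ := abs_lt.1 c.ρ_lt
  have hs := abs_lt.1 c.s_lt
  have hk₁ := c.k₁_pos
  have hk₂ := c.k₂_pos
  induction n with
  | zero =>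
    obtain ⟨M₁, h₁⟩ := isCompact_Icc.exists_bound_of_continuousOn hF.φ₁_cont
    obtain ⟨M₂, h₂⟩ := isCompact_Icc.exists_bound_of_continuousOn hF.φ₂_cont
    obtain ⟨M₃, h₃⟩ := isCompact_Icc.exists_bound_of_continuousOn hF.φ₃_cont
    simp only [Real.norm_eq_abs] at h₁ h₂ h₃
    have h0 : (0 : ℝ) ∈ Icc (-(2 * c.τ)) 0 := ⟨by linarith, le_rfl⟩
    have p₁ := (abs_nonneg _).trans (h₁ 0 h0)
    have p₂ := (abs_nonneg _).trans (h₂ 0 h0)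
    have p₃ := (abs_nonneg _).trans (h₃ 0 h0)
    have p₄ := abs_nonneg (Q 0 0)
    -- The limit `Q 0` may jump at `0`, so its value there is not controlled by `φ₃`.
    refine ⟨M₁ + M₂ + M₃ + |Q 0 0|, fun ε hε t ht => ?_⟩
    simp only [Nat.cast_zero, zero_mul] at ht
    rw [hF.X_init ε hε t ht, hF.Z_init ε hε t ht]
    refine ⟨by linarith [h₁ t ht], by linarith [h₂ t ht], ?_⟩
    rcases ht.2.lt_or_eq with h | rfl
    · rw [hF.Q_init ε hε t ⟨ht.1, h⟩]; linarith [h₃ t ht]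
    · rcases hε.lt_or_eq with h | rfl
      · rw [hF.Q_zero ε h]; linarith [h₃ 0 ht]
      · linarith
  | succ n ih =>
    obtain ⟨M, hM⟩ := ih
    have hn : (0 : ℝ) ≤ n * c.τ := by positivity
    have hMn : ∀ ε ≥ 0, |X ε (n * c.τ)| ≤ M ∧ |Z ε (n * c.τ)| ≤ M ∧ |Q ε (n * c.τ)| ≤ M :=
      fun ε hε => hM ε hε _ ⟨by linarith, le_rfl⟩
    have hM0 : 0 ≤ M := (abs_nonneg _).trans (hMn 0 le_rfl).1
    have hsub : Icc (0 : ℝ) ((n + 1 : ℕ) * c.τ) ⊆ Ici 0 := fun t ht => ht.1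
    obtain ⟨N₁, h₁⟩ := isCompact_Icc.exists_bound_of_continuousOn (hF.H₁_cont.mono hsub)
    obtain ⟨N₂, h₂⟩ := isCompact_Icc.exists_bound_of_continuousOn (hF.H₂_cont.mono hsub)
    obtain ⟨N₃, h₃⟩ := isCompact_Icc.exists_bound_of_continuousOn (hF.H₃_cont.mono hsub)
    simp only [Real.norm_eq_abs] at h₁ h₂ h₃
    push_cast at h₁ h₂ h₃ ⊢
    have h0 : (0 : ℝ) ∈ Icc 0 ((n + 1 : ℝ) * c.τ) := ⟨le_rfl, by positivity⟩
    have p₁ := (abs_nonneg _).trans (h₁ 0 h0)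
    have p₂ := (abs_nonneg _).trans (h₂ 0 h0)
    have p₃ := (abs_nonneg _).trans (h₃ 0 h0)
    -- The inflow on the new window contains only delayed values, bounded by the induction
    -- hypothesis. It bounds `Q`, and `Q` in turn bounds `X` on the same window; `Z` needs delayed
    -- values only.
    set W := c.k₂ * M + (c.k₁ * M + M) + N₃ with hW
    have hW0 : 0 ≤ W := by positivity
    have hin : ∀ ε ≥ 0, ∀ t ∈ Icc (n * c.τ) ((n + 1) * c.τ),
        |c.inflow H₃ (X ε) (Z ε) (Q ε) t| ≤ W := fun ε hε t ht =>
      c.abs_inflow_le (hM ε hε _ ⟨by linarith [ht.1], by linarith [ht.2]⟩).1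
        (hM ε hε _ ⟨by linarith [ht.1], by linarith [ht.2]⟩).2.1
        (hM ε hε _ ⟨by linarith [ht.1], by linarith [ht.2]⟩).2.2 (h₃ t ⟨hn.trans ht.1, ht.2⟩)
    have hQ : ∀ ε ≥ 0, ∀ t ∈ Icc (n * c.τ) ((n + 1) * c.τ), |Q ε t| ≤ M + W := by
      intro ε hε t ht
      rcases hε.lt_or_eq with h | rfl
      · have := abs_le_add_of_relaxation (inv_pos.2 h) ht.1 hW0
          ((hF.Q_cont ε h).mono fun r hr => by simp only [mem_Ici]; linarith [hr.1])
          (fun r hr => hF.Q_deriv ε h r (hn.trans hr.1))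
          (fun r hr => hin ε hε r ⟨hr.1, by linarith [hr.2, ht.2]⟩)
        linarith [(hMn ε hε).2.2]
      · rw [hF.Q_limit t (hn.trans ht.1)]
        linarith [hin 0 le_rfl t ht]
    set WX := (2 * (M + W) + N₁) / c.k₁ with hWX
    have hWX0 : 0 ≤ WX := by positivity
    have hX : ∀ ε ≥ 0, ∀ t ∈ Icc (n * c.τ) ((n + 1) * c.τ), |X ε t| ≤ M + WX := by
      intro ε hε t ht
      have := abs_le_add_of_relaxation hk₁ ht.1 hWX0
        ((hF.X_cont ε hε).mono fun r hr => by simp only [mem_Ici]; linarith [hr.1])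
        (fun r hr => hF.X_relax hε (hn.trans hr.1))
        (fun r hr => by
          have hr' : r ∈ Icc (n * c.τ) ((n + 1) * c.τ) := ⟨hr.1, by linarith [hr.2, ht.2]⟩
          have e : (1 + c.ρ) / c.k₁ * Q ε r + H₁ r / c.k₁ = ((1 + c.ρ) * Q ε r + H₁ r) / c.k₁ := by
            ring
          rw [e, abs_div, abs_of_pos hk₁]
          refine div_le_div_of_nonneg_right ?_ hk₁.le
          have a1 := abs_add_le ((1 + c.ρ) * Q ε r) (H₁ r)
          rw [abs_mul, abs_of_pos (show 0 < 1 + c.ρ by linarith)] at a1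
          have a2 : (1 + c.ρ) * |Q ε r| ≤ 2 * (M + W) :=
            mul_le_mul (by linarith) (hQ ε hε r hr') (abs_nonneg _) (by norm_num)
          linarith [h₁ r ⟨hn.trans hr'.1, hr'.2⟩])
      linarith [(hMn ε hε).1]
    set WZ := (2 * (c.k₁ * M + M) + N₂) / c.k₂ with hWZ
    have hWZ0 : 0 ≤ WZ := by positivity
    have hZ : ∀ ε ≥ 0, ∀ t ∈ Icc (n * c.τ) ((n + 1) * c.τ), |Z ε t| ≤ M + WZ := by
      intro ε hε t ht
      have := abs_le_add_of_relaxation hk₂ ht.1 hWZ0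
        ((hF.Z_cont ε hε).mono fun r hr => by simp only [mem_Ici]; linarith [hr.1])
        (fun r hr => hF.Z_relax hε (hn.trans hr.1))
        (fun r hr => by
          have hr' : r ∈ Icc (n * c.τ) ((n + 1) * c.τ) := ⟨hr.1, by linarith [hr.2, ht.2]⟩
          obtain ⟨b1, -, b3⟩ := hM ε hε (r - c.τ) ⟨by linarith [hr'.1], by linarith [hr'.2]⟩
          set g := -c.k₁ * X ε (r - c.τ) + c.ρ * Q ε (r - c.τ) with hg
          have hgb : |g| ≤ c.k₁ * M + M := by
            have a1 := abs_add_le (-c.k₁ * X ε (r - c.τ)) (c.ρ * Q ε (r - c.τ))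
            rw [abs_mul, abs_neg, abs_of_pos hk₁, abs_mul c.ρ] at a1
            have a2 := mul_le_mul_of_nonneg_left b1 hk₁.le
            have a3 := mul_le_mul c.ρ_lt.le b3 (abs_nonneg _) zero_le_one
            linarith
          have e : (1 + c.s) / c.k₂ * g + H₂ r / c.k₂ = ((1 + c.s) * g + H₂ r) / c.k₂ := by
            ring
          rw [e, abs_div, abs_of_pos hk₂]
          refine div_le_div_of_nonneg_right ?_ hk₂.le
          have a1 := abs_add_le ((1 + c.s) * g) (H₂ r)
          rw [abs_mul, abs_of_pos (show 0 < 1 + c.s by linarith)] at a1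
          have a2 : (1 + c.s) * |g| ≤ 2 * (c.k₁ * M + M) :=
            mul_le_mul (by linarith) hgb (abs_nonneg _) (by norm_num)
          linarith [h₂ r ⟨hn.trans hr'.1, hr'.2⟩])
      linarith [(hMn ε hε).2.1]
    refine ⟨M + W + WX + WZ, fun ε hε t ht => ?_⟩
    rcases le_total t (n * c.τ) with h | h
    · obtain ⟨b1, b2, b3⟩ := hM ε hε t ⟨ht.1, h⟩
      exact ⟨by linarith, by linarith, by linarith⟩
    · have ht' : t ∈ Icc (n * c.τ) ((n + 1) * c.τ) := ⟨h, ht.2⟩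
      exact ⟨by linarith [hX ε hε t ht'], by linarith [hZ ε hε t ht'],
        by linarith [hQ ε hε t ht']⟩

/-- The limit `Q 0` is uniformly continuous between consecutive multiples of `τ`. -/
theorem uniformContinuousOn_Q_zero (hF : c.IsFamily φ₁ φ₂ φ₃ H₁ H₂ H₃ X Z Q) (i : ℕ) :
    UniformContinuousOn (Q 0) (Ico ((i - 2 : ℝ) * c.τ) ((i - 1 : ℝ) * c.τ)) := by
  have hτ := c.τ_pos
  have hinit : ∀ a b : ℝ, -(2 * c.τ) ≤ a → b ≤ 0 → UniformContinuousOn (Q 0) (Ico a b) := by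
    intro a b ha hb
    refine ((isCompact_Icc.uniformContinuousOn_of_continuous hF.φ₃_cont).mono
      (fun t ht => ⟨ha.trans ht.1, (ht.2.trans_le hb).le⟩)).congr fun t ht => ?_
    exact (hF.Q_init 0 le_rfl t ⟨ha.trans ht.1, ht.2.trans_le hb⟩).symm
  -- The index is shifted so that `0` and `1` are the two windows of the history. The difference
  -- equation reaches back by `2τ`, that is, two windows.
  induction i using Nat.strong_induction_on with
  | _ i ih =>
    match i with
    | 0 => exact hinit _ _ (by norm_num) (by push_cast; linarith)
    | 1 => exact hinit _ _ (by push_cast; linarith) (by norm_num)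
    | i + 2 =>
      have hQ := ih i (by omega)
      push_cast
      have e1 : ((i : ℝ) + 2 - 2) * c.τ = i * c.τ := by ring
      have e2 : ((i : ℝ) + 2 - 1) * c.τ = i * c.τ + c.τ := by ring
      have hi : (0 : ℝ) ≤ i * c.τ := by positivity
      rw [e1, e2]
      have hQ' : UniformContinuousOn (fun t => Q 0 (t - 2 * c.τ)) (Ico (i * c.τ) (i * c.τ + c.τ)) :=
        uniformContinuousOn_comp_sub hQ fun t ht => ⟨by linarith [ht.1], by linarith [ht.2]⟩
      have hX' : UniformContinuousOn (fun t => X 0 (t - 2 * c.τ))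
          (Ico (i * c.τ) (i * c.τ + c.τ)) :=
        uniformContinuousOn_comp_sub ((isCompact_Icc (a := -(2 * c.τ))
          (b := i * c.τ)).uniformContinuousOn_of_continuous
          ((hF.X_cont 0 le_rfl).mono fun t ht => ht.1))
          fun t ht => ⟨by linarith [ht.1], by linarith [ht.2]⟩
      have hZ' : UniformContinuousOn (fun t => Z 0 (t - c.τ)) (Ico (i * c.τ) (i * c.τ + c.τ)) :=
        uniformContinuousOn_comp_sub ((isCompact_Icc (a := -(2 * c.τ))
          (b := i * c.τ)).uniformContinuousOn_of_continuous
          ((hF.Z_cont 0 le_rfl).mono fun t ht => ht.1))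
          fun t ht => ⟨by linarith [ht.1], by linarith [ht.2]⟩
      have hH' : UniformContinuousOn H₃ (Ico (i * c.τ) (i * c.τ + c.τ)) :=
        ((isCompact_Icc (a := (0 : ℝ)) (b := i * c.τ + c.τ)).uniformContinuousOn_of_continuous
          (hF.H₃_cont.mono fun t ht => ht.1)).mono fun t ht => ⟨hi.trans ht.1, ht.2.le⟩
      refine (uniformContinuousOn_add (uniformContinuousOn_add
        (uniformContinuousOn_const_mul hZ' (-c.k₂)) (uniformContinuousOn_const_mul
          (uniformContinuousOn_add (uniformContinuousOn_const_mul hX' (-c.k₁))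
            (uniformContinuousOn_const_mul hQ' c.ρ)) c.s)) hH').congr fun t ht => ?_
      exact (hF.Q_limit t (hi.trans ht.1)).symm

/-- The inflow converges where the delayed unknowns do. -/
theorem vanishes_inflow (hF : c.IsFamily φ₁ φ₂ φ₃ H₁ H₂ H₃ X Z Q) {S : Set ℝ}
    (hX : Vanishes (fun ε t => X ε (t - 2 * c.τ) - X 0 (t - 2 * c.τ)) S)
    (hZ : Vanishes (fun ε t => Z ε (t - c.τ) - Z 0 (t - c.τ)) S)
    (hQ : Vanishes (fun ε t => Q ε (t - 2 * c.τ) - Q 0 (t - 2 * c.τ)) S) (hS : S ⊆ Ici 0) :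
    Vanishes (fun ε t => c.inflow H₃ (X ε) (Z ε) (Q ε) t - Q 0 t) S := by
  refine ((hZ.const_mul (-c.k₂)).add (((hX.const_mul (-c.k₁)).add
    (hQ.const_mul c.ρ)).const_mul c.s)).congr fun ε _ t ht => ?_
  rw [hF.Q_limit t (hS ht)]
  unfold inflow
  ring

/-- Convergence on bounded time intervals: uniform for `X` and `Z`, and uniform away from the right
of multiples of `τ` for `Q`. -/
theorem vanishes_finite_time (hF : c.IsFamily φ₁ φ₂ φ₃ H₁ H₂ H₃ X Z Q) (n : ℕ) :
    Vanishes (fun ε t => X ε t - X 0 t) (Icc (-(2 * c.τ)) (n * c.τ)) ∧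
    Vanishes (fun ε t => Z ε t - Z 0 t) (Icc (-(2 * c.τ)) (n * c.τ)) ∧
    ∀ i < n + 2, ∀ δ > 0, Vanishes (fun ε t => Q ε t - Q 0 t)
      (Ico ((i - 2 : ℝ) * c.τ + δ) ((i - 1 : ℝ) * c.τ)) := by
  have hτ := c.τ_pos
  have hρ := abs_lt.1 c.ρ_lt
  have hs := abs_lt.1 c.s_lt
  have hk₁ := c.k₁_pos
  have hk₂ := c.k₂_pos
  induction n with
  | zero =>
    simp only [Nat.cast_zero, zero_mul]
    refine ⟨.of_eq_zero fun ε hε t ht => ?_, .of_eq_zero fun ε hε t ht => ?_,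
      fun i hi δ hδ => .of_eq_zero fun ε hε t ht => ?_⟩
    · rw [hF.X_init ε hε.le t ht, hF.X_init 0 le_rfl t ht, sub_self]
    · rw [hF.Z_init ε hε.le t ht, hF.Z_init 0 le_rfl t ht, sub_self]
    · have hi' : (i : ℝ) ≤ 1 := by exact_mod_cast (by omega : i ≤ 1)
      have hi0 : (0 : ℝ) ≤ i := by positivity
      have ht' : t ∈ Ico (-(2 * c.τ)) 0 := ⟨by nlinarith [ht.1], by nlinarith [ht.2]⟩
      rw [hF.Q_init ε hε.le t ht', hF.Q_init 0 le_rfl t ht', sub_self]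
  | succ n ih =>
    obtain ⟨ihX, ihZ, ihQ⟩ := ih
    obtain ⟨M, hM⟩ := hF.exists_bound (n + 1)
    push_cast at hM ⊢
    have hn : (0 : ℝ) ≤ n * c.τ := by positivity
    have hM0 : 0 ≤ M := (abs_nonneg _).trans
      (hM 0 le_rfl (n * c.τ) ⟨by linarith, by linarith⟩).1
    have hsub : Icc (n * c.τ) ((n + 1) * c.τ) ⊆ Icc (-(2 * c.τ)) ((n + 1) * c.τ) :=
      Icc_subset_Icc (by linarith) le_rfl
    have hsub' : Icc (n * c.τ) ((n + 1) * c.τ) ⊆ Ici (-(2 * c.τ)) := fun t ht => (hsub ht).1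
    -- `[nτ, (n + 1)τ)` is the window with index `n + 2`. The inflow sees `Q` on the window with
    -- index `n`, whose layer of width `δ` is carried over by the delay.
    have hQn : ∀ δ > 0, Vanishes (fun ε t => Q ε t - Q 0 t)
        (Ico (n * c.τ + δ) ((n + 1) * c.τ)) := by
      refine vanishes_of_fast_relaxation (W := M)
        (fun ε hε => (hF.Q_cont ε hε).mono hsub')
        (fun ε hε r hr => hF.Q_deriv ε hε r (hn.trans hr.1))
        (fun ε hε r hr => (hM ε hε.le r (hsub hr)).2.2)
        (fun r hr => (hM 0 le_rfl r (hsub (Ico_subset_Icc_self hr))).2.2) ?_ ?_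
      · have := hF.uniformContinuousOn_Q_zero (n + 2)
        push_cast at this
        convert this using 2 <;> ring
      · intro δ hδ
        refine hF.vanishes_inflow (ihX.comp_sub fun t ht => ⟨?_, ?_⟩)
          (ihZ.comp_sub fun t ht => ⟨?_, ?_⟩)
          ((ihQ n (by omega) δ hδ).comp_sub fun t ht => ⟨?_, ?_⟩)
          fun t ht => hn.trans (by linarith [ht.1]) <;> linarith [ht.1, ht.2]
    have hXn : Vanishes (fun ε t => X ε t - X 0 t) (Icc (n * c.τ) ((n + 1) * c.τ)) := by
      have hC : 0 ≤ (1 + c.ρ) / c.k₁ := div_nonneg (by linarith) hk₁.le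
      refine vanishes_of_slow_relaxation (W := 2 * M + (1 + c.ρ) / c.k₁ * (2 * M)) hk₁
        (w := fun ε t => (1 + c.ρ) / c.k₁ * (Q ε t - Q 0 t))
        (fun ε hε => ((hF.X_cont ε hε.le).sub (hF.X_cont 0 le_rfl)).mono hsub')
        (fun ε hε r hr => ((hF.X_relax hε.le (hn.trans hr.1)).sub
          (hF.X_relax le_rfl (hn.trans hr.1))).congr_deriv (by ring)) (by positivity)
        (fun ε hε r hr => ?_) (fun ε hε r hr => ?_) (ihX.mono ?_)
        (fun δ hδ => (hQn δ hδ).const_mul _)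
      · have := abs_sub (X ε r) (X 0 r)
        have h1 := (hM ε hε.le r (hsub hr)).1
        have h2 := (hM 0 le_rfl r (hsub hr)).1
        have h3 : 0 ≤ (1 + c.ρ) / c.k₁ * (2 * M) := by positivity
        linarith
      · have := abs_sub (Q ε r) (Q 0 r)
        have h1 := (hM ε hε.le r (hsub (Ico_subset_Icc_self hr))).2.2
        have h2 := (hM 0 le_rfl r (hsub (Ico_subset_Icc_self hr))).2.2
        rw [abs_mul, abs_of_nonneg hC]
        have h3 : (1 + c.ρ) / c.k₁ * |Q ε r - Q 0 r| ≤ (1 + c.ρ) / c.k₁ * (2 * M) :=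
          mul_le_mul_of_nonneg_left (by linarith) hC
        linarith
      · rintro t rfl; exact ⟨by linarith, le_rfl⟩
    -- Only values delayed by `τ` enter, so the window with index `n + 1` is used for `Q`.
    have hZn : Vanishes (fun ε t => Z ε t - Z 0 t) (Icc (n * c.τ) ((n + 1) * c.τ)) := by
      have hC : 0 ≤ (1 + c.s) / c.k₂ := div_nonneg (by linarith) hk₂.le
      refine vanishes_of_slow_relaxation
        (W := 2 * M + (1 + c.s) / c.k₂ * (c.k₁ * (2 * M) + 2 * M)) hk₂
        (w := fun ε t => (1 + c.s) / c.k₂ * (-c.k₁ * (X ε (t - c.τ) - X 0 (t - c.τ)) +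
          c.ρ * (Q ε (t - c.τ) - Q 0 (t - c.τ))))
        (fun ε hε => ((hF.Z_cont ε hε.le).sub (hF.Z_cont 0 le_rfl)).mono hsub')
        (fun ε hε r hr => ((hF.Z_relax hε.le (hn.trans hr.1)).sub
          (hF.Z_relax le_rfl (hn.trans hr.1))).congr_deriv (by ring)) (by positivity)
        (fun ε hε r hr => ?_) (fun ε hε r hr => ?_) (ihZ.mono ?_)
        (fun δ hδ => ?_)
      · have := abs_sub (Z ε r) (Z 0 r)
        have h1 := (hM ε hε.le r (hsub hr)).2.1
        have h2 := (hM 0 le_rfl r (hsub hr)).2.1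
        have h3 : 0 ≤ (1 + c.s) / c.k₂ * (c.k₁ * (2 * M) + 2 * M) := by positivity
        linarith
      · have hr' : r - c.τ ∈ Icc (-(2 * c.τ)) ((n + 1) * c.τ) :=
          ⟨by linarith [hr.1], by linarith [hr.2]⟩
        have h0 := abs_sub (X ε (r - c.τ)) (X 0 (r - c.τ))
        have h0' := abs_sub (Q ε (r - c.τ)) (Q 0 (r - c.τ))
        have h1 := hM ε hε.le _ hr'
        have h2 := hM 0 le_rfl _ hr'
        rw [abs_mul, abs_of_nonneg hC]
        have h4 := abs_add_le (-c.k₁ * (X ε (r - c.τ) - X 0 (r - c.τ)))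
          (c.ρ * (Q ε (r - c.τ) - Q 0 (r - c.τ)))
        rw [abs_mul, abs_neg, abs_of_pos hk₁, abs_mul c.ρ] at h4
        have h5 : c.k₁ * |X ε (r - c.τ) - X 0 (r - c.τ)| ≤ c.k₁ * (2 * M) :=
          mul_le_mul_of_nonneg_left (by linarith [h1.1, h2.1]) hk₁.le
        have h6 : |c.ρ| * |Q ε (r - c.τ) - Q 0 (r - c.τ)| ≤ 1 * (2 * M) :=
          mul_le_mul c.ρ_lt.le (by linarith [h1.2.2, h2.2.2]) (abs_nonneg _) zero_le_one
        have h3 := mul_le_mul_of_nonneg_left (h4.trans (add_le_add h5 h6)) hC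
        linarith
      · rintro t rfl; exact ⟨by linarith, le_rfl⟩
      · refine (((ihX.comp_sub fun t ht => ⟨?_, ?_⟩).const_mul _).add
          (((ihQ (n + 1) (by omega) δ hδ).comp_sub fun t ht => ⟨?_, ?_⟩).const_mul _)).const_mul _
          <;> push_cast <;> linarith [ht.1, ht.2]
    refine ⟨(ihX.union hXn).mono fun t ht => ?_, (ihZ.union hZn).mono fun t ht => ?_, ?_⟩
    · exact (le_total t (n * c.τ)).imp (fun h => ⟨ht.1, h⟩) fun h => ⟨h, ht.2⟩
    · exact (le_total t (n * c.τ)).imp (fun h => ⟨ht.1, h⟩) fun h => ⟨h, ht.2⟩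
    · intro i hi δ hδ
      rcases (by omega : i < n + 2 ∨ i = n + 2) with h | rfl
      · exact ihQ i h δ hδ
      · refine (hQn δ hδ).mono fun t ht => ⟨?_, ?_⟩
        · have := ht.1; push_cast at this; linarith
        · have := ht.2; push_cast at this; linarith

end IsFamily

end LoopCoeffs

/-! ### Energy of the feedback loop and its long-time behaviour -/

/-- A continuous function on `[a, b]` with nonpositive right derivative decreases. -/
theorem le_left_of_deriv_right_nonpos {f f' : ℝ → ℝ} {a b : ℝ} (hab : a ≤ b)
    (hc : ContinuousOn f (Icc a b)) (hd : ∀ r ∈ Ico a b, HasDerivWithinAt f (f' r) (Ici r) r)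
    (hn : ∀ r ∈ Ico a b, f' r ≤ 0) : f b ≤ f a :=
  image_le_of_deriv_right_le_deriv_boundary hc hd (B := fun _ => f a) (B' := fun _ => 0) le_rfl
    continuousOn_const (fun _ _ => hasDerivWithinAt_const _ _ _) hn (right_mem_Icc.2 hab)

theorem hasDerivAt_integral_right {w : ℝ → ℝ} (hw : Continuous w) (a t : ℝ) :
    HasDerivAt (fun t => ∫ r in a..t, w r) (w t) t :=
  intervalIntegral.integral_hasDerivAt_right (hw.intervalIntegrable _ _)
    (hw.stronglyMeasurableAtFilter _ _) hw.continuousAt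

theorem hasDerivAt_integral_window {w : ℝ → ℝ} (hw : Continuous w) (d t : ℝ) :
    HasDerivAt (fun t => ∫ r in (t - d)..t, w r) (w t - w (t - d)) t := by
  have h1 := hasDerivAt_integral_right hw 0 t
  have h2 := (hasDerivAt_integral_right hw 0 (t - d)).comp_sub_const t d
  refine (h1.sub h2).congr_of_eventuallyEq (Eventually.of_forall fun r => ?_)
  exact (intervalIntegral.integral_interval_sub_left (hw.intervalIntegrable _ _)
    (hw.intervalIntegrable _ _)).symm

theorem integral_mono_interval_of_nonneg {w : ℝ → ℝ} (hw : Continuous w) (h0 : ∀ r, 0 ≤ w r)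
    {a b a' b' : ℝ} (ha : a ≤ a') (hab : a' ≤ b') (hb : b' ≤ b) :
    ∫ r in a'..b', w r ≤ ∫ r in a..b, w r :=
  intervalIntegral.integral_mono_interval ha hab hb (Eventually.of_forall h0)
    (hw.intervalIntegrable _ _)

namespace LoopCoeffs

variable (c : LoopCoeffs)

theorem one_add_ρ_pos : 0 < 1 + c.ρ := by linarith [(abs_lt.1 c.ρ_lt).1]

theorem one_add_s_pos : 0 < 1 + c.s := by linarith [(abs_lt.1 c.s_lt).1]

theorem one_sub_ρ_pos : 0 < 1 - c.ρ := by linarith [(abs_lt.1 c.ρ_lt).2]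

theorem one_sub_s_pos : 0 < 1 - c.s := by linarith [(abs_lt.1 c.s_lt).2]

/-- The wave travelling from the first to the second layer. -/
def forwardWave (η X Q : ℝ → ℝ) (t : ℝ) : ℝ :=
  -c.k₁ * X t + c.ρ * Q t + (1 + c.ρ) * η t

/-- The wave travelling from the second to the first layer. -/
def backwardWave (η X Z Q : ℝ → ℝ) (t : ℝ) : ℝ :=
  -c.k₂ * Z t + c.s * c.forwardWave η X Q (t - c.τ)

/-- The loop equations for `t ≥ 2τ`, with forcings `η` and `ζ` acting on the first layer. -/
structure IsLoop (ε : ℝ) (η ζ X Z Q : ℝ → ℝ) : Prop where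
  ε_pos : 0 < ε
  η_cont : Continuous η
  ζ_cont : Continuous ζ
  X_cont : Continuous X
  Z_cont : Continuous Z
  Q_cont : Continuous Q
  X_deriv : ∀ t ≥ 2 * c.τ, HasDerivWithinAt X
    (-c.k₁ * X t + (1 + c.ρ) * (Q t + η t) - ζ t) (Ici t) t
  Z_deriv : ∀ t ≥ 2 * c.τ, HasDerivWithinAt Z
    (-c.k₂ * Z t + (1 + c.s) * c.forwardWave η X Q (t - c.τ)) (Ici t) t
  Q_deriv : ∀ t ≥ 2 * c.τ, HasDerivWithinAt Q
    (ε⁻¹ * (c.backwardWave η X Z Q (t - c.τ) - Q t)) (Ici t) t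

/-- The energy stored in the layers and in the waves between them. -/
noncomputable def energy (ε : ℝ) (η X Z Q : ℝ → ℝ) (t : ℝ) : ℝ :=
  c.k₁ / (1 + c.ρ) * X t ^ 2 + c.k₂ / (1 + c.s) * Z t ^ 2 + ε * Q t ^ 2 +
    ∫ r in (t - c.τ)..t, (c.forwardWave η X Q r ^ 2 + c.backwardWave η X Z Q r ^ 2)

/-- The dissipation density. -/
def dissipation (η X Z Q : ℝ → ℝ) (t : ℝ) : ℝ :=
  (-c.k₁ * X t + (1 + c.ρ) * Q t) ^ 2 +
    (-c.k₂ * Z t + (1 + c.s) * c.forwardWave η X Q (t - c.τ)) ^ 2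

/-- The size of the forcing, as it enters the energy balance. -/
def load (η ζ : ℝ → ℝ) (t : ℝ) : ℝ := |ζ t| + η t ^ 2

theorem load_nonneg (η ζ : ℝ → ℝ) (t : ℝ) : 0 ≤ load η ζ t := by unfold load; positivity

theorem dissipation_nonneg (η X Z Q : ℝ → ℝ) (t : ℝ) : 0 ≤ c.dissipation η X Z Q t := by
  unfold dissipation; positivity

/-- The energy controls `X` and `Z` with weights independent of `ε`, whereas `Q` carries only the
weight `ε`. Hence energy estimates give uniform settling of the two layers, and `Q` needs a separate
argument. -/
theorem layers_le_energy {ε : ℝ} (hε : 0 ≤ ε) (η X Z Q : ℝ → ℝ) (t : ℝ) :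
    c.k₁ / (1 + c.ρ) * X t ^ 2 + c.k₂ / (1 + c.s) * Z t ^ 2 ≤ c.energy ε η X Z Q t := by
  have h1 : 0 ≤ ∫ r in (t - c.τ)..t,
      (c.forwardWave η X Q r ^ 2 + c.backwardWave η X Z Q r ^ 2) :=
    intervalIntegral.integral_nonneg (by linarith [c.τ_pos]) fun r _ => by positivity
  have h2 : 0 ≤ ε * Q t ^ 2 := by positivity
  unfold energy
  linarith

theorem energy_nonneg {ε : ℝ} (hε : 0 ≤ ε) (η X Z Q : ℝ → ℝ) (t : ℝ) :
    0 ≤ c.energy ε η X Z Q t := by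
  have h1 := c.layers_le_energy hε η X Z Q t
  have h2 : 0 ≤ c.k₁ / (1 + c.ρ) := (div_pos c.k₁_pos c.one_add_ρ_pos).le
  have h3 : 0 ≤ c.k₂ / (1 + c.s) := (div_pos c.k₂_pos c.one_add_s_pos).le
  have h4 : 0 ≤ c.k₁ / (1 + c.ρ) * X t ^ 2 := by positivity
  have h5 : 0 ≤ c.k₂ / (1 + c.s) * Z t ^ 2 := by positivity
  linarith

/-- Fraction of the dissipation density that is not used to absorb the forcing. -/
noncomputable def dissRate : ℝ := min ((1 - c.ρ) / (1 + c.ρ) / 2) ((1 - c.s) / (1 + c.s))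

/-- Growth rate of the energy per unit of forcing. -/
noncomputable def loadRate : ℝ :=
  c.k₁ / (1 + c.ρ) + 1 + (2 * c.ρ ^ 2 / ((1 - c.ρ) / (1 + c.ρ)) + (1 + c.ρ) ^ 2)

theorem dissRate_pos : 0 < c.dissRate :=
  lt_min (half_pos (div_pos c.one_sub_ρ_pos c.one_add_ρ_pos))
    (div_pos c.one_sub_s_pos c.one_add_s_pos)

theorem loadRate_pos : 0 < c.loadRate := by
  have h1 := div_pos c.k₁_pos c.one_add_ρ_pos
  have h2 := div_pos c.one_sub_ρ_pos c.one_add_ρ_pos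
  unfold loadRate
  positivity

/-- The energy balance at one instant, as an inequality between real numbers. -/
theorem energy_balance (x z q e d gd P V : ℝ) (hV : c.k₁ / (1 + c.ρ) * x ^ 2 ≤ V) :
    2 * (c.k₁ / (1 + c.ρ)) * x * (-c.k₁ * x + (1 + c.ρ) * (q + e) - d) +
      2 * (c.k₂ / (1 + c.s)) * z * (-c.k₂ * z + (1 + c.s) * gd) + 2 * q * (P - q) +
      ((-c.k₁ * x + c.ρ * q + (1 + c.ρ) * e) ^ 2 + (-c.k₂ * z + c.s * gd) ^ 2 - (gd ^ 2 + P ^ 2)) ≤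
    -c.dissRate * ((-c.k₁ * x + (1 + c.ρ) * q) ^ 2 + (-c.k₂ * z + (1 + c.s) * gd) ^ 2) +
      c.loadRate * (|d| + e ^ 2) * (1 + V) := by
  have hρ := c.one_add_ρ_pos
  have hs := c.one_add_s_pos
  have hk : 0 < c.k₁ / (1 + c.ρ) := div_pos c.k₁_pos hρ
  set κ := c.k₁ / (1 + c.ρ) with hκ
  set c1 := (1 - c.ρ) / (1 + c.ρ) with hc1
  have hc1p : 0 < c1 := div_pos c.one_sub_ρ_pos hρ
  set Y := -c.k₁ * x + (1 + c.ρ) * q with hY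
  set W := -c.k₂ * z + (1 + c.s) * gd with hW
  have hk₁ : c.k₁ = κ * (1 + c.ρ) := by rw [hκ]; field_simp
  -- The weight `κ = k₁ / (1 + ρ)` is the one for which stored plus outgoing energy equals incoming
  -- energy up to a loss in `Y ^ 2`. The second layer obeys the same law with `s`.
  have id1 : 2 * κ * x * Y + (-c.k₁ * x + c.ρ * q) ^ 2 = q ^ 2 - c1 * Y ^ 2 := by
    rw [hc1, hY, hκ]; field_simp; ring
  have id2 : 2 * (c.k₂ / (1 + c.s)) * z * W + (-c.k₂ * z + c.s * gd) ^ 2 =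
      gd ^ 2 - (1 - c.s) / (1 + c.s) * W ^ 2 := by
    rw [hW]; field_simp; ring
  -- The terms linear in `e` combine to a multiple of `Y`. Half of the loss `c1 * Y ^ 2` absorbs
  -- them, and only `e ^ 2` remains.
  have id3 : 2 * κ * x * ((1 + c.ρ) * e) + 2 * (-c.k₁ * x + c.ρ * q) * ((1 + c.ρ) * e) =
      2 * c.ρ * Y * e := by
    rw [hY, hk₁]; ring
  have b1 : 2 * c.ρ * Y * e ≤ c1 / 2 * Y ^ 2 + 2 * c.ρ ^ 2 / c1 * e ^ 2 := by
    have h : c1 / 2 * Y ^ 2 + 2 * c.ρ ^ 2 / c1 * e ^ 2 - 2 * c.ρ * Y * e =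
        (c1 * Y - 2 * c.ρ * e) ^ 2 / (2 * c1) := by field_simp; ring
    have h' : 0 ≤ (c1 * Y - 2 * c.ρ * e) ^ 2 / (2 * c1) := by positivity
    linarith
  -- The term in `d` contains `x` rather than `Y`, so it cannot be absorbed: it enters through `|d|`
  -- and costs a factor `1 + V`.
  have b2 : -(2 * κ * x * d) ≤ (κ + κ * x ^ 2) * |d| := by
    have h1 : -(x * d) ≤ |x| * |d| := by rw [← abs_mul]; exact neg_le_abs _
    have h2 : 2 * |x| ≤ 1 + x ^ 2 := by nlinarith [sq_nonneg (|x| - 1), sq_abs x]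
    have h3 := mul_le_mul_of_nonneg_right h2 (abs_nonneg d)
    nlinarith
  have r1 : c.dissRate ≤ c1 / 2 := min_le_left _ _
  have r2 : c.dissRate ≤ (1 - c.s) / (1 + c.s) := min_le_right _ _
  have d1 := mul_le_mul_of_nonneg_right r1 (sq_nonneg Y)
  have d2 := mul_le_mul_of_nonneg_right r2 (sq_nonneg W)
  have hV0 : 0 ≤ V := le_trans (by positivity) hV
  have l1 : (κ + κ * x ^ 2) * |d| ≤ (κ + 1) * (1 + V) * |d| := by
    refine mul_le_mul_of_nonneg_right ?_ (abs_nonneg d)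
    nlinarith
  set A := 2 * c.ρ ^ 2 / c1 + (1 + c.ρ) ^ 2 with hA
  have hA0 : 0 ≤ A := by positivity
  have l2 : c.loadRate = κ + 1 + A := rfl
  have l3 : 0 ≤ A * |d| * (1 + V) := by positivity
  have l4 : 0 ≤ A * e ^ 2 * V := by positivity
  have l5 : 0 ≤ (κ + 1) * e ^ 2 * (1 + V) := by positivity
  have hl : c.loadRate * (|d| + e ^ 2) * (1 + V) = (κ + 1) * (1 + V) * |d| + A * |d| * (1 + V) +
      A * e ^ 2 * V + A * e ^ 2 + (κ + 1) * e ^ 2 * (1 + V) := by rw [l2]; ring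
  have hAe : A * e ^ 2 = 2 * c.ρ ^ 2 / c1 * e ^ 2 + (1 + c.ρ) ^ 2 * e ^ 2 := by rw [hA]; ring
  have hsq : 0 ≤ (q - P) ^ 2 := sq_nonneg _
  have expand : 2 * κ * x * (-c.k₁ * x + (1 + c.ρ) * (q + e) - d) = 2 * κ * x * Y +
      2 * κ * x * ((1 + c.ρ) * e) - 2 * κ * x * d := by rw [hY]; ring
  have expand2 : (-c.k₁ * x + c.ρ * q + (1 + c.ρ) * e) ^ 2 = (-c.k₁ * x + c.ρ * q) ^ 2 +
      2 * (-c.k₁ * x + c.ρ * q) * ((1 + c.ρ) * e) + (1 + c.ρ) ^ 2 * e ^ 2 := by ring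
  have hsq' : 2 * q * (P - q) + q ^ 2 - P ^ 2 = -(q - P) ^ 2 := by ring
  have hdiss : -c.dissRate * (Y ^ 2 + W ^ 2) = -(c.dissRate * Y ^ 2) - c.dissRate * W ^ 2 := by ring
  rw [expand, expand2, hl, hdiss]
  clear_value A Y W κ c1
  linarith

namespace IsLoop

variable {c} {ε : ℝ} {η ζ X Z Q : ℝ → ℝ}

theorem forwardWave_cont (hL : c.IsLoop ε η ζ X Z Q) : Continuous (c.forwardWave η X Q) := by
  have h1 := hL.X_cont
  have h2 := hL.Q_cont
  have h3 := hL.η_cont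
  unfold forwardWave
  fun_prop

theorem backwardWave_cont (hL : c.IsLoop ε η ζ X Z Q) : Continuous (c.backwardWave η X Z Q) := by
  have h1 := hL.Z_cont
  have h2 := hL.forwardWave_cont
  unfold backwardWave
  fun_prop

theorem dissipation_cont (hL : c.IsLoop ε η ζ X Z Q) : Continuous (c.dissipation η X Z Q) := by
  have h1 := hL.X_cont
  have h2 := hL.Q_cont
  have h3 := hL.Z_cont
  have h4 := hL.forwardWave_cont
  unfold dissipation
  fun_prop

theorem load_cont (hL : c.IsLoop ε η ζ X Z Q) : Continuous (load η ζ) := by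
  have h1 := hL.η_cont
  have h2 := hL.ζ_cont
  unfold load
  fun_prop

theorem energy_cont (hL : c.IsLoop ε η ζ X Z Q) : Continuous (c.energy ε η X Z Q) := by
  have h1 := hL.X_cont
  have h2 := hL.Q_cont
  have h3 := hL.Z_cont
  have h4 : Continuous fun r => c.forwardWave η X Q r ^ 2 + c.backwardWave η X Z Q r ^ 2 :=
    (hL.forwardWave_cont.pow 2).add (hL.backwardWave_cont.pow 2)
  have h5 : Continuous fun t => ∫ r in (t - c.τ)..t,
      (c.forwardWave η X Q r ^ 2 + c.backwardWave η X Z Q r ^ 2) :=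
    continuous_iff_continuousAt.2 fun t => (hasDerivAt_integral_window h4 c.τ t).continuousAt
  unfold energy
  fun_prop

/-- The window integral contributes the squares of the waves emitted at `t` minus those of the waves
emitted at `t - τ`, and the latter are the inputs of the second layer and of `Q`. The weight `ε`
cancels the rate `ε⁻¹`, so the instantaneous balance applies with constants free of `ε`. -/
theorem exists_energy_deriv (hL : c.IsLoop ε η ζ X Z Q) {t : ℝ} (ht : 2 * c.τ ≤ t) :
    ∃ V', HasDerivWithinAt (c.energy ε η X Z Q) V' (Ici t) t ∧
      V' ≤ -c.dissRate * c.dissipation η X Z Q t +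
        c.loadRate * load η ζ t * (1 + c.energy ε η X Z Q t) := by
  have h4 : Continuous fun r => c.forwardWave η X Q r ^ 2 + c.backwardWave η X Z Q r ^ 2 :=
    (hL.forwardWave_cont.pow 2).add (hL.backwardWave_cont.pow 2)
  refine ⟨_, ((((((hL.X_deriv t ht).pow 2).const_mul (c.k₁ / (1 + c.ρ))).add
    (((hL.Z_deriv t ht).pow 2).const_mul (c.k₂ / (1 + c.s)))).add
    (((hL.Q_deriv t ht).pow 2).const_mul ε)).add
    (hasDerivAt_integral_window h4 c.τ t).hasDerivWithinAt), ?_⟩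
  have hb := c.energy_balance (X t) (Z t) (Q t) (η t) (ζ t) (c.forwardWave η X Q (t - c.τ))
    (c.backwardWave η X Z Q (t - c.τ)) (c.energy ε η X Z Q t) (by
      have h1 := c.layers_le_energy hL.ε_pos.le η X Z Q t
      have h2 : 0 ≤ c.k₂ / (1 + c.s) * Z t ^ 2 :=
        mul_nonneg (div_pos c.k₂_pos c.one_add_s_pos).le (sq_nonneg _)
      linarith)
  have hε := mul_inv_cancel₀ hL.ε_pos.ne'
  refine le_trans (le_of_eq ?_) hb
  have e1 : c.forwardWave η X Q t = -c.k₁ * X t + c.ρ * Q t + (1 + c.ρ) * η t := rfl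
  have e2 : c.backwardWave η X Z Q t = -c.k₂ * Z t + c.s * c.forwardWave η X Q (t - c.τ) := rfl
  rw [← e1, ← e2]
  set P := c.backwardWave η X Z Q (t - c.τ)
  have e3 : ε * (2 * Q t * (ε⁻¹ * (P - Q t))) = 2 * Q t * (P - Q t) := by
    rw [show ε * (2 * Q t * (ε⁻¹ * (P - Q t))) = ε * ε⁻¹ * (2 * Q t * (P - Q t)) by ring, hε,
      one_mul]
  rw [← e3]
  norm_num
  ring

/-- Gronwall bound for the energy. -/
theorem energy_le (hL : c.IsLoop ε η ζ X Z Q) {a t : ℝ} (ha : 2 * c.τ ≤ a) (hat : a ≤ t) :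
    1 + c.energy ε η X Z Q t ≤
      (1 + c.energy ε η X Z Q a) * Real.exp (c.loadRate * ∫ r in a..t, load η ζ r) := by
  choose! V' hV' hV'le using fun t (ht : 2 * c.τ ≤ t) => hL.exists_energy_deriv ht
  set E := c.energy ε η X Z Q with hE
  have hexp : ∀ r, HasDerivAt (fun t => Real.exp (-(c.loadRate * ∫ r in a..t, load η ζ r)))
      (Real.exp (-(c.loadRate * ∫ r in a..r, load η ζ r)) * -(c.loadRate * load η ζ r)) r :=
    fun r => ((hasDerivAt_integral_right hL.load_cont a r).const_mul c.loadRate).neg.exp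
  have hcexp : Continuous fun t => Real.exp (-(c.loadRate * ∫ r in a..t, load η ζ r)) :=
    continuous_iff_continuousAt.2 fun r => (hexp r).continuousAt
  have key := le_left_of_deriv_right_nonpos
    (f := fun t => Real.exp (-(c.loadRate * ∫ r in a..t, load η ζ r)) * (1 + E t)) hat
    ((hcexp.mul (continuous_const.add hL.energy_cont)).continuousOn)
    (fun r hr => (hexp r).hasDerivWithinAt.mul ((hV' r (ha.trans hr.1)).const_add 1))
    (fun r hr => by
      have h1 := hV'le r (ha.trans hr.1)
      have h2 := mul_nonneg c.dissRate_pos.le (c.dissipation_nonneg η X Z Q r)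
      have h3 := Real.exp_pos (-(c.loadRate * ∫ r in a..r, load η ζ r))
      have h4 : V' r - c.loadRate * load η ζ r * (1 + E r) ≤ 0 := by linarith
      nlinarith [mul_nonpos_of_nonneg_of_nonpos h3.le h4])
  simp only [intervalIntegral.integral_same, mul_zero, neg_zero, Real.exp_zero, one_mul] at key
  have h5 := mul_le_mul_of_nonneg_left key
    (Real.exp_pos (c.loadRate * ∫ r in a..t, load η ζ r)).le
  rw [← mul_assoc, ← Real.exp_add, add_neg_cancel, Real.exp_zero, one_mul] at h5
  linarith

/-- Integrating the energy inequality bounds the total dissipation by a quantity that depends on the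
elapsed time only through the total load. This feeds the pigeonhole argument for quiet windows. -/
theorem integral_dissipation_le (hL : c.IsLoop ε η ζ X Z Q)
    {a t K : ℝ} (ha : 2 * c.τ ≤ a) (hat : a ≤ t)
    (hK : ∀ r ∈ Icc a t, 1 + c.energy ε η X Z Q r ≤ K) :
    c.dissRate * ∫ r in a..t, c.dissipation η X Z Q r ≤
      K + c.loadRate * K * ∫ r in a..t, load η ζ r := by
  choose! V' hV' hV'le using fun t (ht : 2 * c.τ ≤ t) => hL.exists_energy_deriv ht
  set E := c.energy ε η X Z Q with hE
  have hd1 := fun r => (hasDerivAt_integral_right hL.dissipation_cont a r).const_mul c.dissRate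
  have hd2 := fun r => (hasDerivAt_integral_right hL.load_cont a r).const_mul (c.loadRate * K)
  have key := le_left_of_deriv_right_nonpos
    (f := fun t => E t + c.dissRate * (∫ r in a..t, c.dissipation η X Z Q r) -
      c.loadRate * K * ∫ r in a..t, load η ζ r) hat
    (((hL.energy_cont.continuousOn).add
      (fun r _ => (hd1 r).continuousAt.continuousWithinAt)).sub
      (fun r _ => (hd2 r).continuousAt.continuousWithinAt))
    (fun r hr => ((hV' r (ha.trans hr.1)).add (hd1 r).hasDerivWithinAt).sub
      (hd2 r).hasDerivWithinAt)
    (fun r hr => by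
      have h1 := hV'le r (ha.trans hr.1)
      have h2 := mul_le_mul_of_nonneg_left (hK r (Ico_subset_Icc_self hr))
        (mul_nonneg c.loadRate_pos.le (load_nonneg η ζ r))
      nlinarith)
  simp only [intervalIntegral.integral_same, mul_zero, add_zero, sub_zero] at key
  have h3 := hK a (left_mem_Icc.2 hat)
  have h4 := c.energy_nonneg hL.ε_pos.le η X Z Q t
  linarith

/-- Subtracting an equilibrium. -/
theorem shift (hL : c.IsLoop ε η ζ X Z Q)
    (v : ℝ) : c.IsLoop ε η ζ (fun t => X t - v * ((1 + c.ρ) / c.k₁))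
    (fun t => Z t + v * ((1 + c.s) / c.k₂)) (fun t => Q t - v) := by
  have hk₁ := c.k₁_pos.ne'
  have hk₂ := c.k₂_pos.ne'
  refine ⟨hL.ε_pos, hL.η_cont, hL.ζ_cont, hL.X_cont.sub continuous_const,
    hL.Z_cont.add continuous_const, hL.Q_cont.sub continuous_const, fun t ht => ?_, fun t ht => ?_,
    fun t ht => ?_⟩
  · exact ((hL.X_deriv t ht).sub_const _).congr_deriv (by field_simp; ring)
  · refine ((hL.Z_deriv t ht).add_const _).congr_deriv ?_
    unfold forwardWave; field_simp; ring
  · refine ((hL.Q_deriv t ht).sub_const _).congr_deriv ?_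
    unfold backwardWave forwardWave; field_simp; ring

end IsLoop

end LoopCoeffs

/-! ### Quiet time windows: little dissipation forces closeness to an equilibrium. -/

namespace LoopCoeffs

variable (c : LoopCoeffs)

/-- With `Y = -k₁ x + (1 + ρ) q` one has `q = (Y + k₁ x) / (1 + ρ)`. So a small `x` and little
dissipation make the incoming and the outgoing wave small. -/
theorem exists_first_layer_bound : ∃ C, 0 ≤ C ∧ ∀ x q e : ℝ,
    q ^ 2 + (-c.k₁ * x + c.ρ * q + (1 + c.ρ) * e) ^ 2 ≤
      C * ((-c.k₁ * x + (1 + c.ρ) * q) ^ 2 + e ^ 2 + x ^ 2) := by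
  have hρ := c.one_add_ρ_pos
  set m := 2 / (1 + c.ρ) ^ 2 * (1 + c.k₁ ^ 2) with hm
  have hm0 : 0 ≤ m := by positivity
  refine ⟨m + 3 * (c.k₁ ^ 2 + c.ρ ^ 2 * m + (1 + c.ρ) ^ 2), by positivity, fun x q e => ?_⟩
  set Y := -c.k₁ * x + (1 + c.ρ) * q with hY
  have h1 : q ^ 2 ≤ m * (Y ^ 2 + x ^ 2) := by
    have e1 : q = (Y + c.k₁ * x) / (1 + c.ρ) := by rw [hY]; field_simp; ring
    have h2 : (Y + c.k₁ * x) ^ 2 ≤ 2 * ((1 + c.k₁ ^ 2) * (Y ^ 2 + x ^ 2)) := by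
      nlinarith [sq_nonneg (Y - c.k₁ * x), sq_nonneg (c.k₁ * Y), sq_nonneg x]
    calc q ^ 2 = (Y + c.k₁ * x) ^ 2 / (1 + c.ρ) ^ 2 := by rw [← div_pow, ← e1]
      _ ≤ 2 * ((1 + c.k₁ ^ 2) * (Y ^ 2 + x ^ 2)) / (1 + c.ρ) ^ 2 := by gcongr
      _ = m * (Y ^ 2 + x ^ 2) := by rw [hm]; ring
  have h3 : (-c.k₁ * x + c.ρ * q + (1 + c.ρ) * e) ^ 2 ≤
      3 * (c.k₁ ^ 2 * x ^ 2 + c.ρ ^ 2 * q ^ 2 + (1 + c.ρ) ^ 2 * e ^ 2) := by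
    nlinarith [sq_nonneg (-c.k₁ * x - c.ρ * q), sq_nonneg (-c.k₁ * x - (1 + c.ρ) * e),
      sq_nonneg (c.ρ * q - (1 + c.ρ) * e)]
  have h4 := mul_le_mul_of_nonneg_left h1 (sq_nonneg c.ρ)
  have n1 : 0 ≤ m * e ^ 2 := by positivity
  have n2 : 0 ≤ c.k₁ ^ 2 * (Y ^ 2 + e ^ 2) := by positivity
  have n3 : 0 ≤ c.ρ ^ 2 * m * e ^ 2 := by positivity
  have n4 : 0 ≤ (1 + c.ρ) ^ 2 * (Y ^ 2 + x ^ 2) := by positivity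
  linarith

/-- With `W = -k₂ z + (1 + s) g` one has `z = ((1 + s) g - W) / k₂`, and the outgoing wave is `W -
g`. -/
theorem exists_second_layer_bound : ∃ C, 0 ≤ C ∧ ∀ z g : ℝ,
    z ^ 2 + (-c.k₂ * z + c.s * g) ^ 2 ≤ C * ((-c.k₂ * z + (1 + c.s) * g) ^ 2 + g ^ 2) := by
  have hk := c.k₂_pos
  set m := 2 / c.k₂ ^ 2 * (1 + (1 + c.s) ^ 2) with hm
  have hm0 : 0 ≤ m := by positivity
  refine ⟨m + 2, by positivity, fun z g => ?_⟩
  set W := -c.k₂ * z + (1 + c.s) * g with hW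
  have h1 : z ^ 2 ≤ m * (W ^ 2 + g ^ 2) := by
    have e1 : z = ((1 + c.s) * g - W) / c.k₂ := by rw [hW]; field_simp; ring
    have h2 : ((1 + c.s) * g - W) ^ 2 ≤ 2 * ((1 + (1 + c.s) ^ 2) * (W ^ 2 + g ^ 2)) := by
      nlinarith [sq_nonneg ((1 + c.s) * g + W), sq_nonneg ((1 + c.s) * W), sq_nonneg g]
    calc z ^ 2 = ((1 + c.s) * g - W) ^ 2 / c.k₂ ^ 2 := by rw [← div_pow, ← e1]
      _ ≤ 2 * ((1 + (1 + c.s) ^ 2) * (W ^ 2 + g ^ 2)) / c.k₂ ^ 2 := by gcongr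
      _ = m * (W ^ 2 + g ^ 2) := by rw [hm]; ring
  have h3 : (-c.k₂ * z + c.s * g) ^ 2 ≤ 2 * (W ^ 2 + g ^ 2) := by
    have : -c.k₂ * z + c.s * g = W - g := by rw [hW]; ring
    rw [this]
    nlinarith [sq_nonneg (W + g)]
  linarith

/-- The window integral of `w(t) + w(t - d) + l²`. -/
theorem integral_add_shift_le {w : ℝ → ℝ} (hw : Continuous w) (h0 : ∀ r, 0 ≤ w r)
    {a d l : ℝ} (hd : 0 ≤ d) (h : ∫ r in a..(a + 3 * d), w r ≤ 2 * l ^ 2) :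
    ∫ r in (a + d)..(a + 3 * d), (w r + w (r - d) + l ^ 2) ≤ (4 + 2 * d) * l ^ 2 := by
  have i1 : IntervalIntegrable w MeasureTheory.volume (a + d) (a + 3 * d) :=
    hw.intervalIntegrable _ _
  have i2 : IntervalIntegrable (fun r => w (r - d)) MeasureTheory.volume (a + d) (a + 3 * d) :=
    (hw.comp (continuous_sub_right d)).intervalIntegrable _ _
  have e1 : ∫ r in (a + d)..(a + 3 * d), l ^ 2 = 2 * d * l ^ 2 := by
    rw [intervalIntegral.integral_const, smul_eq_mul]; ring
  have b1 := (integral_mono_interval_of_nonneg hw h0 (a := a) (a' := a + d) (b' := a + 3 * d)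
    (by linarith) (by linarith) le_rfl).trans h
  have b2 := (integral_mono_interval_of_nonneg hw h0 (a := a) (a' := a + d - d)
    (b' := a + 3 * d - d) (by linarith) (by linarith) (by linarith)).trans h
  rw [intervalIntegral.integral_add (i1.add i2) intervalIntegrable_const,
    intervalIntegral.integral_add i1 i2, intervalIntegral.integral_comp_sub_right w d, e1]
  linarith

/-- In a time window with little dissipation and little forcing, the first layer hardly moves. -/
theorem IsLoop.abs_sub_le_of_integral_le {c : LoopCoeffs} {ε : ℝ} {η ζ X Z Q : ℝ → ℝ}
    (hL : c.IsLoop ε η ζ X Z Q) {a l : ℝ} (ha : 2 * c.τ ≤ a) (hl : 0 < l) (hl1 : l ≤ 1)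
    (hD : ∫ r in a..(a + 3 * c.τ), c.dissipation η X Z Q r ≤ l ^ 2)
    (hB : ∫ r in a..(a + 3 * c.τ), load η ζ r ≤ l ^ 2) :
    ∀ t ∈ Icc a (a + 3 * c.τ), |X t - X a| ≤ (6 * c.τ + 2) * l := by
  have hρ := c.one_add_ρ_pos
  have hρ2 : 1 + c.ρ ≤ 2 := by linarith [c.one_sub_ρ_pos]
  set D := c.dissipation η X Z Q with hDdef
  set b := load η ζ with hbdef
  have hDc : Continuous D := hL.dissipation_cont
  have hbc : Continuous b := hL.load_cont
  have hD0 : ∀ r, 0 ≤ D r := c.dissipation_nonneg η X Z Q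
  have hb0 : ∀ r, 0 ≤ b r := load_nonneg η ζ
  intro t ht
  -- The majorant comes from `2 |y| ≤ l + y ^ 2 / l`, applied to the undisturbed slope of `X` and to
  -- `η`, and from `|ζ| ≤ |ζ| / l`. Over time at most `3τ` it grows to at most `6 τ l + 2 l`.
  have hB' : ∀ r, HasDerivAt (fun t => 2 * l * (t - a) + l⁻¹ * ((∫ r in a..t, D r) +
      ∫ r in a..t, b r)) (2 * l * 1 + l⁻¹ * (D r + b r)) r := fun r =>
    (((hasDerivAt_id r).sub_const a).const_mul (2 * l)).add
      (((hasDerivAt_integral_right hDc a r).add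
        (hasDerivAt_integral_right hbc a r)).const_mul l⁻¹)
  have key := image_norm_le_of_norm_deriv_right_le_deriv_boundary
    (f := fun t => X t - X a) (a := a) (b := a + 3 * c.τ)
    ((hL.X_cont.sub continuous_const).continuousOn)
    (fun r hr => (hL.X_deriv r (ha.trans hr.1)).sub_const (X a)) (by simp) hB'
    (fun r hr => by
      rw [Real.norm_eq_abs]
      set Y := -c.k₁ * X r + (1 + c.ρ) * Q r with hY
      have e1 : -c.k₁ * X r + (1 + c.ρ) * (Q r + η r) - ζ r = Y + (1 + c.ρ) * η r - ζ r := by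
        rw [hY]; ring
      have y1 : ∀ y : ℝ, 2 * |y| ≤ l + l⁻¹ * y ^ 2 := by
        intro y
        have : l + l⁻¹ * y ^ 2 - 2 * |y| = l⁻¹ * (l - |y|) ^ 2 := by
          rw [← sq_abs y]; field_simp; ring
        have h0 : 0 ≤ l⁻¹ * (l - |y|) ^ 2 := by positivity
        linarith
      have y2 := y1 Y
      have y3 := y1 (η r)
      have y4 : (1 + c.ρ) * |η r| ≤ 2 * |η r| :=
        mul_le_mul_of_nonneg_right hρ2 (abs_nonneg _)
      have y5 : |ζ r| ≤ l⁻¹ * |ζ r| :=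
        le_mul_of_one_le_left (abs_nonneg _) ((one_le_inv₀ hl).2 hl1)
      have y6 : l⁻¹ * Y ^ 2 ≤ l⁻¹ * D r := by
        refine mul_le_mul_of_nonneg_left ?_ (inv_pos.2 hl).le
        rw [hDdef]; unfold dissipation; rw [← hY]
        exact le_add_of_nonneg_right (sq_nonneg _)
      have y7 : l⁻¹ * b r = l⁻¹ * |ζ r| + l⁻¹ * η r ^ 2 := by
        rw [hbdef]; unfold load; ring
      have y8 := abs_sub (Y + (1 + c.ρ) * η r) (ζ r)
      have y9 := abs_add_le Y ((1 + c.ρ) * η r)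
      rw [abs_mul (1 + c.ρ), abs_of_pos hρ] at y9
      rw [e1, mul_add, y7]
      linarith [abs_nonneg Y])
    ht
  rw [Real.norm_eq_abs] at key
  have i1 : ∫ r in a..t, D r ≤ l ^ 2 :=
    (integral_mono_interval_of_nonneg hDc hD0 le_rfl ht.1 ht.2).trans hD
  have i2 : ∫ r in a..t, b r ≤ l ^ 2 :=
    (integral_mono_interval_of_nonneg hbc hb0 le_rfl ht.1 ht.2).trans hB
  have i3 : l⁻¹ * ((∫ r in a..t, D r) + ∫ r in a..t, b r) ≤ l⁻¹ * (l ^ 2 + l ^ 2) :=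
    mul_le_mul_of_nonneg_left (by linarith) (inv_pos.2 hl).le
  have i4 : l⁻¹ * (l ^ 2 + l ^ 2) = 2 * l := by field_simp; ring
  have i5 : 2 * l * (t - a) ≤ 2 * l * (3 * c.τ) :=
    mul_le_mul_of_nonneg_left (by linarith [ht.2]) (by positivity)
  linarith

/-- In a time window with little dissipation and little forcing, the state is close to an
equilibrium. -/
theorem exists_energy_shift_le : ∃ C, 0 ≤ C ∧ ∀ (ε : ℝ) (η ζ X Z Q : ℝ → ℝ),
    c.IsLoop ε η ζ X Z Q → ε ≤ 1 → ∀ a l : ℝ, 2 * c.τ ≤ a → 0 < l → l ≤ 1 →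
    ∫ r in a..(a + 3 * c.τ), c.dissipation η X Z Q r ≤ l ^ 2 →
    ∫ r in a..(a + 3 * c.τ), load η ζ r ≤ l ^ 2 →
    ∃ v, ∃ T ∈ Icc a (a + 3 * c.τ), c.energy ε η (fun t => X t - v * ((1 + c.ρ) / c.k₁))
      (fun t => Z t + v * ((1 + c.s) / c.k₂)) (fun t => Q t - v) T ≤ C * l ^ 2 := by
  have hτ := c.τ_pos
  have hρ := c.one_add_ρ_pos
  have hs := c.one_add_s_pos
  have hk₁ := c.k₁_pos
  have hk₂ := c.k₂_pos
  obtain ⟨C₁, hC₁, hfirst⟩ := c.exists_first_layer_bound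
  obtain ⟨C₂, hC₂, hsecond⟩ := c.exists_second_layer_bound
  set K := 6 * c.τ + 2 with hK
  set C₃ := C₁ * (1 + K ^ 2) with hC₃
  set C₄ := K ^ 2 + C₃ + C₂ * (1 + C₃) with hC₄
  have hC₃0 : 0 ≤ C₃ := by positivity
  have hC₄0 : 0 ≤ C₄ := by positivity
  set κ₁ := c.k₁ / (1 + c.ρ) with hκ₁
  set κ₂ := c.k₂ / (1 + c.s) with hκ₂
  have hκ₁0 : 0 < κ₁ := div_pos hk₁ hρ
  have hκ₂0 : 0 < κ₂ := div_pos hk₂ hs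
  refine ⟨(κ₁ + κ₂ + 1) * C₄ * ((5 + 2 * c.τ) / c.τ) + C₄ * (4 + 2 * c.τ), by positivity, ?_⟩
  intro ε η ζ X Z Q hL hε a l ha hl hl1 hD hB
  set D := c.dissipation η X Z Q with hDdef
  set b := load η ζ with hbdef
  have hDc : Continuous D := hL.dissipation_cont
  have hbc : Continuous b := hL.load_cont
  have hD0 : ∀ r, 0 ≤ D r := c.dissipation_nonneg η X Z Q
  have hb0 : ∀ r, 0 ≤ b r := load_nonneg η ζ
  have hXa : ∀ t ∈ Icc a (a + 3 * c.τ), |X t - X a| ≤ K * l :=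
    hL.abs_sub_le_of_integral_le ha hl hl1 hD hB
  -- The equilibrium whose first component is `X a`.
  set v := X a * κ₁ with hv
  have hv' : v * ((1 + c.ρ) / c.k₁) = X a := by rw [hv, hκ₁]; field_simp
  have hS := hL.shift v
  set X' := fun t => X t - v * ((1 + c.ρ) / c.k₁) with hX'
  set Z' := fun t => Z t + v * ((1 + c.s) / c.k₂) with hZ'
  set Q' := fun t => Q t - v with hQ'
  set g := c.forwardWave η X' Q' with hg
  set p := c.backwardWave η X' Z' Q' with hp
  have hgv : ∀ r, g r = c.forwardWave η X Q r + v := by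
    intro r; rw [hg, hX', hQ']; unfold forwardWave; field_simp; ring
  have hX2 : ∀ r ∈ Icc a (a + 3 * c.τ), X' r ^ 2 ≤ K ^ 2 * l ^ 2 := by
    intro r hr
    have h1 : |X' r| ≤ K * l := by simpa [hX', hv'] using hXa r hr
    rw [← mul_pow, ← sq_abs]
    exact pow_le_pow_left₀ (abs_nonneg _) h1 2
  have hQg : ∀ r ∈ Icc a (a + 3 * c.τ), Q' r ^ 2 + g r ^ 2 ≤ C₃ * (D r + b r + l ^ 2) := by
    intro r hr
    have h1 := hfirst (X' r) (Q' r) (η r)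
    have h2 : (-c.k₁ * X' r + (1 + c.ρ) * Q' r) ^ 2 ≤ D r := by
      have : -c.k₁ * X' r + (1 + c.ρ) * Q' r = -c.k₁ * X r + (1 + c.ρ) * Q r := by
        rw [hX', hQ']; field_simp; ring
      rw [this, hDdef]
      exact le_add_of_nonneg_right (sq_nonneg _)
    have h3 : η r ^ 2 ≤ b r := le_add_of_nonneg_left (abs_nonneg _)
    have h4 := hX2 r hr
    have h5 : (-c.k₁ * X' r + (1 + c.ρ) * Q' r) ^ 2 + η r ^ 2 + X' r ^ 2 ≤
        (1 + K ^ 2) * (D r + b r + l ^ 2) := by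
      have : 0 ≤ K ^ 2 * (D r + b r) := mul_nonneg (sq_nonneg _) (add_nonneg (hD0 r) (hb0 r))
      nlinarith [sq_nonneg l]
    refine h1.trans ((mul_le_mul_of_nonneg_left h5 hC₁).trans (le_of_eq ?_))
    rw [hC₃]; ring
  -- The values at `t - τ` occur because the input of the second layer is the wave emitted at `t -
  -- τ`. This costs the first third of the window; the second third holds the history of the energy
  -- at `T`, which is sought in the last third.
  set R : ℝ → ℝ := fun t => D t + b t + (D (t - c.τ) + b (t - c.τ)) + l ^ 2 with hR
  have hRc : Continuous R := by rw [hR]; fun_prop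
  have hall : ∀ r ∈ Icc (a + c.τ) (a + 3 * c.τ),
      X' r ^ 2 + Z' r ^ 2 + Q' r ^ 2 + (g r ^ 2 + p r ^ 2) ≤ C₄ * R r := by
    intro r hr
    have hr1 : r ∈ Icc a (a + 3 * c.τ) := ⟨by linarith [hr.1], hr.2⟩
    have hr2 : r - c.τ ∈ Icc a (a + 3 * c.τ) := ⟨by linarith [hr.1], by linarith [hr.2]⟩
    have h1 := hX2 r hr1
    have h2 := hQg r hr1
    have h3 := hQg (r - c.τ) hr2
    have h4 := hsecond (Z' r) (g (r - c.τ))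
    have h5 : (-c.k₂ * Z' r + (1 + c.s) * g (r - c.τ)) ^ 2 ≤ D r := by
      have : -c.k₂ * Z' r + (1 + c.s) * g (r - c.τ) =
          -c.k₂ * Z r + (1 + c.s) * c.forwardWave η X Q (r - c.τ) := by
        rw [hgv, hZ']; field_simp; ring
      rw [this, hDdef]
      exact le_add_of_nonneg_left (sq_nonneg _)
    have hpr : p r = -c.k₂ * Z' r + c.s * g (r - c.τ) := rfl
    have a1 := hD0 r
    have a2 := hD0 (r - c.τ)
    have a3 := hb0 r
    have a4 := hb0 (r - c.τ)
    have a5 := sq_nonneg l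
    have b1 : D r + b r + l ^ 2 ≤ R r := by simp only [hR]; linarith
    have b2 : D (r - c.τ) + b (r - c.τ) + l ^ 2 ≤ R r := by simp only [hR]; linarith
    have b3 : D r ≤ R r := by linarith
    have b4 : l ^ 2 ≤ R r := by linarith
    have c1 := mul_le_mul_of_nonneg_left b1 hC₃0
    have c2 := mul_le_mul_of_nonneg_left b2 hC₃0
    have c3 : C₂ * ((-c.k₂ * Z' r + (1 + c.s) * g (r - c.τ)) ^ 2 + g (r - c.τ) ^ 2) ≤
        C₂ * (R r + C₃ * R r) :=
      mul_le_mul_of_nonneg_left (by linarith [sq_nonneg (Q' (r - c.τ))]) hC₂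
    have c4 := mul_le_mul_of_nonneg_left b4 (sq_nonneg K)
    rw [hpr, hC₄]
    linarith
  have hRint : ∫ r in (a + c.τ)..(a + 3 * c.τ), R r ≤ (4 + 2 * c.τ) * l ^ 2 := by
    have hW : ∫ r in a..(a + 3 * c.τ), (D r + b r) ≤ 2 * l ^ 2 := by
      rw [intervalIntegral.integral_add (hDc.intervalIntegrable _ _) (hbc.intervalIntegrable _ _)]
      linarith
    have := integral_add_shift_le (w := fun r => D r + b r) (hDc.add hbc)
      (fun r => add_nonneg (hD0 r) (hb0 r)) hτ.le hW
    linarith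
  have hR0 : ∀ r, 0 ≤ R r := fun r => by
    have := hD0 r; have := hD0 (r - c.τ); have := hb0 r; have := hb0 (r - c.τ)
    simp only [hR]; positivity
  -- The energy needs pointwise values at `T`, obtained from the mean of `R` over the last third.
  -- The `5`, against `4` in the bound for the integral, makes the contradiction strict.
  obtain ⟨T, hT, hRT⟩ : ∃ T ∈ Icc (a + 2 * c.τ) (a + 3 * c.τ),
      R T ≤ (5 + 2 * c.τ) * l ^ 2 / c.τ := by
    by_contra! hcon
    have h1 : ∫ r in (a + 2 * c.τ)..(a + 3 * c.τ), (5 + 2 * c.τ) * l ^ 2 / c.τ ≤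
        ∫ r in (a + 2 * c.τ)..(a + 3 * c.τ), R r :=
      intervalIntegral.integral_mono_on (by linarith) intervalIntegrable_const
        (hRc.intervalIntegrable _ _) fun r hr => (hcon r hr).le
    rw [intervalIntegral.integral_const, smul_eq_mul,
      show (a + 3 * c.τ - (a + 2 * c.τ)) * ((5 + 2 * c.τ) * l ^ 2 / c.τ) =
        (5 + 2 * c.τ) * l ^ 2 by field_simp; ring] at h1
    have h2 := integral_mono_interval_of_nonneg hRc hR0 (a := a + c.τ) (b := a + 3 * c.τ)
      (a' := a + 2 * c.τ) (b' := a + 3 * c.τ) (by linarith) (by linarith) le_rfl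
    have h3 : 0 < l ^ 2 := by positivity
    linarith
  refine ⟨v, T, ⟨by linarith [hT.1], hT.2⟩, ?_⟩
  have f1 : ∫ r in (T - c.τ)..T, (g r ^ 2 + p r ^ 2) ≤ C₄ * ((4 + 2 * c.τ) * l ^ 2) := by
    have h1 : ∫ r in (T - c.τ)..T, (g r ^ 2 + p r ^ 2) ≤ ∫ r in (T - c.τ)..T, C₄ * R r :=
      intervalIntegral.integral_mono_on (by linarith)
        (((hS.forwardWave_cont.pow 2).add (hS.backwardWave_cont.pow 2)).intervalIntegrable _ _)
        ((continuous_const.mul hRc).intervalIntegrable _ _) fun r hr => by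
          have := hall r ⟨by linarith [hr.1, hT.1], by linarith [hr.2, hT.2]⟩
          linarith [sq_nonneg (X' r), sq_nonneg (Z' r), sq_nonneg (Q' r)]
    rw [intervalIntegral.integral_const_mul] at h1
    have h2 := integral_mono_interval_of_nonneg hRc hR0 (a := a + c.τ) (b := a + 3 * c.τ)
      (a' := T - c.τ) (b' := T) (by linarith [hT.1]) (by linarith) hT.2
    exact h1.trans (mul_le_mul_of_nonneg_left (h2.trans hRint) hC₄0)
  have f2 := hall T ⟨by linarith [hT.1], hT.2⟩
  have f3 : κ₁ * X' T ^ 2 + κ₂ * Z' T ^ 2 + ε * Q' T ^ 2 ≤ (κ₁ + κ₂ + 1) * (C₄ * R T) := by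
    have s1 := sq_nonneg (X' T)
    have s2 := sq_nonneg (Z' T)
    have s3 := sq_nonneg (Q' T)
    have s4 := sq_nonneg (g T)
    have s5 := sq_nonneg (p T)
    have t1 := mul_le_mul_of_nonneg_left (show X' T ^ 2 ≤ C₄ * R T by linarith) hκ₁0.le
    have t2 := mul_le_mul_of_nonneg_left (show Z' T ^ 2 ≤ C₄ * R T by linarith) hκ₂0.le
    have t3 := mul_le_mul_of_nonneg_right hε s3
    linarith
  have f4 : (κ₁ + κ₂ + 1) * (C₄ * R T) ≤
      (κ₁ + κ₂ + 1) * (C₄ * ((5 + 2 * c.τ) * l ^ 2 / c.τ)) :=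
    mul_le_mul_of_nonneg_left (mul_le_mul_of_nonneg_left hRT hC₄0) (by positivity)
  calc c.energy ε η X' Z' Q' T
      = κ₁ * X' T ^ 2 + κ₂ * Z' T ^ 2 + ε * Q' T ^ 2 +
        ∫ r in (T - c.τ)..T, (g r ^ 2 + p r ^ 2) := rfl
    _ ≤ (κ₁ + κ₂ + 1) * (C₄ * ((5 + 2 * c.τ) * l ^ 2 / c.τ)) + C₄ * ((4 + 2 * c.τ) * l ^ 2) := by
      linarith
    _ = _ := by ring

end LoopCoeffs

/-- Choose `N` with `u N` within `l` of the supremum; as the estimate is one-sided, monotonicity is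
not needed. -/
theorem exists_tail_le {u : ℝ → ℝ} {a B l : ℝ} (hB : ∀ t ≥ a, u t ≤ B) (hl : 0 < l) :
    ∃ N ≥ a, ∀ t ≥ N, u t - u N ≤ l := by
  have hbdd : BddAbove (u '' Ici a) := ⟨B, by rintro _ ⟨t, ht, rfl⟩; exact hB t ht⟩
  obtain ⟨_, ⟨N, hN, rfl⟩, hlt⟩ := exists_lt_of_lt_csSup ((nonempty_Ici (a := a)).image u)
    (sub_lt_self (sSup (u '' Ici a)) hl)
  refine ⟨N, hN, fun t ht => ?_⟩
  have := le_csSup hbdd (mem_image_of_mem u (show t ∈ Ici a from le_trans hN ht))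
  linarith

/-! ### A settling time independent of `ε`. -/

namespace LoopCoeffs

variable (c : LoopCoeffs)

/-- If the total forcing is finite, all solutions with bounded initial energy are close to an
equilibrium after a time that does not depend on `ε ∈ (0, 1]`. -/
theorem exists_settling_time {η ζ : ℝ → ℝ} (hη : Continuous η) (hζ : Continuous ζ) {B : ℝ}
    (hB : ∀ t ≥ 2 * c.τ, ∫ r in (2 * c.τ)..t, load η ζ r ≤ B) (M : ℝ) {γ : ℝ} (hγ : 0 < γ) :
    ∃ N ≥ 2 * c.τ, ∀ (ε : ℝ) (X Z Q : ℝ → ℝ), c.IsLoop ε η ζ X Z Q → ε ≤ 1 →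
      c.energy ε η X Z Q (2 * c.τ) ≤ M → ∃ v, ∀ t ≥ N,
        |X t - v * ((1 + c.ρ) / c.k₁)| ≤ γ ∧ |Z t + v * ((1 + c.s) / c.k₂)| ≤ γ := by
  have hτ := c.τ_pos
  have hΛ := c.loadRate_pos
  have hδ := c.dissRate_pos
  obtain ⟨C, hC, hwin⟩ := c.exists_energy_shift_le
  have hκ₁ : 0 < c.k₁ / (1 + c.ρ) := div_pos c.k₁_pos c.one_add_ρ_pos
  have hκ₂ : 0 < c.k₂ / (1 + c.s) := div_pos c.k₂_pos c.one_add_s_pos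
  have hlc : Continuous (load η ζ) := by unfold load; fun_prop
  have hl0 := load_nonneg η ζ
  set κ := min (c.k₁ / (1 + c.ρ)) (c.k₂ / (1 + c.s)) with hκ
  have hκ0 : 0 < κ := lt_min hκ₁ hκ₂
  -- With this `l`, Gronwall started at energy `C * l ^ 2` under a remaining load `l ^ 2` keeps the
  -- energy below `κ * γ ^ 2`.
  obtain ⟨l, hl, hl1, hlγ⟩ : ∃ l : ℝ, 0 < l ∧ l ≤ 1 ∧
      (1 + C * l ^ 2) * Real.exp (c.loadRate * l ^ 2) ≤ 1 + κ * γ ^ 2 := by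
    have hcont : Continuous fun l : ℝ => (1 + C * l ^ 2) * Real.exp (c.loadRate * l ^ 2) := by
      fun_prop
    have h1 : ∀ᶠ l in 𝓝 (0 : ℝ), (1 + C * l ^ 2) * Real.exp (c.loadRate * l ^ 2) <
        1 + κ * γ ^ 2 := by
      refine hcont.continuousAt.eventually_lt_const ?_
      have : 0 < κ * γ ^ 2 := by positivity
      norm_num; linarith
    have h2 : ∀ᶠ l in 𝓝[>] (0 : ℝ), 0 < l ∧ l ≤ 1 ∧
        (1 + C * l ^ 2) * Real.exp (c.loadRate * l ^ 2) < 1 + κ * γ ^ 2 := by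
      filter_upwards [self_mem_nhdsWithin, Ioc_mem_nhdsGT (zero_lt_one' ℝ),
        nhdsWithin_le_nhds h1] with l h3 h4 h5
      exact ⟨h3, h4.2, h5⟩
    obtain ⟨l, hl, h3, h4⟩ := h2.exists
    exact ⟨l, hl, h3, h4.le⟩
  obtain ⟨a₀, ha₀, htail⟩ := exists_tail_le (u := fun t => ∫ r in (2 * c.τ)..t, load η ζ r) hB
    (show 0 < l ^ 2 by positivity)
  have htail' : ∀ x y, a₀ ≤ x → x ≤ y → ∫ r in x..y, load η ζ r ≤ l ^ 2 := by
    intro x y hx hxy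
    have h1 := htail y (hx.trans hxy)
    rw [intervalIntegral.integral_interval_sub_left (hlc.intervalIntegrable _ _)
      (hlc.intervalIntegrable _ _)] at h1
    exact (integral_mono_interval_of_nonneg hlc hl0 hx hxy le_rfl).trans h1
  set K := (1 + M) * Real.exp (c.loadRate * B) with hK
  set G := K + c.loadRate * K * B with hG
  -- `G` bounds `dissRate` times the total dissipation, so one of `n` successive windows of length
  -- `3τ` dissipates at most `l ^ 2`. Which window it is, and the equilibrium found there, depend on
  -- `ε`; the end of the last window does not. The `+ 1` ensures `n > 0`.
  obtain ⟨n, hn⟩ := exists_nat_ge (G / (c.dissRate * l ^ 2) + 1)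
  refine ⟨a₀ + 3 * n * c.τ, ha₀.trans (le_add_of_nonneg_right (by positivity)), ?_⟩
  intro ε X Z Q hL hε hM
  have hM0 : 0 ≤ M := (c.energy_nonneg hL.ε_pos.le η X Z Q _).trans hM
  have hB0 : 0 ≤ B := by simpa using hB (2 * c.τ) le_rfl
  have hK0 : 0 ≤ K := by positivity
  have hG0 : 0 ≤ G := by positivity
  have hEK : ∀ t ≥ 2 * c.τ, 1 + c.energy ε η X Z Q t ≤ K := by
    intro t ht
    refine (hL.energy_le le_rfl ht).trans (mul_le_mul (by linarith) ?_ (Real.exp_pos _).le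
      (by linarith))
    exact Real.exp_le_exp.2 (mul_le_mul_of_nonneg_left (hB t ht) hΛ.le)
  have hn0 : 0 < n := by
    have : (0 : ℝ) < n := lt_of_lt_of_le (by positivity) hn
    exact_mod_cast this
  have htot : ∫ r in (2 * c.τ)..(a₀ + 3 * n * c.τ), c.dissipation η X Z Q r ≤ n * l ^ 2 := by
    have hle : 2 * c.τ ≤ a₀ + 3 * n * c.τ :=
      le_add_of_le_of_nonneg ha₀ (by positivity)
    have h1 := hL.integral_dissipation_le le_rfl hle (fun r hr => hEK r hr.1)
    have h2 := mul_le_mul_of_nonneg_left (hB _ hle) (mul_nonneg hΛ.le hK0)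
    have h3 : G / (c.dissRate * l ^ 2) ≤ n := by linarith
    rw [div_le_iff₀ (by positivity)] at h3
    have h4 : c.dissRate * ∫ r in (2 * c.τ)..(a₀ + 3 * n * c.τ), c.dissipation η X Z Q r ≤
        c.dissRate * (n * l ^ 2) := by linarith
    exact le_of_mul_le_mul_left h4 hδ
  obtain ⟨i, hi, hDi⟩ : ∃ i ∈ Finset.range n,
      ∫ r in (a₀ + 3 * i * c.τ)..(a₀ + 3 * i * c.τ + 3 * c.τ), c.dissipation η X Z Q r ≤
        l ^ 2 := by
    refine Finset.exists_le_of_sum_le (Finset.nonempty_range_iff.2 hn0.ne') ?_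
    have hsum := intervalIntegral.sum_integral_adjacent_intervals
      (f := c.dissipation η X Z Q) (μ := MeasureTheory.volume)
      (a := fun i : ℕ => a₀ + 3 * i * c.τ) (n := n)
      (fun i _ => hL.dissipation_cont.intervalIntegrable _ _)
    have hcongr : ∀ i : ℕ, a₀ + 3 * i * c.τ + 3 * c.τ = a₀ + 3 * (i + 1 : ℕ) * c.τ := by
      intro i; push_cast; ring
    simp only [hcongr]
    rw [hsum, Finset.sum_const, Finset.card_range, nsmul_eq_mul]
    refine le_trans ?_ htot
    refine integral_mono_interval_of_nonneg hL.dissipation_cont (c.dissipation_nonneg η X Z Q)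
      (by simpa using ha₀) ?_ le_rfl
    have : (0 : ℝ) ≤ 3 * n * c.τ := by positivity
    simpa using this
  have hin : (i : ℝ) + 1 ≤ n := by exact_mod_cast Finset.mem_range.1 hi
  have hi0 : (0 : ℝ) ≤ 3 * i * c.τ := by positivity
  obtain ⟨v, T, hT, hET⟩ := hwin ε η ζ X Z Q hL hε (a₀ + 3 * i * c.τ) l (by linarith) hl hl1 hDi
    (htail' _ _ (by linarith) (by linarith))
  refine ⟨v, fun t ht => ?_⟩
  have hTt : T ≤ t := by
    have := hT.2
    have h2 := mul_le_mul_of_nonneg_right hin hτ.le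
    linarith
  have hTa : a₀ ≤ T := by linarith [hT.1]
  have h1 := (hL.shift v).energy_le (ha₀.trans hTa) hTt
  set E := c.energy ε η (fun t => X t - v * ((1 + c.ρ) / c.k₁))
    (fun t => Z t + v * ((1 + c.s) / c.k₂)) (fun t => Q t - v) with hE
  have h2 : 1 + E t ≤ 1 + κ * γ ^ 2 := by
    refine (h1.trans ?_).trans hlγ
    refine mul_le_mul (by linarith) ?_ (Real.exp_pos _).le (by positivity)
    exact Real.exp_le_exp.2 (mul_le_mul_of_nonneg_left (htail' _ _ hTa hTt) hΛ.le)
  have h3 := c.layers_le_energy hL.ε_pos.le η (fun t => X t - v * ((1 + c.ρ) / c.k₁))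
    (fun t => Z t + v * ((1 + c.s) / c.k₂)) (fun t => Q t - v) t
  rw [← hE] at h3
  have aux : ∀ k y : ℝ, κ ≤ k → k * y ^ 2 ≤ κ * γ ^ 2 → |y| ≤ γ := by
    intro k y hk hy
    refine abs_le_of_sq_le_sq ?_ hγ.le
    have : κ * y ^ 2 ≤ κ * γ ^ 2 := (mul_le_mul_of_nonneg_right hk (sq_nonneg y)).trans hy
    exact le_of_mul_le_mul_left this hκ0
  have s1 := mul_nonneg hκ₁.le (sq_nonneg (X t - v * ((1 + c.ρ) / c.k₁)))
  have s2 := mul_nonneg hκ₂.le (sq_nonneg (Z t + v * ((1 + c.s) / c.k₂)))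
  exact ⟨aux _ _ (min_le_left _ _) (by linarith), aux _ _ (min_le_right _ _) (by linarith)⟩

end LoopCoeffs

/-! ### Functions of bounded variation on a half-line -/

/-- The increments of a function of bounded variation are controlled by a bounded monotone
function. -/
theorem BoundedVariationOn.exists_monotone_control {f : ℝ → ℝ}
    (hf : BoundedVariationOn f (Ici 0)) :
    ∃ v : ℝ → ℝ, ∃ B : ℝ, Monotone v ∧ (∀ t, 0 ≤ v t ∧ v t ≤ B) ∧
      ∀ x y, 0 ≤ x → x ≤ y → |f y - f x| ≤ v y - v x := by
  have hfin : ∀ a b : ℝ, eVariationOn f (Ici 0 ∩ Icc a b) ≠ ⊤ := fun a b =>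
    ne_top_of_le_ne_top hf (eVariationOn.mono f inter_subset_left)
  refine ⟨fun t => (eVariationOn f (Ici 0 ∩ Icc 0 t)).toReal, (eVariationOn f (Ici 0)).toReal,
    fun x y hxy => ?_, fun t => ⟨ENNReal.toReal_nonneg, ?_⟩, fun x y hx hxy => ?_⟩
  · exact ENNReal.toReal_mono (hfin _ _)
      (eVariationOn.mono f (inter_subset_inter_right _ (Icc_subset_Icc_right hxy)))
  · exact ENNReal.toReal_mono hf (eVariationOn.mono f inter_subset_left)
  · have hadd := eVariationOn.Icc_add_Icc f (s := Ici 0) hx hxy hx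
    have h1 : edist (f y) (f x) ≤ eVariationOn f (Ici 0 ∩ Icc x y) :=
      eVariationOn.edist_le f ⟨hx.trans hxy, hxy, le_rfl⟩ ⟨hx, le_rfl, hxy⟩
    have h2 : |f y - f x| ≤ (eVariationOn f (Ici 0 ∩ Icc x y)).toReal := by
      rw [← Real.dist_eq, dist_edist]
      exact ENNReal.toReal_mono (hfin _ _) h1
    simp only
    rw [← hadd, ENNReal.toReal_add (hfin _ _) (hfin _ _)]
    linarith

/-- A function of bounded variation is Cauchy at infinity. -/
theorem BoundedVariationOn.exists_tail_abs_sub_le {f : ℝ → ℝ} (hf : BoundedVariationOn f (Ici 0))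
    {l : ℝ} (hl : 0 < l) : ∃ N ≥ 0, ∀ t ≥ N, |f t - f N| ≤ l := by
  obtain ⟨v, B, -, hvB, hv⟩ := hf.exists_monotone_control
  obtain ⟨N, hN, h⟩ := exists_tail_le (u := v) (a := 0) (fun t _ => (hvB t).2) hl
  exact ⟨N, hN, fun t ht => (hv N t hN ht).trans (h t ht)⟩

/-- The mean of `f` over `[t, t + 1]`. -/
noncomputable def forwardMean (f : ℝ → ℝ) (t : ℝ) : ℝ := ∫ r in t..(t + 1), f r

theorem hasDerivAt_forwardMean {f : ℝ → ℝ} (hf : Continuous f) (t : ℝ) :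
    HasDerivAt (forwardMean f) (f (t + 1) - f t) t := by
  have h := (hasDerivAt_integral_window hf 1 (t + 1)).comp_add_const t 1
  rw [add_sub_cancel_right] at h
  refine h.congr_of_eventuallyEq (Eventually.of_forall fun r => ?_)
  simp only [forwardMean, add_sub_cancel_right]

theorem abs_sub_forwardMean_le {f v : ℝ → ℝ} (hf : Continuous f) (hm : Monotone v)
    (hv : ∀ x y, 0 ≤ x → x ≤ y → |f y - f x| ≤ v y - v x) {t : ℝ} (ht : 0 ≤ t) :
    |f t - forwardMean f t| ≤ v (t + 1) - v t := by
  have e : f t - forwardMean f t = ∫ r in t..(t + 1), (f t - f r) := by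
    rw [intervalIntegral.integral_sub intervalIntegrable_const (hf.intervalIntegrable _ _),
      intervalIntegral.integral_const]
    simp [forwardMean]
  rw [e, ← Real.norm_eq_abs]
  have h := intervalIntegral.norm_integral_le_of_norm_le_const (a := t) (b := t + 1)
    (f := fun r => f t - f r) (C := v (t + 1) - v t) (fun r hr => by
      rw [uIoc_of_le (by linarith)] at hr
      rw [Real.norm_eq_abs, abs_sub_comm]
      linarith [hv t r ht hr.1.le, hm hr.2])
  simpa using h

/-- The forcing that remains after removing the slowly varying mean of a function of bounded
variation is integrable. -/
theorem exists_integral_load_le {f v : ℝ → ℝ} {B : ℝ} (hf : Continuous f) (hm : Monotone v)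
    (hvB : ∀ t, 0 ≤ v t ∧ v t ≤ B)
    (hv : ∀ x y, 0 ≤ x → x ≤ y → |f y - f x| ≤ v y - v x) (k : ℝ) {a : ℝ} (ha : 0 ≤ a) :
    ∃ C, ∀ t ≥ a, ∫ r in a..t, LoopCoeffs.load (fun t => f t - forwardMean f t)
      (fun t => k * (f (t + 1) - f t)) r ≤ C := by
  have hmean : Continuous (forwardMean f) :=
    continuous_iff_continuousAt.2 fun t => (hasDerivAt_forwardMean hf t).continuousAt
  have hB : 0 ≤ B := (hvB 0).1.trans (hvB 0).2
  have iv : ∀ x y, IntervalIntegrable v MeasureTheory.volume x y := fun x y =>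
    hm.intervalIntegrable
  have iv' : ∀ x y, IntervalIntegrable (fun r => v (r + 1)) MeasureTheory.volume x y :=
    fun x y => (show Monotone fun r => v (r + 1) from fun p q h => hm (by linarith)).intervalIntegrable
  -- The load is at most `(|k| + B) (v (r + 1) - v r)`: `|k|` comes from `ζ`, and `B` from bounding
  -- one factor of `η ^ 2`. The integral of `v (r + 1) - v r` telescopes to a difference of two
  -- integrals over unit intervals, at most `B`.
  refine ⟨(|k| + B) * B, fun t ht => ?_⟩
  have h1 : ∫ r in a..t, LoopCoeffs.load (fun t => f t - forwardMean f t)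
      (fun t => k * (f (t + 1) - f t)) r ≤ ∫ r in a..t, (|k| + B) * (v (r + 1) - v r) := by
    refine intervalIntegral.integral_mono_on ht (Continuous.intervalIntegrable ?_ _ _)
      (((iv' _ _).sub (iv _ _)).const_mul _) fun r hr => ?_
    · unfold LoopCoeffs.load; fun_prop
    · have hr0 : 0 ≤ r := ha.trans hr.1
      have b1 := abs_sub_forwardMean_le hf hm hv hr0
      have b2 := hv r (r + 1) hr0 (by linarith)
      have b3 : v (r + 1) - v r ≤ B := by linarith [(hvB (r + 1)).2, (hvB r).1]
      have b4 := mul_le_mul_of_nonneg_left b2 (abs_nonneg k)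
      have b5 : |f r - forwardMean f r| * |f r - forwardMean f r| ≤ B * (v (r + 1) - v r) :=
        mul_le_mul (b1.trans b3) b1 (abs_nonneg _) hB
      unfold LoopCoeffs.load
      rw [abs_mul, ← sq_abs (f r - forwardMean f r), sq]
      linarith
  refine h1.trans ?_
  rw [intervalIntegral.integral_const_mul]
  refine mul_le_mul_of_nonneg_left ?_ (by positivity)
  rw [intervalIntegral.integral_sub (iv' _ _) (iv _ _),
    intervalIntegral.integral_comp_add_right v 1,
    intervalIntegral.integral_interval_sub_interval_comm' (iv _ _) (iv _ _) (iv _ _)]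
  have h2 : ∫ r in t..(t + 1), v r ≤ B := by
    have := intervalIntegral.integral_mono_on (show t ≤ t + 1 by linarith) (iv t (t + 1))
      (intervalIntegrable_const (c := B)) fun r _ => (hvB r).2
    simpa using this
  have h3 : 0 ≤ ∫ r in a..(a + 1), v r :=
    intervalIntegral.integral_nonneg (by linarith) fun r _ => (hvB r).1
  linarith

/-! ### Convergence on the half-line -/

theorem uniformContinuousOn_Ici_of_tail {f : ℝ → ℝ} {a : ℝ} (hf : ContinuousOn f (Ici a))
    (htail : ∀ l > 0, ∃ N ≥ a, ∀ t ≥ N, |f t - f N| ≤ l) : UniformContinuousOn f (Ici a) := by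
  rw [Metric.uniformContinuousOn_iff]
  intro e he
  obtain ⟨N, hN, hNe⟩ := htail (e / 4) (by positivity)
  obtain ⟨δ, hδ, h⟩ := Metric.uniformContinuousOn_iff.1
    ((isCompact_Icc (a := a) (b := N + 1)).uniformContinuousOn_of_continuous
      (hf.mono Icc_subset_Ici_self)) e he
  -- Two points at distance less than `1` both lie in `[a, N + 1]` or both lie beyond `N`.
  refine ⟨min δ 1, by positivity, fun x hx y hy hxy => ?_⟩
  by_cases hcase : x ≤ N + 1 ∧ y ≤ N + 1
  · exact h x ⟨hx, hcase.1⟩ y ⟨hy, hcase.2⟩ (hxy.trans_le (min_le_left _ _))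
  · have h1 : dist x y < 1 := hxy.trans_le (min_le_right _ _)
    rw [Real.dist_eq, abs_lt] at h1
    have hxN : N ≤ x ∧ N ≤ y := by
      rw [not_and_or, not_le, not_le] at hcase
      rcases hcase with h | h <;> constructor <;> linarith
    have h2 := hNe x hxN.1
    have h3 := hNe y hxN.2
    rw [Real.dist_eq]
    rw [abs_sub_comm] at h3
    linarith [abs_sub_le (f x) (f N) (f y)]

theorem exists_bound_Ici_of_tail {f : ℝ → ℝ} {a : ℝ} (hf : ContinuousOn f (Ici a))
    (htail : ∀ l > 0, ∃ N ≥ a, ∀ t ≥ N, |f t - f N| ≤ l) : ∃ M, ∀ t ≥ a, |f t| ≤ M := by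
  obtain ⟨N, hN, hN1⟩ := htail 1 one_pos
  obtain ⟨M, hM⟩ := (isCompact_Icc (a := a) (b := N)).exists_bound_of_continuousOn
    (hf.mono Icc_subset_Ici_self)
  refine ⟨M + 1, fun t ht => ?_⟩
  rcases le_total t N with h | h
  · have := hM t ⟨ht, h⟩; rw [Real.norm_eq_abs] at this; linarith
  · have h1 := hM N ⟨hN, le_rfl⟩
    rw [Real.norm_eq_abs] at h1
    have h2 := abs_sub_abs_le_abs_sub (f t) (f N)
    linarith [hN1 t h]

/-- Induction along consecutive windows of length `d`. -/
theorem window_induction {d : ℝ} (hd : 0 < d) {p : ℝ → Prop} (h0 : ∀ t ∈ Ico (-d) 0, p t)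
    (hstep : ∀ T ≥ 0, (∀ t ∈ Ico (-d) T, p t) → ∀ t ∈ Ico T (T + d), p t) :
    ∀ t ≥ -d, p t := by
  have key : ∀ n : ℕ, ∀ t ∈ Ico (-d) (n * d), p t := by
    intro n
    induction n with
    | zero => simpa using h0
    | succ n ih =>
      intro t ht
      rcases lt_or_ge t (n * d) with h | h
      · exact ih t ⟨ht.1, h⟩
      · refine hstep (n * d) (by positivity) ih t ⟨h, ?_⟩
        have := ht.2; push_cast at this; linarith
  intro t ht
  obtain ⟨n, hn⟩ := exists_nat_gt (t / d)
  exact key n t ⟨ht, (div_lt_iff₀ hd).1 hn⟩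

/-- A limit of uniformly settling functions settles. -/
theorem abs_sub_le_of_vanishes {x : ℝ → ℝ → ℝ} {S : Set ℝ} {t u γ : ℝ}
    (h : Vanishes (fun ε t => x ε t - x 0 t) S) (ht : t ∈ S) (hu : u ∈ S)
    (hs : ∀ ε, 0 < ε → ε ≤ 1 → |x ε t - x ε u| ≤ γ) : |x 0 t - x 0 u| ≤ γ := by
  refine le_of_forall_pos_le_add fun e he => ?_
  obtain ⟨ε, h1, h2⟩ := ((h (e / 2) (half_pos he)).and (Ioc_mem_nhdsGT (zero_lt_one' ℝ))).exists
  have a1 := abs_le.1 (h1 t ht)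
  have a2 := abs_le.1 (h1 u hu)
  have a3 := abs_le.1 (hs ε h2.1 h2.2)
  rw [abs_le]
  constructor <;> linarith [a1.1, a1.2, a2.1, a2.2, a3.1, a3.2]

/-- Convergence on bounded intervals and uniform settling give convergence on the half-line. -/
theorem vanishes_Ici_of_settling {x : ℝ → ℝ → ℝ} {a : ℝ}
    (h : ∀ N, Vanishes (fun ε t => x ε t - x 0 t) (Icc a N))
    (hs : ∀ γ > 0, ∃ N ≥ a, ∀ ε, 0 < ε → ε ≤ 1 → ∀ t ≥ N, |x ε t - x ε N| ≤ γ) :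
    Vanishes (fun ε t => x ε t - x 0 t) (Ici a) := by
  intro γ hγ
  obtain ⟨N, hN, hset⟩ := hs (γ / 3) (by positivity)
  filter_upwards [h N (γ / 3) (by positivity), Ioc_mem_nhdsGT (zero_lt_one' ℝ)] with ε h1 h2 t ht
  rcases le_total t N with htN | htN
  · linarith [h1 t ⟨ht, htN⟩]
  · have a1 := abs_le.1 (h1 N ⟨hN, le_rfl⟩)
    have a2 := abs_le.1 (hset ε h2.1 h2.2 t htN)
    have a3 := abs_le.1 (abs_sub_le_of_vanishes (h t) (S := Icc a t) ⟨ht, le_rfl⟩ ⟨hN, htN⟩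
      (fun ε h3 h4 => hset ε h3 h4 t htN))
    rw [abs_le]
    constructor <;> linarith [a1.1, a1.2, a2.1, a2.2, a3.1, a3.2]

/-! ### Uniform settling of the layers of a family. -/

namespace LoopCoeffs

variable {c : LoopCoeffs}

/-- This is the factor of `Q` over one round trip, the contraction behind all half-line estimates
for `Q`. -/
theorem abs_s_mul_ρ_lt_one : |c.s * c.ρ| < 1 := by
  rw [abs_mul]
  nlinarith [c.s_lt, c.ρ_lt, abs_nonneg c.s, abs_nonneg c.ρ]

namespace IsFamily

variable {φ₁ φ₂ φ₃ H₁ H₂ H₃ f : ℝ → ℝ} {X Z Q : ℝ → ℝ → ℝ}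

/-- For `t ≥ 2τ`, after subtracting the slow response of the first layer, a member of the family
solves the loop equations with an integrable forcing. -/
theorem isLoop (hF : c.IsFamily φ₁ φ₂ φ₃ H₁ H₂ H₃ X Z Q)
    (hf : ContinuousOn f (Ici 0)) (h₁ : ∀ t ≥ 0, H₁ t = (1 + c.ρ) * f t)
    (h₂ : ∀ t ≥ c.τ, H₂ t = (1 + c.s) * ((1 + c.ρ) * f (t - c.τ)))
    (h₃ : ∀ t ≥ 2 * c.τ, H₃ t = c.s * ((1 + c.ρ) * f (t - 2 * c.τ))) {ε : ℝ} (hε : 0 < ε) :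
    c.IsLoop ε (fun t => f (max t 0) - forwardMean (fun t => f (max t 0)) t)
      (fun t => (1 + c.ρ) / c.k₁ * (f (max (t + 1) 0) - f (max t 0)))
      (fun t => X ε (max t 0) - (1 + c.ρ) / c.k₁ * forwardMean (fun t => f (max t 0)) t)
      (fun t => Z ε (max t 0)) (fun t => Q ε (max t 0)) := by
  have hτ := c.τ_pos
  have hk₁ := c.k₁_pos.ne'
  -- Freezing at `0` produces the globally continuous functions required by `IsLoop`. The equations
  -- are only claimed for `t ≥ 2τ`, where `t`, `t - τ` and `t - 2τ` are nonnegative.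
  have hext : ∀ y : ℝ → ℝ, ContinuousOn y (Ici 0) → Continuous fun t => y (max t 0) := fun y hy =>
    hy.comp_continuous (by fun_prop) fun t => le_max_right t 0
  have hsub : Ici (0 : ℝ) ⊆ Ici (-(2 * c.τ)) := Ici_subset_Ici.2 (by linarith)
  have hfc := hext f hf
  have hXc := hext _ ((hF.X_cont ε hε.le).mono hsub)
  have hZc := hext _ ((hF.Z_cont ε hε.le).mono hsub)
  have hQc := hext _ ((hF.Q_cont ε hε).mono hsub)
  set F := fun t => f (max t 0) with hFdef
  have hm : Continuous (forwardMean F) :=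
    continuous_iff_continuousAt.2 fun t => (hasDerivAt_forwardMean hfc t).continuousAt
  have hder : ∀ (y : ℝ → ℝ) (y' t : ℝ), 2 * c.τ ≤ t → HasDerivWithinAt y y' (Ici t) t →
      HasDerivWithinAt (fun t => y (max t 0)) y' (Ici t) t := by
    intro y y' t ht hy
    refine hy.congr (fun r hr => ?_) ?_
    · rw [max_eq_left]; exact le_trans (by linarith) (le_trans ht hr)
    · rw [max_eq_left]; linarith
  have hmax : ∀ t : ℝ, 0 ≤ t → max t 0 = t := fun t ht => max_eq_left ht
  refine ⟨hε, hfc.sub hm, ?_, hXc.sub (continuous_const.mul hm), hZc, hQc, fun t ht => ?_,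
    fun t ht => ?_, fun t ht => ?_⟩
  · exact continuous_const.mul ((hfc.comp (continuous_add_const 1)).sub hfc)
  · refine ((hder _ _ t ht (hF.X_deriv ε hε.le t (by linarith))).sub
      ((hasDerivAt_forwardMean hfc t).const_mul ((1 + c.ρ) / c.k₁)).hasDerivWithinAt).congr_deriv ?_
    rw [h₁ t (by linarith)]
    simp only [hFdef, hmax t (by linarith)]
    field_simp
    ring
  · refine (hder _ _ t ht (hF.Z_deriv ε hε.le t (by linarith))).congr_deriv ?_
    rw [h₂ t (by linarith)]
    simp only [forwardWave, hFdef, hmax t (by linarith), hmax (t - c.τ) (by linarith)]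
    field_simp
    ring
  · refine (hder _ _ t ht (hF.Q_deriv ε hε t (by linarith))).congr_deriv ?_
    have e : t - c.τ - c.τ = t - 2 * c.τ := by ring
    unfold inflow
    rw [h₃ t ht]
    simp only [backwardWave, forwardWave, hFdef, hmax t (by linarith),
      hmax (t - c.τ) (by linarith), e, hmax (t - 2 * c.τ) (by linarith)]
    field_simp
    ring

/-- The initial energies are bounded uniformly in `ε`. -/
theorem exists_energy_bound (hF : c.IsFamily φ₁ φ₂ φ₃ H₁ H₂ H₃ X Z Q)
    (hf : ContinuousOn f (Ici 0)) : ∃ M, ∀ ε, 0 < ε → ε ≤ 1 →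
    c.energy ε (fun t => f (max t 0) - forwardMean (fun t => f (max t 0)) t)
      (fun t => X ε (max t 0) - (1 + c.ρ) / c.k₁ * forwardMean (fun t => f (max t 0)) t)
      (fun t => Z ε (max t 0)) (fun t => Q ε (max t 0)) (2 * c.τ) ≤ M := by
  have hτ := c.τ_pos
  have hk₁ := c.k₁_pos
  have hk₂ := c.k₂_pos
  have hρ := c.one_add_ρ_pos
  have hρ2 : 1 + c.ρ ≤ 2 := by linarith [c.one_sub_ρ_pos]
  have hκ₁ : 0 < c.k₁ / (1 + c.ρ) := div_pos c.k₁_pos c.one_add_ρ_pos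
  have hκ₂ : 0 < c.k₂ / (1 + c.s) := div_pos c.k₂_pos c.one_add_s_pos
  set F := fun t => f (max t 0) with hFdef
  obtain ⟨M, hM⟩ := hF.exists_bound 2
  push_cast at hM
  obtain ⟨Nf, hNf⟩ := (isCompact_Icc (a := (0 : ℝ)) (b := 2 * c.τ)).exists_bound_of_continuousOn
    (hf.mono Icc_subset_Ici_self)
  simp only [Real.norm_eq_abs] at hNf
  have hmem : ∀ t ∈ Icc (0 : ℝ) (2 * c.τ), t ∈ Icc (-(2 * c.τ)) (2 * c.τ) := fun t ht =>
    ⟨by linarith [ht.1], ht.2⟩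
  have h0 : (0 : ℝ) ∈ Icc 0 (2 * c.τ) := ⟨le_rfl, by linarith⟩
  have hM0 : 0 ≤ M := (abs_nonneg _).trans (hM 0 le_rfl 0 (hmem 0 h0)).1
  have hNf0 : 0 ≤ Nf := (abs_nonneg _).trans (hNf 0 h0)
  set x₀ := M + (1 + c.ρ) / c.k₁ * |forwardMean F (2 * c.τ)| with hx₀
  set G := c.k₁ * M + M + 2 * Nf with hG
  have hG0 : 0 ≤ G := by positivity
  set P := c.k₂ * M + G with hP
  have hP0 : 0 ≤ P := by positivity
  refine ⟨c.k₁ / (1 + c.ρ) * x₀ ^ 2 + c.k₂ / (1 + c.s) * M ^ 2 + 1 * M ^ 2 +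
    (G ^ 2 + P ^ 2) * c.τ, fun ε hε hε1 => ?_⟩
  set η := fun t => F t - forwardMean F t with hη
  set X' := fun t => X ε (max t 0) - (1 + c.ρ) / c.k₁ * forwardMean F t with hX'
  set Z' := fun t => Z ε (max t 0) with hZ'
  set Q' := fun t => Q ε (max t 0) with hQ'
  have hsq : ∀ y m : ℝ, |y| ≤ m → y ^ 2 ≤ m ^ 2 := fun y m h => by
    rw [← sq_abs]; exact pow_le_pow_left₀ (abs_nonneg _) h 2
  have hg : ∀ r ∈ Icc 0 (2 * c.τ), |c.forwardWave η X' Q' r| ≤ G := by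
    intro r hr
    obtain ⟨b1, -, b3⟩ := hM ε hε.le r (hmem r hr)
    -- The sliding mean cancels between `X'` and `η`, so the wave is that of the original unknowns.
    have e : c.forwardWave η X' Q' r = -c.k₁ * X ε r + c.ρ * Q ε r + (1 + c.ρ) * f r := by
      simp only [forwardWave, hη, hX', hQ', hFdef, max_eq_left hr.1]; field_simp; ring
    rw [e]
    have a1 := abs_add_three (-c.k₁ * X ε r) (c.ρ * Q ε r) ((1 + c.ρ) * f r)
    rw [abs_mul, abs_neg, abs_of_pos hk₁, abs_mul c.ρ, abs_mul (1 + c.ρ), abs_of_pos hρ] at a1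
    have a2 := mul_le_mul_of_nonneg_left b1 hk₁.le
    have a3 := mul_le_mul c.ρ_lt.le b3 (abs_nonneg _) zero_le_one
    have a4 := mul_le_mul hρ2 (hNf r hr) (abs_nonneg _) zero_le_two
    linarith
  have hp : ∀ r ∈ Icc c.τ (2 * c.τ), |c.backwardWave η X' Z' Q' r| ≤ P := by
    intro r hr
    have hr0 : 0 ≤ r := hτ.le.trans hr.1
    have b1 := hg (r - c.τ) ⟨by linarith [hr.1], by linarith [hr.2]⟩
    have b2 := (hM ε hε.le r (hmem r ⟨hr0, hr.2⟩)).2.1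
    have e : c.backwardWave η X' Z' Q' r =
        -c.k₂ * Z ε r + c.s * c.forwardWave η X' Q' (r - c.τ) := by
      simp only [backwardWave, hZ', max_eq_left hr0]
    rw [e]
    have a1 := abs_add_le (-c.k₂ * Z ε r) (c.s * c.forwardWave η X' Q' (r - c.τ))
    rw [abs_mul, abs_neg, abs_of_pos hk₂, abs_mul c.s] at a1
    have a2 := mul_le_mul_of_nonneg_left b2 hk₂.le
    have a3 := mul_le_mul c.s_lt.le b1 (abs_nonneg _) zero_le_one
    linarith
  obtain ⟨b1, b2, b3⟩ := hM ε hε.le (2 * c.τ) (hmem _ ⟨by linarith, le_rfl⟩)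
  have h2τ : max (2 * c.τ) 0 = 2 * c.τ := max_eq_left (by linarith)
  have e1 : X' (2 * c.τ) ^ 2 ≤ x₀ ^ 2 := by
    refine hsq _ _ ?_
    simp only [hX', h2τ]
    refine (abs_sub _ _).trans ?_
    rw [abs_mul, abs_of_pos (div_pos hρ hk₁)]
    linarith
  have e2 : Z' (2 * c.τ) ^ 2 ≤ M ^ 2 := hsq _ _ (by simpa only [hZ', h2τ] using b2)
  have e3 : Q' (2 * c.τ) ^ 2 ≤ M ^ 2 := hsq _ _ (by simpa only [hQ', h2τ] using b3)
  have e4 : ∫ r in (2 * c.τ - c.τ)..(2 * c.τ), (c.forwardWave η X' Q' r ^ 2 +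
      c.backwardWave η X' Z' Q' r ^ 2) ≤ (G ^ 2 + P ^ 2) * c.τ := by
    have h := intervalIntegral.norm_integral_le_of_norm_le_const (a := 2 * c.τ - c.τ)
      (b := 2 * c.τ) (f := fun r => c.forwardWave η X' Q' r ^ 2 + c.backwardWave η X' Z' Q' r ^ 2)
      (C := G ^ 2 + P ^ 2) (fun r hr => by
        rw [uIoc_of_le (by linarith)] at hr
        rw [Real.norm_eq_abs, abs_of_nonneg (by positivity)]
        exact add_le_add (hsq _ _ (hg r ⟨by linarith [hr.1], hr.2⟩))
          (hsq _ _ (hp r ⟨by linarith [hr.1], hr.2⟩)))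
    have e : |2 * c.τ - (2 * c.τ - c.τ)| = c.τ := by
      rw [show 2 * c.τ - (2 * c.τ - c.τ) = c.τ by ring, abs_of_pos hτ]
    rw [e] at h
    exact (le_abs_self _).trans h
  have e5 := mul_le_mul_of_nonneg_left e1 hκ₁.le
  have e6 := mul_le_mul_of_nonneg_left e2 hκ₂.le
  have e7 := mul_le_mul hε1 e3 (sq_nonneg _) zero_le_one
  unfold energy
  linarith

/-- Uniform settling of the layers. -/
theorem exists_settling (hF : c.IsFamily φ₁ φ₂ φ₃ H₁ H₂ H₃ X Z Q)
    (hf : ContinuousOn f (Ici 0)) (hbv : BoundedVariationOn f (Ici 0))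
    (h₁ : ∀ t ≥ 0, H₁ t = (1 + c.ρ) * f t)
    (h₂ : ∀ t ≥ c.τ, H₂ t = (1 + c.s) * ((1 + c.ρ) * f (t - c.τ)))
    (h₃ : ∀ t ≥ 2 * c.τ, H₃ t = c.s * ((1 + c.ρ) * f (t - 2 * c.τ))) {γ : ℝ} (hγ : 0 < γ) :
    ∃ N ≥ -(2 * c.τ), ∀ ε, 0 < ε → ε ≤ 1 → ∀ t ≥ N,
      |X ε t - X ε N| ≤ γ ∧ |Z ε t - Z ε N| ≤ γ := by
  have hτ := c.τ_pos
  have hk : 0 < (1 + c.ρ) / c.k₁ := div_pos c.one_add_ρ_pos c.k₁_pos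
  set F := fun t => f (max t 0) with hFdef
  have hfc : Continuous F := hf.comp_continuous (by fun_prop) fun t => le_max_right t 0
  obtain ⟨v, B, hm, hvB, hv⟩ := hbv.exists_monotone_control
  have hvF : ∀ x y, 0 ≤ x → x ≤ y → |F y - F x| ≤ v y - v x := fun x y hx hxy => by
    simpa only [hFdef, max_eq_left hx, max_eq_left (hx.trans hxy)] using hv x y hx hxy
  obtain ⟨C, hC⟩ := exists_integral_load_le hfc hm hvB hvF ((1 + c.ρ) / c.k₁)
    (show 0 ≤ 2 * c.τ by linarith)
  obtain ⟨M, hM⟩ := hF.exists_energy_bound hf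
  have hm' : Continuous (forwardMean F) :=
    continuous_iff_continuousAt.2 fun t => (hasDerivAt_forwardMean hfc t).continuousAt
  obtain ⟨N₁, hN₁, hset⟩ := c.exists_settling_time (hfc.sub hm')
    (continuous_const.mul ((hfc.comp (continuous_add_const 1)).sub hfc)) hC M
    (show 0 < γ / 4 by positivity)
  -- The sliding mean drifts by at most `3 l` after `N₂`, which moves the response of the first
  -- layer by at most `γ / 4`. The two distances to the equilibrium take `γ / 4` each.
  set l := γ / 12 / ((1 + c.ρ) / c.k₁) with hl
  have hl0 : 0 < l := by positivity
  obtain ⟨N₂, hN₂, htail⟩ := exists_tail_le (u := v) (a := 0) (fun t _ => (hvB t).2) hl0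
  have hdrift : ∀ x y, N₂ ≤ x → x ≤ y → |forwardMean F y - forwardMean F x| ≤ 3 * l := by
    intro x y hx hxy
    have hx0 : 0 ≤ x := le_trans hN₂ hx
    have a1 := abs_le.1 (hvF x y hx0 hxy)
    have a2 := abs_le.1 (abs_sub_forwardMean_le hfc hm hvF hx0)
    have a3 := abs_le.1 (abs_sub_forwardMean_le hfc hm hvF (hx0.trans hxy))
    have m1 := hm hx
    have m2 := hm (hx.trans hxy)
    have t1 := htail (x + 1) (by linarith)
    have t2 := htail (y + 1) (by linarith)
    have t3 := htail y (by linarith)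
    rw [abs_le]
    constructor <;> linarith [a1.1, a1.2, a2.1, a2.2, a3.1, a3.2]
  refine ⟨max N₁ N₂, le_trans (by linarith) (le_max_left N₁ N₂), fun ε hε hε1 t ht => ?_⟩
  obtain ⟨w, hw⟩ := hset ε _ _ _ (hF.isLoop hf h₁ h₂ h₃ hε) hε1 (hM ε hε hε1)
  set N := max N₁ N₂ with hN
  have hN0 : 0 ≤ N := le_trans (by linarith) (le_max_left N₁ N₂)
  obtain ⟨p1, p2⟩ := hw t ((le_max_left N₁ N₂).trans ht)
  obtain ⟨q1, q2⟩ := hw N (le_max_left N₁ N₂)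
  simp only [max_eq_left hN0, max_eq_left (hN0.trans ht)] at p1 p2 q1 q2
  have hd := hdrift N t (le_max_right N₁ N₂) ht
  have hd' : |(1 + c.ρ) / c.k₁ * (forwardMean F t - forwardMean F N)| ≤ γ / 4 := by
    rw [abs_mul, abs_of_pos hk]
    have h1 := mul_le_mul_of_nonneg_left hd hk.le
    have h2 : (1 + c.ρ) / c.k₁ * l = γ / 12 := by
      rw [hl]; exact mul_div_cancel₀ _ hk.ne'
    linarith
  have b1 := abs_le.1 p1
  have b2 := abs_le.1 p2
  have b3 := abs_le.1 q1
  have b4 := abs_le.1 q2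
  have b5 := abs_le.1 hd'
  constructor <;> rw [abs_le] <;> constructor <;>
    linarith [b1.1, b1.2, b2.1, b2.2, b3.1, b3.2, b4.1, b4.2, b5.1, b5.2]

end IsFamily

end LoopCoeffs

/-! ### Convergence of the fast variable `Q`. -/

namespace LoopCoeffs

variable {c : LoopCoeffs}

/-- Separates the drive by the layers and the source from the feedback of `Q`, which carries the
contraction factor `s ρ`. -/
theorem inflow_eq_add (H X Z Q : ℝ → ℝ) (t : ℝ) : c.inflow H X Z Q t =
    (-c.k₂ * Z (t - c.τ) + -c.s * c.k₁ * X (t - 2 * c.τ) + H t) +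
      c.s * c.ρ * Q (t - 2 * c.τ) := by
  unfold inflow; ring

namespace IsFamily

variable {φ₁ φ₂ φ₃ H₁ H₂ H₃ : ℝ → ℝ} {X Z Q : ℝ → ℝ → ℝ}

/-- Convergence of `Q` uniformly on compact sets that avoid the multiples of `τ`. -/
theorem tendstoUniformlyOn_Q_compact (hF : c.IsFamily φ₁ φ₂ φ₃ H₁ H₂ H₃ X Z Q)
    {K : Set ℝ} (hK : IsCompact K)
    (hKQ : K ⊆ Ici 0 \ {t | ∃ j : ℕ, t = j * c.τ}) :
    TendstoUniformlyOn Q (Q 0) (𝓝[>] 0) K := by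
  have hτ := c.τ_pos
  rw [← tendstoLocallyUniformlyOn_iff_tendstoUniformlyOn_of_compact hK]
  rw [Metric.tendstoLocallyUniformlyOn_iff]
  intro γ hγ t ht
  obtain ⟨ht0, htn⟩ := hKQ ht
  set j := ⌊t / c.τ⌋₊ with hj
  have h1 : (j : ℝ) * c.τ ≤ t := by
    rw [← le_div_iff₀ hτ]; exact Nat.floor_le (div_nonneg ht0 hτ.le)
  have h1' : (j : ℝ) * c.τ < t := lt_of_le_of_ne h1 fun h => htn ⟨j, h.symm⟩
  have h2 : t < ((j : ℝ) + 1) * c.τ := by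
    rw [← div_lt_iff₀ hτ]; exact Nat.lt_floor_add_one _
  set δ := (t - j * c.τ) / 2 with hδ
  have hδ0 : 0 < δ := by rw [hδ]; linarith
  have hv := (hF.vanishes_finite_time (j + 1)).2.2 (j + 2) (by omega) δ hδ0
  refine ⟨Ioo (j * c.τ + δ) ((j + 1) * c.τ),
    mem_nhdsWithin_of_mem_nhds (Ioo_mem_nhds (by linarith) h2), ?_⟩
  have hsub : Ioo (j * c.τ + δ) ((j + 1) * c.τ) ⊆
      Ico (((j + 2 : ℕ) - 2 : ℝ) * c.τ + δ) (((j + 2 : ℕ) - 1 : ℝ) * c.τ) := by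
    intro r hr
    push_cast
    exact ⟨by linarith [hr.1], by linarith [hr.2]⟩
  exact Metric.tendstoUniformlyOn_iff.1 (hv.mono hsub).tendstoUniformlyOn γ hγ

/-- Without an initial jump, the limit `Q 0` is uniformly continuous. -/
theorem exists_modulus_Q_zero (hF : c.IsFamily φ₁ φ₂ φ₃ H₁ H₂ H₃ X Z Q)
    (hX : UniformContinuousOn (X 0) (Ici (-(2 * c.τ))))
    (hZ : UniformContinuousOn (Z 0) (Ici (-(2 * c.τ)))) (hH : UniformContinuousOn H₃ (Ici 0))
    (h0 : Q 0 0 = φ₃ 0) {e : ℝ} (he : 0 < e) :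
    ∃ δ > 0, ∀ t ≥ -(2 * c.τ), ∀ r ∈ Icc (-(2 * c.τ)) t, t - r < δ → |Q 0 t - Q 0 r| ≤ e := by
  have hτ := c.τ_pos
  set θ := |c.s * c.ρ| with hθ
  have hθ1 : θ < 1 := abs_s_mul_ρ_lt_one
  have hθ0 : 0 ≤ θ := abs_nonneg _
  set k := fun t => -c.k₂ * Z 0 (t - c.τ) + -c.s * c.k₁ * X 0 (t - 2 * c.τ) + H₃ t with hk
  have hkuc : UniformContinuousOn k (Ici 0) :=
    uniformContinuousOn_add (uniformContinuousOn_add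
      (uniformContinuousOn_const_mul (uniformContinuousOn_comp_sub hZ fun t ht => by
        simp only [mem_Ici] at ht ⊢; linarith) _)
      (uniformContinuousOn_const_mul (uniformContinuousOn_comp_sub hX fun t ht => by
        simp only [mem_Ici] at ht ⊢; linarith) _)) hH
  have hQk : ∀ t ≥ 0, Q 0 t = k t + c.s * c.ρ * Q 0 (t - 2 * c.τ) := fun t ht => by
    rw [hF.Q_limit t ht, inflow_eq_add]
  -- With the tolerance `(1 - θ) * (e / 4)` for the drive, the bounds `e` and `e / 4` each reproduce
  -- themselves under the recursion.
  obtain ⟨δ₁, hδ₁, hm₁⟩ := Metric.uniformContinuousOn_iff.1 hkuc ((1 - θ) * (e / 4))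
    (mul_pos (by linarith) (by positivity))
  obtain ⟨δ₂, hδ₂, hm₂⟩ := Metric.uniformContinuousOn_iff.1
    (isCompact_Icc.uniformContinuousOn_of_continuous hF.φ₃_cont) (e / 4) (by positivity)
  set δ := min (min δ₁ δ₂) (2 * c.τ) with hδ
  have d1 : δ ≤ δ₁ := (min_le_left _ _).trans (min_le_left _ _)
  have d2 : δ ≤ δ₂ := (min_le_left _ _).trans (min_le_right _ _)
  have d3 : δ ≤ 2 * c.τ := min_le_right _ _
  have hQφ : ∀ t ∈ Icc (-(2 * c.τ)) 0, Q 0 t = φ₃ t := by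
    intro t ht
    rcases ht.2.lt_or_eq with h | rfl
    · exact hF.Q_init 0 le_rfl t ⟨ht.1, h⟩
    · exact h0
  have hinit : ∀ t ≤ 0, ∀ r ∈ Icc (-(2 * c.τ)) t, t - r < δ → |Q 0 t - Q 0 r| ≤ e / 4 := by
    intro t ht r hr htr
    have ht' : t ∈ Icc (-(2 * c.τ)) 0 := ⟨hr.1.trans hr.2, ht⟩
    have hr' : r ∈ Icc (-(2 * c.τ)) 0 := ⟨hr.1, hr.2.trans ht⟩
    rw [hQφ t ht', hQφ r hr', ← Real.dist_eq]
    refine (hm₂ t ht' r hr' ?_).le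
    rw [Real.dist_eq, abs_of_nonneg (by linarith [hr.2])]
    linarith
  have hrec : ∀ t r m, 0 ≤ r → r ≤ t → t - r < δ →
      |Q 0 (t - 2 * c.τ) - Q 0 (r - 2 * c.τ)| ≤ m →
      |Q 0 t - Q 0 r| ≤ (1 - θ) * (e / 4) + θ * m := by
    intro t r m hr hrt htr hm
    have hk1 := (hm₁ t (hr.trans hrt) r hr (by
      rw [Real.dist_eq, abs_of_nonneg (by linarith)]; linarith)).le
    rw [Real.dist_eq] at hk1
    rw [hQk t (hr.trans hrt), hQk r hr,
      show k t + c.s * c.ρ * Q 0 (t - 2 * c.τ) - (k r + c.s * c.ρ * Q 0 (r - 2 * c.τ)) =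
        (k t - k r) + c.s * c.ρ * (Q 0 (t - 2 * c.τ) - Q 0 (r - 2 * c.τ)) by ring]
    refine (abs_add_le _ _).trans (add_le_add hk1 ?_)
    rw [abs_mul]
    exact mul_le_mul_of_nonneg_left hm hθ0
  refine ⟨δ, by positivity, ?_⟩
  refine window_induction (by positivity) (fun t ht r hr htr => ?_) fun T hT ih t ht r hr htr => ?_
  · linarith [hinit t ht.2.le r hr htr]
  · have ht0 : 0 ≤ t := le_trans hT ht.1
    -- A pair on both sides of `0` is compared through `0`. As `δ ≤ 2τ`, the delayed arguments of
    -- `t` and `0` then both lie in the history, so each half costs `e / 4`.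
    rcases le_total 0 r with hr0 | hr0
    · have h1 := hrec t r e hr0 hr.2 htr (ih (t - 2 * c.τ) ⟨by linarith, by linarith [ht.2]⟩
        (r - 2 * c.τ) ⟨by linarith, by linarith [hr.2]⟩ (by linarith))
      nlinarith
    · have h1 := hinit 0 le_rfl r ⟨hr.1, hr0⟩ (by linarith)
      have h2 := hrec t 0 (e / 4) le_rfl ht0 (by linarith) (hinit (t - 2 * c.τ) (by linarith)
        (0 - 2 * c.τ) ⟨by linarith, by linarith⟩ (by linarith))
      have h3 := abs_sub_le (Q 0 t) (Q 0 0) (Q 0 r)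
      have h4 : (1 - θ) * (e / 4) + θ * (e / 4) = e / 4 := by ring
      linarith

/-- Bounds for `Q ε` on the half-line from bounds for `X ε` and `Z ε`. -/
theorem abs_Q_le (hF : c.IsFamily φ₁ φ₂ φ₃ H₁ H₂ H₃ X Z Q) {ε β Y : ℝ} (hε : 0 ≤ ε)
    (hβ : ∀ t ≥ 0, |-c.k₂ * Z ε (t - c.τ) + -c.s * c.k₁ * X ε (t - 2 * c.τ) + H₃ t| ≤ β)
    (hY : ∀ t ∈ Icc (-(2 * c.τ)) 0, |φ₃ t| ≤ Y) :
    ∀ t ≥ -(2 * c.τ), |Q ε t| ≤ Y + β / (1 - |c.s * c.ρ|) := by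
  have hτ := c.τ_pos
  set θ := |c.s * c.ρ| with hθ
  have hθ1 : θ < 1 := abs_s_mul_ρ_lt_one
  have hθ0 : 0 ≤ θ := abs_nonneg _
  have hβ0 : 0 ≤ β := (abs_nonneg _).trans (hβ 0 le_rfl)
  have h00 : (0 : ℝ) ∈ Icc (-(2 * c.τ)) 0 := ⟨by linarith, le_rfl⟩
  have hY0 : 0 ≤ Y := (abs_nonneg _).trans (hY 0 h00)
  set M := Y + β / (1 - θ) with hM
  have hYM : Y ≤ M := le_add_of_nonneg_right (div_nonneg hβ0 (by linarith))
  -- This makes the bound `M` invariant: an inflow with drive at most `β` and feedback at most `θ *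
  -- M` is again at most `M`.
  have hβM : β + θ * M ≤ M := by
    have h1 : (1 - θ) * (β / (1 - θ)) = β := mul_div_cancel₀ _ (by linarith)
    have h2 : (1 - θ) * M = (1 - θ) * Y + β := by rw [hM, mul_add, h1]
    nlinarith [mul_nonneg (sub_nonneg.2 hθ1.le) hY0]
  refine window_induction (by positivity) (fun t ht => ?_) fun T hT ih => ?_
  · rw [hF.Q_init ε hε t ht]
    exact (hY t (Ico_subset_Icc_self ht)).trans hYM
  · have hin : ∀ r ∈ Ico 0 (T + 2 * c.τ), |c.inflow H₃ (X ε) (Z ε) (Q ε) r| ≤ M := by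
      intro r hr
      rw [inflow_eq_add]
      refine (abs_add_le _ _).trans (le_trans (add_le_add (hβ r hr.1) ?_) hβM)
      rw [abs_mul]
      exact mul_le_mul_of_nonneg_left (ih _ ⟨by linarith [hr.1], by linarith [hr.2]⟩) hθ0
    intro t ht
    have ht0 : 0 ≤ t := le_trans hT ht.1
    rcases hε.lt_or_eq with h | rfl
    · refine abs_le_of_relaxation (inv_pos.2 h) ht0
        ((hF.Q_cont ε h).mono fun r hr => by simp only [mem_Ici]; linarith [hr.1])
        (fun r hr => hF.Q_deriv ε h r hr.1) (fun r hr => hin r ⟨hr.1, hr.2.trans ht.2⟩) ?_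
      rw [hF.Q_zero ε h]
      exact (hY 0 h00).trans hYM
    · rw [hF.Q_limit t ht0]
      exact hin t ⟨ht0, ht.2⟩

/-- Without an initial jump, `Q` converges uniformly on the half-line. -/
theorem vanishes_Q (hF : c.IsFamily φ₁ φ₂ φ₃ H₁ H₂ H₃ X Z Q)
    (hXv : Vanishes (fun ε t => X ε t - X 0 t) (Ici (-(2 * c.τ))))
    (hZv : Vanishes (fun ε t => Z ε t - Z 0 t) (Ici (-(2 * c.τ))))
    (hXt : ∀ l > 0, ∃ N ≥ -(2 * c.τ), ∀ t ≥ N, |X 0 t - X 0 N| ≤ l)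
    (hZt : ∀ l > 0, ∃ N ≥ -(2 * c.τ), ∀ t ≥ N, |Z 0 t - Z 0 N| ≤ l)
    (hHt : ∀ l > 0, ∃ N ≥ 0, ∀ t ≥ N, |H₃ t - H₃ N| ≤ l) (h0 : Q 0 0 = φ₃ 0) :
    Vanishes (fun ε t => Q ε t - Q 0 t) (Ici 0) := by
  have hτ := c.τ_pos
  have hk₁ := c.k₁_pos
  have hk₂ := c.k₂_pos
  set θ := |c.s * c.ρ| with hθ
  have hθ1 : θ < 1 := abs_s_mul_ρ_lt_one
  have hθ0 : 0 ≤ θ := abs_nonneg _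
  obtain ⟨MX, hMX⟩ := exists_bound_Ici_of_tail (hF.X_cont 0 le_rfl) hXt
  obtain ⟨MZ, hMZ⟩ := exists_bound_Ici_of_tail (hF.Z_cont 0 le_rfl) hZt
  obtain ⟨MH, hMH⟩ := exists_bound_Ici_of_tail hF.H₃_cont hHt
  obtain ⟨Y, hY⟩ := isCompact_Icc.exists_bound_of_continuousOn hF.φ₃_cont
  simp only [Real.norm_eq_abs] at hY
  set β := c.k₂ * (MZ + 1) + c.k₁ * (MX + 1) + MH with hβ
  set M := Y + β / (1 - θ) with hM
  have hbound : ∀ ε ≥ 0, (∀ t ∈ Ici (-(2 * c.τ)), |X ε t - X 0 t| ≤ 1) →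
      (∀ t ∈ Ici (-(2 * c.τ)), |Z ε t - Z 0 t| ≤ 1) → ∀ t ≥ -(2 * c.τ), |Q ε t| ≤ M := by
    intro ε hε hx hz
    refine hF.abs_Q_le hε (fun t ht => ?_) hY
    have m1 : t - c.τ ∈ Ici (-(2 * c.τ)) := by simp only [mem_Ici]; linarith
    have m2 : t - 2 * c.τ ∈ Ici (-(2 * c.τ)) := by simp only [mem_Ici]; linarith
    have x1 : |X ε (t - 2 * c.τ)| ≤ MX + 1 := by
      linarith [abs_sub_abs_le_abs_sub (X ε (t - 2 * c.τ)) (X 0 (t - 2 * c.τ)), hx _ m2,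
        hMX _ m2]
    have z1 : |Z ε (t - c.τ)| ≤ MZ + 1 := by
      linarith [abs_sub_abs_le_abs_sub (Z ε (t - c.τ)) (Z 0 (t - c.τ)), hz _ m1, hMZ _ m1]
    have a1 := abs_add_three (-c.k₂ * Z ε (t - c.τ)) (-c.s * c.k₁ * X ε (t - 2 * c.τ)) (H₃ t)
    rw [abs_mul, abs_neg, abs_of_pos hk₂, abs_mul, abs_mul, abs_neg, abs_of_pos hk₁] at a1
    have a2 := mul_le_mul_of_nonneg_left z1 hk₂.le
    have a3 := mul_le_mul_of_nonneg_left x1 hk₁.le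
    have a4 : |c.s| * c.k₁ * |X ε (t - 2 * c.τ)| ≤ c.k₁ * |X ε (t - 2 * c.τ)| := by
      rw [mul_assoc]
      exact mul_le_of_le_one_left (by positivity) c.s_lt.le
    linarith [hMH t ht]
  have hQ0 : ∀ t ≥ -(2 * c.τ), |Q 0 t| ≤ M := hbound 0 le_rfl (by simp) (by simp)
  intro γ hγ
  -- Chosen so that `3 * e + θ * γ = γ`: one `e` each for the drive, the modulus of `Q 0` and the
  -- forgotten starting value, and `θ * γ` for the feedback of the earlier error.
  set e := (1 - θ) * γ / 3 with he
  have he0 : 0 < e := div_pos (mul_pos (by linarith) hγ) (by norm_num)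
  obtain ⟨δ, hδ, hmod⟩ := hF.exists_modulus_Q_zero
    (uniformContinuousOn_Ici_of_tail (hF.X_cont 0 le_rfl) hXt)
    (uniformContinuousOn_Ici_of_tail (hF.Z_cont 0 le_rfl) hZt)
    (uniformContinuousOn_Ici_of_tail hF.H₃_cont hHt) h0 he0
  set d := δ / 2 with hd
  have hd0 : 0 < d := by positivity
  have hdrive : Vanishes (fun ε t => -c.k₂ * (Z ε (t - c.τ) - Z 0 (t - c.τ)) +
      -c.s * c.k₁ * (X ε (t - 2 * c.τ) - X 0 (t - 2 * c.τ))) (Ici 0) :=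
    ((hZv.comp_sub fun t ht => by simp only [mem_Ici] at ht ⊢; linarith).const_mul _).add
      ((hXv.comp_sub fun t ht => by simp only [mem_Ici] at ht ⊢; linarith).const_mul _)
  filter_upwards [hXv 1 one_pos, hZv 1 one_pos, hdrive e he0,
    eventually_exp_layer_le (M := 2 * M) hd0 he0, self_mem_nhdsWithin] with ε hx hz hdr hexp hε
  have hQε := hbound ε (le_of_lt hε) hx hz
  have hmain : ∀ t ≥ -(2 * c.τ), |Q ε t - Q 0 t| ≤ γ := by
    refine window_induction (by positivity) (fun t ht => ?_) fun T hT ih t ht => ?_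
    · rw [hF.Q_init ε (le_of_lt hε) t ht, hF.Q_init 0 le_rfl t ht, sub_self, abs_zero]
      exact hγ.le
    · have ht0 : 0 ≤ t := le_trans hT ht.1
      set σ := max 0 (t - d) with hσ
      have hσ0 : 0 ≤ σ := le_max_left _ _
      have hσt : σ ≤ t := max_le ht0 (by linarith)
      have hσd : t - d ≤ σ := le_max_right _ _
      have hnear : ∀ r ∈ Icc σ t, |Q 0 r - Q 0 t| ≤ e := by
        intro r hr
        rw [abs_sub_comm]
        exact hmod t (by linarith) r ⟨by linarith [hr.1], hr.2⟩ (by linarith [hr.1])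
      have h1 := abs_sub_le_of_relaxation (m := Q 0 t) (β := e + θ * γ + e) (inv_pos.2 hε) hσt
        (by positivity)
        ((hF.Q_cont ε hε).mono fun r hr => by simp only [mem_Ici]; linarith [hr.1])
        (fun r hr => hF.Q_deriv ε hε r (hσ0.trans hr.1)) (fun r hr => by
          have hr0 : 0 ≤ r := hσ0.trans hr.1
          have e1 : c.inflow H₃ (X ε) (Z ε) (Q ε) r - Q 0 t =
              (-c.k₂ * (Z ε (r - c.τ) - Z 0 (r - c.τ)) +
                -c.s * c.k₁ * (X ε (r - 2 * c.τ) - X 0 (r - 2 * c.τ))) +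
              c.s * c.ρ * (Q ε (r - 2 * c.τ) - Q 0 (r - 2 * c.τ)) + (Q 0 r - Q 0 t) := by
            rw [hF.Q_limit r hr0]; unfold inflow; ring
          rw [e1]
          refine (abs_add_three _ _ _).trans (add_le_add (add_le_add (hdr r hr0) ?_)
            (hnear r ⟨hr.1, hr.2.le⟩))
          rw [abs_mul]
          exact mul_le_mul_of_nonneg_left (ih (r - 2 * c.τ)
            ⟨by linarith, by linarith [hr.2, ht.2]⟩) hθ0)
      have h2 : |Q ε σ - Q 0 t| * Real.exp (-(ε⁻¹ * (t - σ))) ≤ e := by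
        -- Near `0` the relaxation starts at `0` from `φ₃ 0 = Q 0 0`, already close to `Q 0 t`; this
        -- is where the absence of a jump counts. Later it starts a fixed time `d` back, and the
        -- exponential removes a bounded difference.
        rcases le_total (t - d) 0 with hcase | hcase
        · have hσz : σ = 0 := max_eq_left hcase
          have h3 := hnear σ ⟨le_rfl, hσt⟩
          rw [hσz, h0] at h3
          rw [hσz, hF.Q_zero ε hε]
          refine (mul_le_of_le_one_right (abs_nonneg _) ?_).trans h3
          rw [Real.exp_le_one_iff, neg_nonpos]
          exact mul_nonneg (inv_pos.2 hε).le (by linarith)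
        · have hσz : σ = t - d := max_eq_right hcase
          rw [hσz, sub_sub_cancel]
          refine (mul_le_mul_of_nonneg_right ?_ (Real.exp_pos _).le).trans hexp
          have := abs_sub (Q ε (t - d)) (Q 0 t)
          linarith [hQε (t - d) (by linarith), hQ0 t (by linarith)]
      have h4 : 3 * e + θ * γ = γ := by rw [he]; ring
      linarith
  exact fun t ht => hmain t (by simp only [mem_Ici] at ht; linarith)

end IsFamily

end LoopCoeffs

/-! ### The two-layer model as a feedback loop -/

namespace LayerParams

variable (P : LayerParams)

theorem a₁_pos : 0 < P.a₁ := by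
  have := P.c₁_pos; have := P.c₃_pos; have := Real.pi_pos
  unfold a₁; positivity

theorem a₁_sub_a₂ : P.a₁ - P.a₂ = 2 * Real.pi * P.c₃ := by
  have h : P.c₁ + P.c₃ ≠ 0 := (add_pos P.c₁_pos P.c₃_pos).ne'
  unfold a₁ a₂; field_simp; ring

theorem a₁_sub_a₂_pos : 0 < P.a₁ - P.a₂ := by
  have := P.c₃_pos; have := Real.pi_pos
  rw [a₁_sub_a₂]; positivity

theorem a₅_pos : 0 < P.a₅ := by
  have := P.c₅_pos; have := P.c₃_pos
  unfold a₅; positivity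

theorem abs_sub_div_add_lt_one {a b : ℝ} (ha : 0 < a) (hb : 0 < b) : |(a - b) / (a + b)| < 1 := by
  rw [abs_div, abs_of_pos (add_pos ha hb), div_lt_one (add_pos ha hb), abs_lt]
  constructor <;> linarith

/-- The quotient is the reflection coefficient `(c₁ - c₃) / (c₁ + c₃)`, less than `1` in modulus
because `c₁, c₃ > 0`. -/
theorem abs_a₂_div_lt_one : |P.a₂ / (P.a₁ - P.a₂)| < 1 := by
  have h : P.a₂ / (P.a₁ - P.a₂) = (P.c₁ - P.c₃) / (P.c₁ + P.c₃) := by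
    have h1 := P.c₃_pos.ne'
    have h2 := Real.pi_ne_zero
    have h3 : P.c₁ + P.c₃ ≠ 0 := (add_pos P.c₁_pos P.c₃_pos).ne'
    rw [a₁_sub_a₂]; unfold a₂; field_simp
  rw [h]
  exact abs_sub_div_add_lt_one P.c₁_pos P.c₃_pos

theorem abs_a₅_sub_one_lt_one : |P.a₅ - 1| < 1 := by
  have h : P.a₅ - 1 = (P.c₅ - P.c₃) / (P.c₅ + P.c₃) := by
    have h3 : P.c₅ + P.c₃ ≠ 0 := (add_pos P.c₅_pos P.c₃_pos).ne'
    unfold a₅; field_simp; ring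
  rw [h]
  exact abs_sub_div_add_lt_one P.c₅_pos P.c₃_pos

/-- The coefficients of the feedback loop. -/
noncomputable def loopCoeffs : LoopCoeffs where
  k₁ := P.a₁ * P.r₂
  k₂ := (P.a₁ - P.a₂) * P.r₄ * P.a₅
  ρ := P.a₂ / (P.a₁ - P.a₂)
  s := P.a₅ - 1
  τ := P.τ
  k₁_pos := mul_pos P.a₁_pos P.r₂_pos
  k₂_pos := mul_pos (mul_pos P.a₁_sub_a₂_pos P.r₄_pos) P.a₅_pos
  ρ_lt := P.abs_a₂_div_lt_one
  s_lt := P.abs_a₅_sub_one_lt_one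
  τ_pos := P.τ_pos

theorem one_add_ρ_mul : (1 + P.loopCoeffs.ρ) * (P.a₁ - P.a₂) = P.a₁ := by
  have := P.a₁_sub_a₂_pos.ne'
  simp only [loopCoeffs]; field_simp; ring

theorem E_mulVec (ε : ℝ) (y : Fin 3 → ℝ) (i : Fin 3) :
    (E ε *ᵥ y) i = (![1, 1, ε] : Fin 3 → ℝ) i * y i := Matrix.mulVec_diagonal _ _ _

theorem rhs_zero (h x : ℝ → Fin 3 → ℝ) (t : ℝ) :
    P.rhs h x t 0 = -(P.a₁ * P.r₂) * x t 0 + P.a₁ * P.a₀ * x t 2 + h t 0 := by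
  simp [rhs, A, B, C, dotProduct, Fin.sum_univ_three]

theorem rhs_one (h x : ℝ → Fin 3 → ℝ) (t : ℝ) :
    P.rhs h x t 1 = -((P.a₁ - P.a₂) * P.r₄ * P.a₅) * x t 1 +
      (-(P.a₅ * P.a₁ * P.r₂) * x (t - P.τ) 0 + P.a₂ * P.a₀ * P.a₅ * x (t - P.τ) 2) + h t 1 := by
  simp [rhs, A, B, C, dotProduct, Fin.sum_univ_three]

theorem rhs_two (h x : ℝ → Fin 3 → ℝ) (t : ℝ) :
    P.rhs h x t 2 = -x t 2 + -(P.a₅ * P.r₄ / P.a₀) * x (t - P.τ) 1 +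
      (-(P.a₁ * P.r₂ * (P.a₅ - 1) / ((P.a₁ - P.a₂) * P.a₀)) * x (t - 2 * P.τ) 0 +
        P.a₂ * (P.a₅ - 1) / (P.a₁ - P.a₂) * x (t - 2 * P.τ) 2) + h t 2 := by
  simp [rhs, A, B, C, dotProduct, Fin.sum_univ_three]

variable {P}

theorem IsSolution.hasDeriv_apply {ε : ℝ} {φ h x : ℝ → Fin 3 → ℝ} (hs : P.IsSolution ε φ h x)
    (i : Fin 3) {t : ℝ} (ht : 0 ≤ t) :
    HasDerivWithinAt (fun r => (![1, 1, ε] : Fin 3 → ℝ) i * x r i) (P.rhs h x t i) (Ici t) t := by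
  have := hasDerivWithinAt_pi.1 (hs.hasDeriv t ht) i
  simpa only [E_mulVec] using this

theorem IsSolution.continuousOn_apply {ε : ℝ} {φ h x : ℝ → Fin 3 → ℝ}
    (hs : P.IsSolution ε φ h x) (i : Fin 3) :
    ContinuousOn (fun r => (![1, 1, ε] : Fin 3 → ℝ) i * x r i) (Ici 0) := by
  have := continuousOn_pi.1 hs.continuousOn i
  simpa only [E_mulVec] using this

theorem IsSolution.initial_zero_apply {ε : ℝ} {φ h x : ℝ → Fin 3 → ℝ}
    (hs : P.IsSolution ε φ h x) (i : Fin 3) :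
    (![1, 1, ε] : Fin 3 → ℝ) i * x 0 i = (![1, 1, ε] : Fin 3 → ℝ) i * φ 0 i := by
  have := congrFun hs.initial_zero i
  simpa only [E_mulVec] using this

/-- The third row, scaled by `(a₁ - a₂) a₀`, in terms of the inflow. -/
theorem scaled_rhs_two (h x : ℝ → Fin 3 → ℝ) (t : ℝ) :
    (P.a₁ - P.a₂) * P.a₀ * P.rhs h x t 2 =
      P.loopCoeffs.inflow (fun t => (P.a₁ - P.a₂) * P.a₀ * h t 2) (fun t => x t 0)
        (fun t => x t 1) (fun t => (P.a₁ - P.a₂) * P.a₀ * x t 2) t -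
      (P.a₁ - P.a₂) * P.a₀ * x t 2 := by
  have h1 := P.a₁_sub_a₂_pos.ne'
  have h2 := P.a₀_ne_zero
  rw [rhs_two]
  simp only [LoopCoeffs.inflow, loopCoeffs]
  field_simp
  ring

theorem continuousOn_Ici_of_initial {y φ : ℝ → ℝ} {a : ℝ} (ha : a ≤ 0)
    (hφ : ContinuousOn φ (Icc a 0)) (he : ∀ t ∈ Icc a 0, y t = φ t)
    (hy : ContinuousOn y (Ici 0)) : ContinuousOn y (Ici a) := by
  rw [← Icc_union_Ici_eq_Ici ha]
  exact (hφ.congr he).union_of_isClosed hy isClosed_Icc isClosed_Ici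

/-- The solutions form a family of solutions of the loop equations. -/
theorem isFamily {φ h : ℝ → Fin 3 → ℝ} {x : ℝ → ℝ → Fin 3 → ℝ}
    (hx : ∀ ε : ℝ, 0 ≤ ε → P.IsSolution ε φ h (x ε))
    (hφ : ContinuousOn φ (Icc (-(2 * P.τ)) 0)) (hh : ContinuousOn h (Ici 0)) :
    P.loopCoeffs.IsFamily (fun t => φ t 0) (fun t => φ t 1)
      (fun t => (P.a₁ - P.a₂) * P.a₀ * φ t 2) (fun t => h t 0) (fun t => h t 1)
      (fun t => (P.a₁ - P.a₂) * P.a₀ * h t 2) (fun ε t => x ε t 0) (fun ε t => x ε t 1)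
      (fun ε t => (P.a₁ - P.a₂) * P.a₀ * x ε t 2) := by
  have hτ : -(2 * P.τ) ≤ 0 := by linarith [P.τ_pos]
  have hm := P.a₁_sub_a₂_pos.ne'
  have ha := P.a₀_ne_zero
  have hφi := continuousOn_pi.1 hφ
  have hhi := continuousOn_pi.1 hh
  have hinit : ∀ ε ≥ 0, ∀ i, x ε 0 i = φ 0 i → ∀ t ∈ Icc (-(2 * P.τ)) 0, x ε t i = φ t i := by
    intro ε hε i h0 t ht
    rcases ht.2.lt_or_eq with h | rfl
    · rw [(hx ε hε).initial t ⟨ht.1, h⟩]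
    · exact h0
  have h00 : ∀ ε ≥ 0, x ε 0 0 = φ 0 0 := fun ε hε => by
    simpa using (hx ε hε).initial_zero_apply 0
  have h01 : ∀ ε ≥ 0, x ε 0 1 = φ 0 1 := fun ε hε => by
    simpa using (hx ε hε).initial_zero_apply 1
  have h02 : ∀ ε > 0, x ε 0 2 = φ 0 2 := fun ε hε => by
    have := (hx ε (le_of_lt hε)).initial_zero_apply 2
    simp only [Matrix.cons_val] at this
    exact mul_left_cancel₀ (ne_of_gt hε) this
  have hcancel : ∀ ε > 0, ∀ r, ε⁻¹ * ((![1, 1, ε] : Fin 3 → ℝ) 2 * x ε r 2) = x ε r 2 :=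
    fun ε hε r => by simp only [Matrix.cons_val]; exact inv_mul_cancel_left₀ (ne_of_gt hε) _
  refine
    { φ₁_cont := hφi 0
      φ₂_cont := hφi 1
      φ₃_cont := continuousOn_const.mul (hφi 2)
      H₁_cont := hhi 0
      H₂_cont := hhi 1
      H₃_cont := continuousOn_const.mul (hhi 2)
      X_init := fun ε hε => hinit ε hε 0 (h00 ε hε)
      Z_init := fun ε hε => hinit ε hε 1 (h01 ε hε)
      Q_init := fun ε hε t ht => by simp only [(hx ε hε).initial t ht]
      Q_zero := fun ε hε => by simp only [h02 ε hε]
      X_cont := fun ε hε => continuousOn_Ici_of_initial hτ (hφi 0) (hinit ε hε 0 (h00 ε hε))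
        (by simpa using (hx ε hε).continuousOn_apply 0)
      Z_cont := fun ε hε => continuousOn_Ici_of_initial hτ (hφi 1) (hinit ε hε 1 (h01 ε hε))
        (by simpa using (hx ε hε).continuousOn_apply 1)
      Q_cont := fun ε hε => continuousOn_const.mul (continuousOn_Ici_of_initial hτ (hφi 2)
        (hinit ε (le_of_lt hε) 2 (h02 ε hε)) ?_)
      X_deriv := fun ε hε t ht => ?_
      Z_deriv := fun ε hε t ht => ?_
      Q_deriv := fun ε hε t ht => ?_
      Q_limit := fun t ht => ?_ }
  · refine ((continuousOn_const (c := ε⁻¹)).mul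
      ((hx ε (le_of_lt hε)).continuousOn_apply 2)).congr fun r _ => ?_
    exact (hcancel ε hε r).symm
  · have h1 : HasDerivWithinAt (fun r => x ε r 0) (P.rhs h (x ε) t 0) (Ici t) t := by
      simpa using (hx ε hε).hasDeriv_apply 0 ht
    refine h1.congr_deriv ?_
    rw [rhs_zero]
    simp only [loopCoeffs]
    field_simp
    ring
  · have h1 : HasDerivWithinAt (fun r => x ε r 1) (P.rhs h (x ε) t 1) (Ici t) t := by
      simpa using (hx ε hε).hasDeriv_apply 1 ht
    refine h1.congr_deriv ?_
    rw [rhs_one]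
    simp only [loopCoeffs]
    field_simp
    ring
  · have h1 := (((hx ε (le_of_lt hε)).hasDeriv_apply 2 ht).const_mul ε⁻¹).const_mul
      ((P.a₁ - P.a₂) * P.a₀)
    simp only [hcancel ε hε] at h1
    refine h1.congr_deriv ?_
    rw [← scaled_rhs_two]
    ring
  -- For `ε = 0` the third component of `E x` is identically zero, so uniqueness of the right
  -- derivative turns the third row into the difference equation.
  · have h1 := (hx 0 le_rfl).hasDeriv_apply 2 ht
    simp only [Matrix.cons_val, zero_mul] at h1
    have h2 : P.rhs h (x 0) t 2 = 0 :=
      (uniqueDiffWithinAt_Ici t).eq_deriv _ h1 (hasDerivWithinAt_const _ _ _)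
    have h3 := scaled_rhs_two (P := P) h (x 0) t
    rw [h2, mul_zero] at h3
    linarith

/-- Under the compatibility condition the limit solution has no initial jump. -/
theorem eq_initial_of_frequently_compatible {φ h x : ℝ → Fin 3 → ℝ} (hx : P.IsSolution 0 φ h x)
    (hd : DifferentiableOn ℝ φ (Icc (-(2 * P.τ)) 0))
    (hc : ∃ᶠ ε in 𝓝[≥] 0, P.Compatible ε φ h) : x 0 2 = φ 0 2 := by
  have hτ := P.τ_pos
  have h0 : (0 : ℝ) ∈ Icc (-(2 * P.τ)) 0 := ⟨by linarith, le_rfl⟩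
  set R := (P.A *ᵥ φ 0 + P.B *ᵥ φ (-P.τ) + P.C *ᵥ φ (-(2 * P.τ)) + h 0) 2 with hR
  obtain ⟨d, hdφ⟩ : ∃ d, HasDerivWithinAt (fun t => φ t 2) d (Icc (-(2 * P.τ)) 0) 0 :=
    ⟨_, hasDerivWithinAt_pi.1 (hd 0 h0).hasDerivWithinAt 2⟩
  have hεR : ∀ ε, P.Compatible ε φ h → ε * d = R := by
    intro ε hε
    have h1 := hasDerivWithinAt_pi.1 hε 2
    simp only [E_mulVec, Matrix.cons_val] at h1
    exact (uniqueDiffOn_Icc (by linarith) 0 h0).eq_deriv _ (hdφ.const_mul ε) h1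
  -- Compatibility gives `ε * d = R` with `d` and `R` independent of `ε`. Letting such `ε` tend to
  -- `0`, or taking `ε = 0`, yields `R = 0`; `x 0 2` satisfies the same relation, by the third row
  -- at `t = 0`.
  have hR0 : R = 0 := by
    by_contra hne
    have h1 : Tendsto (fun ε : ℝ => ε * d) (𝓝[≥] 0) (𝓝 (0 * d)) :=
      (tendsto_id.mul_const d).mono_left nhdsWithin_le_nhds
    rw [zero_mul] at h1
    have h2 : ∀ᶠ ε in 𝓝[≥] (0 : ℝ), ε * d ≠ R := h1.eventually_ne (Ne.symm hne)
    obtain ⟨ε, h3, h4⟩ := (hc.and_eventually h2).exists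
    exact h4 (hεR ε h3)
  have h1 := hx.hasDeriv_apply 2 le_rfl
  simp only [Matrix.cons_val, zero_mul] at h1
  have h2 : P.rhs h x 0 2 = 0 :=
    (uniqueDiffWithinAt_Ici 0).eq_deriv _ h1 (hasDerivWithinAt_const _ _ _)
  have e1 : x (-P.τ) = φ (-P.τ) := hx.initial _ ⟨by linarith, by linarith⟩
  have e2 : x (-(2 * P.τ)) = φ (-(2 * P.τ)) := hx.initial _ ⟨le_rfl, by linarith⟩
  have e3 : R = P.rhs h x 0 2 - (P.A *ᵥ x 0) 2 + (P.A *ᵥ φ 0) 2 := by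
    simp only [hR, rhs, zero_sub, e1, e2, Pi.add_apply]
    ring
  have e4 : ∀ y : Fin 3 → ℝ, (P.A *ᵥ y) 2 = -y 2 := fun y => by
    simp [A, Matrix.mulVec, dotProduct, Fin.sum_univ_three]
  rw [hR0, h2, e4, e4] at e3
  linarith

end LayerParams

/-! ### The main theorem. -/

/-- Components of functions of bounded variation are of bounded variation, also after scaling. -/
theorem BoundedVariationOn.const_mul_apply {h : ℝ → Fin 3 → ℝ} {S : Set ℝ}
    (hh : BoundedVariationOn h S) (k : ℝ) (i : Fin 3) :
    BoundedVariationOn (fun t => k * h t i) S := by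
  have hL : LipschitzWith ‖k‖₊ (fun y : Fin 3 → ℝ => k * y i) := by
    refine LipschitzWith.of_dist_le_mul fun y z => ?_
    rw [Real.dist_eq, ← mul_sub, abs_mul, coe_nnnorm, Real.norm_eq_abs]
    exact mul_le_mul_of_nonneg_left (dist_le_pi_dist y z i) (abs_nonneg k)
  exact hL.comp_boundedVariationOn hh

theorem mainTheorem1 (P : LayerParams) (F : ℝ → ℝ) (φ : ℝ → Fin 3 → ℝ)
    (x : ℝ → ℝ → Fin 3 → ℝ)
    (hx : ∀ ε : ℝ, 0 ≤ ε → P.IsSolution ε φ (P.source F) (x ε))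
    (hφ : IsContBV φ (Icc (-(2 * P.τ)) 0))
    (hh : IsContBV (P.source F) (Ici 0)) :
    (TendstoUniformlyOn (fun ε t => x ε t 0) (fun t => x 0 t 0) (𝓝[>] 0) (Ici 0) ∧
      TendstoUniformlyOn (fun ε t => x ε t 1) (fun t => x 0 t 1) (𝓝[>] 0) (Ici 0)) ∧
    (HasContBVDeriv φ (Icc (-(2 * P.τ)) 0) → HasContBVDeriv (P.source F) (Ici 0) →
      ((∀ t ∈ P.CQ, Tendsto (fun ε => x ε t 2) (𝓝[>] 0) (𝓝 (x 0 t 2))) ∧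
        ∀ K ⊆ P.CQ, IsCompact K →
          TendstoUniformlyOn (fun ε t => x ε t 2) (fun t => x 0 t 2) (𝓝[>] 0) K) ∧
      -- the compatibility condition for `ε = 0`, or for arbitrarily small `ε > 0`
      ((∃ᶠ ε in 𝓝[≥] 0, P.Compatible ε φ (P.source F)) →
        TendstoUniformlyOn (fun ε t => x ε t 2) (fun t => x 0 t 2) (𝓝[>] 0) (Ici 0))) := by
  have hτ := P.τ_pos
  have ha₁ := P.a₁_pos.ne'
  have ha₀ := P.a₀_ne_zero
  set m := P.a₁ - P.a₂ with hm
  have hm0 : m ≠ 0 := P.a₁_sub_a₂_pos.ne'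
  have hma : m * P.a₀ ≠ 0 := mul_ne_zero hm0 ha₀
  have hF := LayerParams.isFamily hx hφ.1 hh.1
  rw [← hm] at hF
  set c := P.loopCoeffs with hc
  have hcτ : c.τ = P.τ := rfl
  have hρ : (1 + c.ρ) * m = P.a₁ := P.one_add_ρ_mul
  -- the pulse, recovered from the first component of the source
  have hfeq : (fun t => m * P.a₀ * F t) = fun t => m / P.a₁ * P.source F t 0 := by
    funext t
    simp only [LayerParams.source, Matrix.cons_val]
    field_simp
  have hf : ContinuousOn (fun t => m * P.a₀ * F t) (Ici 0) := by
    rw [hfeq]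
    exact continuousOn_const.mul (continuousOn_pi.1 hh.1 0)
  have hbv : BoundedVariationOn (fun t => m * P.a₀ * F t) (Ici 0) := by
    rw [hfeq]
    exact hh.2.const_mul_apply _ 0
  -- The three source components are `f = m a₀ F` delayed by `0`, `τ`, `2τ` and multiplied by `1 +
  -- ρ`, `(1 + s) (1 + ρ)` and, after scaling the third row, `s (1 + ρ)`.
  have hset := fun (γ : ℝ) (hγ : γ > 0) => hF.exists_settling hf hbv
    (fun t _ => by
      simp only [LayerParams.source, Matrix.cons_val]
      rw [← hρ]; ring)
    (fun t _ => by
      simp only [LayerParams.source, Matrix.cons_val, hcτ]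
      rw [← hρ, show c.s = P.a₅ - 1 from rfl]; ring)
    (fun t _ => by
      simp only [LayerParams.source, Matrix.cons_val, hcτ]
      rw [← hm, ← hρ, show c.s = P.a₅ - 1 from rfl]; field_simp) hγ
  have hfin : ∀ N, Vanishes (fun ε t => x ε t 0 - x 0 t 0) (Icc (-(2 * c.τ)) N) ∧
      Vanishes (fun ε t => x ε t 1 - x 0 t 1) (Icc (-(2 * c.τ)) N) := by
    intro N
    obtain ⟨n, hn⟩ := exists_nat_ge (N / c.τ)
    rw [div_le_iff₀ c.τ_pos] at hn
    obtain ⟨h1, h2, -⟩ := hF.vanishes_finite_time n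
    exact ⟨h1.mono (Icc_subset_Icc_right hn), h2.mono (Icc_subset_Icc_right hn)⟩
  have hsetX : ∀ γ > 0, ∃ N ≥ -(2 * c.τ), ∀ ε, 0 < ε → ε ≤ 1 → ∀ t ≥ N,
      |x ε t 0 - x ε N 0| ≤ γ := fun γ hγ => by
    obtain ⟨N, hN, h⟩ := hset γ hγ
    exact ⟨N, hN, fun ε h1 h2 t ht => (h ε h1 h2 t ht).1⟩
  have hsetZ : ∀ γ > 0, ∃ N ≥ -(2 * c.τ), ∀ ε, 0 < ε → ε ≤ 1 → ∀ t ≥ N,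
      |x ε t 1 - x ε N 1| ≤ γ := fun γ hγ => by
    obtain ⟨N, hN, h⟩ := hset γ hγ
    exact ⟨N, hN, fun ε h1 h2 t ht => (h ε h1 h2 t ht).2⟩
  have hXv := vanishes_Ici_of_settling (x := fun ε t => x ε t 0) (fun N => (hfin N).1) hsetX
  have hZv := vanishes_Ici_of_settling (x := fun ε t => x ε t 1) (fun N => (hfin N).2) hsetZ
  have hsub : Ici (0 : ℝ) ⊆ Ici (-(2 * c.τ)) := Ici_subset_Ici.2 (by linarith)
  have hdescale : ∀ S : Set ℝ, TendstoUniformlyOn (fun ε t => m * P.a₀ * x ε t 2)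
      (fun t => m * P.a₀ * x 0 t 2) (𝓝[>] 0) S →
      TendstoUniformlyOn (fun ε t => x ε t 2) (fun t => x 0 t 2) (𝓝[>] 0) S := by
    intro S hS
    have h := (Real.uniformContinuous_const_mul (x := (m * P.a₀)⁻¹)).comp_tendstoUniformlyOn hS
    simpa [Function.comp_def, ← mul_assoc, inv_mul_cancel₀ hma, mul_inv_cancel_right₀,
      inv_mul_cancel_right₀, hm0, ha₀] using h
  have hcompact : ∀ K ⊆ P.CQ, IsCompact K →
      TendstoUniformlyOn (fun ε t => x ε t 2) (fun t => x 0 t 2) (𝓝[>] 0) K := fun K hK hKc =>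
    hdescale K (hF.tendstoUniformlyOn_Q_compact hKc hK)
  refine ⟨⟨(hXv.mono hsub).tendstoUniformlyOn, (hZv.mono hsub).tendstoUniformlyOn⟩,
    fun hφd _ => ⟨⟨fun t ht => ?_, hcompact⟩, fun hcomp => ?_⟩⟩
  · exact (hcompact {t} (singleton_subset_iff.2 ht) isCompact_singleton).tendsto_at rfl
  · have h0 := LayerParams.eq_initial_of_frequently_compatible (hx 0 le_rfl) hφd.1 hcomp
    refine hdescale _ (hF.vanishes_Q hXv hZv (fun l hl => ?_) (fun l hl => ?_)
      (fun l hl => (hh.2.const_mul_apply (m * P.a₀) 2).exists_tail_abs_sub_le hl)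
      (by simp only [h0])).tendstoUniformlyOn
    · obtain ⟨N, hN, h⟩ := hsetX l hl
      exact ⟨N, hN, fun t ht => abs_sub_le_of_vanishes (x := fun ε t => x ε t 0) hXv
        (le_trans hN ht) hN fun ε h1 h2 => h ε h1 h2 t ht⟩
    · obtain ⟨N, hN, h⟩ := hsetZ l hl
      exact ⟨N, hN, fun t ht => abs_sub_le_of_vanishes (x := fun ε t => x ε t 1) hZv
        (le_trans hN ht) hN fun ε h1 h2 => h ε h1 h2 t ht⟩
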